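/- Work over $\mathbb Q$. A CDGA is a graded-commutative differential graded algebra $A=\bigoplus_{n\in\mathbb Z}A^n$ with differential of degree $+1$ (algebras concentrated in non-negative degrees are a special case); tensor products carry the Koszul signs. A relative Sullivan model of a CDGA morphism $f\colon A\to B$ is the inclusion $i\colon A\to (A\otimes\Lambda V,D)$ of the base of a relative Sullivan algebra (that is, $V$ is a graded vector space, $V=\bigcup_{k\ge 0}V(k)$ for graded subspaces $V(0)\subseteq V(1)\subseteq\cdots$, with $D(V(0))\subseteq A$ and $D(V(k+1))\subseteq A\otimes\Lambda V(k)$) together with a quasi-isomorphism $q\colon (A\otimes\Lambda V,D)\to B$ such that $q\circ i=f$. Let $\varphi\colon A\to B$ be a surjective CDGA morphism with kernel $K$. Define the following elements of $\mathbb N\cup\{\infty\}$ (each is $\infty$ if there is no such $m\geq 0$), where $\rho_m\colon A\to A/K^{m+1}$ is the projection: - $\mathrm{amsecat}(\varphi)$ is the smallest $m$ such that there are a relative Sullivan model $i\colon A\to A\otimes\Lambda V$ of $\rho_m$ and a morphism of differential graded $A$-modules $r\colon A\otimes\Lambda V\to A$ with $r\circ i=\mathrm{id}_A$; - $\mathrm{ahsecat}(\varphi)$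 is the smallest $m$ such that $H(\rho_m)$ is injective; - $\mathrm{msecat}(\varphi)$ is the smallest $m$ such that there are a relative Sullivan model $j\colon A^{\otimes m+1}\to A^{\otimes m+1}\otimes\Lambda W$ of the projection $A^{\otimes m+1}\to A^{\otimes m+1}/K^{\otimes m+1}$ and a morphism of differential graded $A^{\otimes m+1}$-modules $r\colon A^{\otimes m+1}\otimes\Lambda W\to A$ with $r\circ j=\mu$, where $\mu\colon A^{\otimes m+1}\to A$ is the multiplication, through which $A^{\otimes m+1}$ acts on $A$. For an ideal $I$ let $\mathrm{nil}\, I\in\mathbb N\cup\{\infty\}$ be the greatest $m$ with $I^m\neq 0$ (with $I^0$ the whole ring, and $\infty$ if no power vanishes). **Proposition.** Let $\varphi_i\colon A_i\to B_i$, $i=1,2$, be surjective CDGA morphisms with $H(A_1)\neq 0$ and $H(A_2)\neq 0$. Then 1. $\mathrm{amsecat}(\varphi_1\otimes\varphi_2)\ \ge\ \mathrm{amsecat}(\varphi_1)+\mathrm{ahsecat}(\varphi_2)$; 2. $\mathrm{msecat}(\varphi_1\otimes\varphi_2)\ \ge\ \mathrm{msecat}(\varphi_1)+\mathrm{nil}\,\ker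 H(\varphi_2)$. -/

import Mathlib

/-!
Commutative differential graded algebras over `ℚ` (graded over `ℤ`, differential of degree `+1`),
their quotients, tensor products and homology, relative Sullivan models, and the invariants
`amsecat`, `ahsecat`, `msecat` of a surjective morphism.
-/

open scoped TensorProduct DirectSum

universe u

noncomputable section

namespace RHT

/-- The sign `(-1)^n`, as a rational number. -/
def sgn (n : ℤ) : ℚ := ((n.negOnePow : ℤ) : ℚ)

theorem sgn_zero : sgn 0 = 1 := by simp [sgn]

theorem sgn_add (m n : ℤ) : sgn (m + n) = sgn m * sgn n := by
  simp [sgn, Int.negOnePow_add]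

theorem sgn_succ (n : ℤ) : sgn (n + 1) = - sgn n := by
  simp [sgn, Int.negOnePow_succ]

theorem sgn_sq (n : ℤ) : sgn n * sgn n = 1 := by
  rw [← sgn_add, sgn, Int.negOnePow_even _ ⟨n, rfl⟩]; simp

theorem units_smul_eq_sgn {M : Type*} [AddCommGroup M] [Module ℚ M] (n : ℤ) (x : M) :
    n.negOnePow • x = sgn n • x := by
  rw [Units.smul_def, sgn, Int.cast_smul_eq_zsmul]

/-- A commutative differential graded algebra over `ℚ`, with differential raising degree by one. -/
structure CDGA : Type (u + 1) where
  carrier : Type u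
  [ring : Ring carrier]
  [algebra : Algebra ℚ carrier]
  /-- `deg n` is the subspace of homogeneous elements of degree `n`. -/
  deg : ℤ → Submodule ℚ carrier
  [graded : GradedAlgebra deg]
  d : carrier →ₗ[ℚ] carrier
  d_mem : ∀ {n : ℤ} {a : carrier}, a ∈ deg n → d a ∈ deg (n + 1)
  d_d : ∀ a : carrier, d (d a) = 0
  leibniz : ∀ {n : ℤ} {a : carrier}, a ∈ deg n → ∀ b : carrier,
    d (a * b) = d a * b + sgn n • (a * d b)
  comm : ∀ {m n : ℤ} {a b : carrier}, a ∈ deg m → b ∈ deg n →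
    a * b = sgn (m * n) • (b * a)

namespace CDGA

instance : CoeSort CDGA.{u} (Type u) := ⟨CDGA.carrier⟩

instance (A : CDGA.{u}) : Ring A := A.ring
instance (A : CDGA.{u}) : Algebra ℚ A := A.algebra
instance (A : CDGA.{u}) : GradedAlgebra A.deg := A.graded

/-- Morphisms of CDGAs: algebra morphisms of degree zero that commute with the differentials. -/
structure Hom (A B : CDGA.{u}) where
  toAlgHom : A →ₐ[ℚ] B
  map_deg : ∀ {n : ℤ} {a : A}, a ∈ A.deg n → toAlgHom a ∈ B.deg n
  map_d : ∀ a : A, toAlgHom (A.d a) = B.d (toAlgHom a)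

instance (A B : CDGA.{u}) : CoeFun (Hom A B) (fun _ => A → B) := ⟨fun f => f.toAlgHom⟩

/-- The identity morphism. -/
def Hom.id (A : CDGA.{u}) : Hom A A where
  toAlgHom := AlgHom.id ℚ A
  map_deg h := h
  map_d _ := rfl

/-! ### The degree involution -/

section Invol

variable (A : CDGA.{u})

/-- The linear map which is multiplication by `(-1)^n` in degree `n`. -/
def invol : A →ₗ[ℚ] A :=
  (DirectSum.toModule ℚ ℤ A fun n => sgn n • (A.deg n).subtype) ∘ₗ
    (DirectSum.decomposeLinearEquiv A.deg).toLinearMap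

variable {A}

theorem invol_of_mem {n : ℤ} {a : A} (h : a ∈ A.deg n) : A.invol a = sgn n • a := by
  have := DirectSum.decomposeLinearEquiv_apply_coe A.deg n ⟨a, h⟩
  simp only [invol, LinearMap.comp_apply, LinearEquiv.coe_coe] at *
  rw [this, DirectSum.toModule_lof]; rfl

@[elab_as_elim]
theorem induction_deg {P : A → Prop} (zero : P 0)
    (homog : ∀ (n : ℤ) (a : A), a ∈ A.deg n → P a)
    (add : ∀ a b : A, P a → P b → P (a + b)) (a : A) : P a :=
  DirectSum.Decomposition.inductionOn A.deg zero (fun m => homog _ _ m.2) add a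

theorem invol_invol (a : A) : A.invol (A.invol a) = a := by
  induction a using induction_deg with
  | zero => simp
  | homog n a h => rw [invol_of_mem h, map_smul, invol_of_mem h, smul_smul, sgn_sq, one_smul]
  | add a b ha hb => simp [ha, hb]

theorem d_invol (a : A) : A.d (A.invol a) = - A.invol (A.d a) := by
  induction a using induction_deg with
  | zero => simp
  | homog n a h =>
    rw [invol_of_mem h, map_smul, invol_of_mem (A.d_mem h), sgn_succ, neg_smul, neg_neg]
  | add a b ha hb => simp [ha, hb]; abel

theorem d_mul (a b : A) : A.d (a * b) = A.d a * b + A.invol a * A.d b := by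
  induction a using induction_deg with
  | zero => simp
  | homog n a h => rw [A.leibniz h, invol_of_mem h, smul_mul_assoc]
  | add a a' ha ha' => simp only [add_mul, map_add, ha, ha']; abel

theorem d_one : A.d 1 = 0 := by
  have h := A.leibniz (SetLike.GradedOne.one_mem (A := A.deg)) (1 : A)
  rw [sgn_zero, one_smul, one_mul, one_mul, mul_one] at h
  simpa using h

theorem Hom.map_invol {A B : CDGA.{u}} (f : Hom A B) (a : A) : f (A.invol a) = B.invol (f a) := by
  induction a using induction_deg with
  | zero => simp
  | homog n a h => rw [invol_of_mem h, invol_of_mem (f.map_deg h), map_smul]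
  | add a b ha hb => simp [ha, hb]

end Invol

/-! ### Homology -/

section Homology

/-- The subalgebra of cycles. -/
def cycles (A : CDGA.{u}) : Subalgebra ℚ A where
  carrier := {a | A.d a = 0}
  mul_mem' {a b} (ha : A.d a = 0) (hb : A.d b = 0) := by simp [d_mul, ha, hb]
  add_mem' {a b} (ha : A.d a = 0) (hb : A.d b = 0) := by simp [ha, hb]
  algebraMap_mem' r := by simp [Algebra.algebraMap_eq_smul_one, d_one]

/-- The ideal of boundaries in the algebra of cycles. -/
def boundaries (A : CDGA.{u}) : Ideal A.cycles where
  carrier := {z | ∃ x : A, A.d x = z}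
  add_mem' := by
    rintro _ _ ⟨x, hx⟩ ⟨y, hy⟩
    exact ⟨x + y, by simp [hx, hy]⟩
  zero_mem' := ⟨0, by simp⟩
  smul_mem' := by
    rintro ⟨z, hz⟩ ⟨w, hw⟩ ⟨x, hx⟩
    refine ⟨A.invol z * x, ?_⟩
    have hz' : A.d z = 0 := hz
    simp only at hx
    rw [d_mul, d_invol, hz', invol_invol, hx]
    simp

instance (A : CDGA.{u}) : (boundaries A).IsTwoSided where
  mul_mem_of_left := by
    rintro ⟨w, hw⟩ ⟨z, hz⟩ ⟨x, hx⟩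
    refine ⟨x * z, ?_⟩
    have hz' : A.d z = 0 := hz
    simp only at hx
    rw [d_mul, hz', hx]
    simp

/-- The homology algebra `H(A) = ker d / im d`. -/
abbrev Homology (A : CDGA.{u}) : Type u := A.cycles ⧸ A.boundaries

/-- The morphism induced on cycles. -/
def Hom.cyclesMap {A B : CDGA.{u}} (f : Hom A B) : A.cycles →+* B.cycles :=
  ((f.toAlgHom.comp A.cycles.val).codRestrict B.cycles (fun z => by
    have hz : A.d z = 0 := z.2
    change B.d (f z) = 0
    rw [← f.map_d, hz, map_zero])).toRingHom

/-- The morphism `H(f) : H(A) → H(B)`. -/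
def Hom.homologyMap {A B : CDGA.{u}} (f : Hom A B) : A.Homology →+* B.Homology :=
  Ideal.quotientMap B.boundaries f.cyclesMap (by
    rintro ⟨z, hz⟩ ⟨x, hx⟩
    exact ⟨f x, by rw [← f.map_d, hx]; rfl⟩)

/-- Quasi-isomorphisms. -/
def Hom.QuasiIso {A B : CDGA.{u}} (f : Hom A B) : Prop := Function.Bijective f.homologyMap

end Homology

/-! ### Differential ideals and quotients -/

section Quotient

/-- A differential homogeneous two-sided ideal of a CDGA. -/
structure DGIdeal (A : CDGA.{u}) where
  toIdeal : Ideal A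
  twoSided : toIdeal.IsTwoSided
  homogeneous : ∀ (n : ℤ) {a : A}, a ∈ toIdeal → GradedAlgebra.proj A.deg n a ∈ toIdeal
  d_mem : ∀ {a : A}, a ∈ toIdeal → A.d a ∈ toIdeal

instance {A : CDGA.{u}} (I : DGIdeal A) : I.toIdeal.IsTwoSided := I.twoSided

theorem sum_proj (A : CDGA.{u}) (a : A) : ∃ s : Finset ℤ,
    a = ∑ n ∈ s, GradedAlgebra.proj A.deg n a := by
  classical
  exact ⟨_, (DirectSum.sum_support_decompose A.deg a).symm⟩

theorem proj_mem (A : CDGA.{u}) (n : ℤ) (a : A) : GradedAlgebra.proj A.deg n a ∈ A.deg n := by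
  rw [GradedAlgebra.proj_apply]; exact SetLike.coe_mem _

theorem Hom.map_proj {A B : CDGA.{u}} (f : Hom A B) (n : ℤ) (a : A) :
    f (GradedAlgebra.proj A.deg n a) = GradedAlgebra.proj B.deg n (f a) := by
  induction a using induction_deg with
  | zero => simp
  | homog m a h =>
    simp only [GradedAlgebra.proj_apply]
    by_cases hmn : m = n
    · subst hmn
      rw [DirectSum.decompose_of_mem_same _ h, DirectSum.decompose_of_mem_same _ (f.map_deg h)]
    · rw [DirectSum.decompose_of_mem_ne _ h hmn,
        DirectSum.decompose_of_mem_ne _ (f.map_deg h) hmn, map_zero]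
  | add a b ha hb => simp only [map_add, ha, hb]

theorem DGIdeal.invol_mem {A : CDGA.{u}} (I : DGIdeal A) {a : A} (h : a ∈ I.toIdeal) :
    A.invol a ∈ I.toIdeal := by
  obtain ⟨s, hs⟩ := sum_proj A a
  rw [hs, map_sum]
  refine sum_mem fun n _ => ?_
  rw [invol_of_mem (proj_mem A n a), ← algebraMap_smul A, smul_eq_mul]
  exact I.toIdeal.mul_mem_left _ (I.homogeneous n h)

/-- The kernel of a morphism. -/
def Hom.ker {A B : CDGA.{u}} (f : Hom A B) : DGIdeal A where
  toIdeal := RingHom.ker f.toAlgHom.toRingHom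
  twoSided := inferInstance
  homogeneous n {a} h := by
    change f _ = 0
    have h' : f a = 0 := h
    rw [f.map_proj, h', map_zero]
  d_mem {a} h := by
    change f _ = 0
    have h' : f a = 0 := h
    rw [f.map_d, h', map_zero]

theorem invol_mul {A : CDGA.{u}} (a b : A) : A.invol (a * b) = A.invol a * A.invol b := by
  induction a using induction_deg with
  | zero => simp
  | add a a' ha ha' => simp only [add_mul, map_add, ha, ha']
  | homog m a ha =>
    induction b using induction_deg with
    | zero => simp
    | add b b' hb hb' => simp only [mul_add, map_add, hb, hb']
    | homog n b hb =>
      rw [invol_of_mem ha, invol_of_mem hb,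
        invol_of_mem (SetLike.GradedMul.mul_mem (A := A.deg) ha hb), sgn_add, smul_mul_smul_comm]

theorem DGIdeal.pow_homogeneous {A : CDGA.{u}} (I : DGIdeal A) (m : ℕ) :
    ∀ (n : ℤ) {a : A}, a ∈ I.toIdeal ^ m → GradedAlgebra.proj A.deg n a ∈ I.toIdeal ^ m := by
  induction m with
  | zero => intro n a _; rw [Submodule.pow_zero, Ideal.one_eq_top]; trivial
  | succ m ih =>
    intro n a h
    rw [Submodule.pow_succ] at h ⊢
    refine Submodule.smul_induction_on h (fun x hx y hy => ?_) (fun x y hx hy => ?_)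
    · obtain ⟨s, hs⟩ := sum_proj A x
      obtain ⟨t, ht⟩ := sum_proj A y
      rw [hs, ht, smul_eq_mul, Finset.sum_mul_sum, map_sum]
      refine sum_mem fun i _ => ?_
      rw [map_sum]
      refine sum_mem fun j _ => ?_
      have hmem := SetLike.GradedMul.mul_mem (A := A.deg) (proj_mem A i x) (proj_mem A j y)
      rw [GradedAlgebra.proj_apply A.deg n]
      by_cases hij : i + j = n
      · subst hij
        rw [DirectSum.decompose_of_mem_same _ hmem]
        exact Submodule.smul_mem_smul (ih i hx) (I.homogeneous j hy)
      · rw [DirectSum.decompose_of_mem_ne _ hmem hij]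
        exact zero_mem _
    · rw [map_add]; exact add_mem hx hy

theorem DGIdeal.pow_invol_mem {A : CDGA.{u}} (I : DGIdeal A) (m : ℕ) :
    ∀ {a : A}, a ∈ I.toIdeal ^ m → A.invol a ∈ I.toIdeal ^ m := by
  induction m with
  | zero => intro a _; rw [Submodule.pow_zero, Ideal.one_eq_top]; trivial
  | succ m ih =>
    intro a h
    rw [Submodule.pow_succ] at h ⊢
    refine Submodule.smul_induction_on h (fun x hx y hy => ?_) (fun x y hx hy => ?_)
    · rw [smul_eq_mul, invol_mul]
      exact Submodule.smul_mem_smul (ih hx) (I.invol_mem hy)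
    · rw [map_add]; exact add_mem hx hy

theorem DGIdeal.pow_d_mem {A : CDGA.{u}} (I : DGIdeal A) (m : ℕ) :
    ∀ {a : A}, a ∈ I.toIdeal ^ m → A.d a ∈ I.toIdeal ^ m := by
  induction m with
  | zero => intro a _; rw [Submodule.pow_zero, Ideal.one_eq_top]; trivial
  | succ m ih =>
    intro a h
    rw [Submodule.pow_succ] at h ⊢
    refine Submodule.smul_induction_on h (fun x hx y hy => ?_) (fun x y hx hy => ?_)
    · rw [smul_eq_mul, d_mul]
      exact add_mem (Submodule.smul_mem_smul (ih hx) hy)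
        (Submodule.smul_mem_smul (I.pow_invol_mem m hx) (I.d_mem hy))
    · rw [map_add]; exact add_mem hx hy

/-- The power `I ^ m` of a differential ideal (`I ^ 0 = A`). -/
def DGIdeal.pow {A : CDGA.{u}} (I : DGIdeal A) (m : ℕ) : DGIdeal A where
  toIdeal := I.toIdeal ^ m
  twoSided := inferInstance
  homogeneous := I.pow_homogeneous m
  d_mem := I.pow_d_mem m

variable {A : CDGA.{u}} (I : DGIdeal A)

/-- The degree `n` part of `A / I`. -/
def DGIdeal.quotDeg (n : ℤ) : Submodule ℚ (A ⧸ I.toIdeal) :=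
  (A.deg n).map (Ideal.Quotient.mkₐ ℚ I.toIdeal).toLinearMap

/-- The projection in degree `n`. -/
def DGIdeal.quotMkDeg (n : ℤ) : A.deg n →ₗ[ℚ] I.quotDeg n :=
  (Ideal.Quotient.mkₐ ℚ I.toIdeal).toLinearMap.submoduleMap (A.deg n)

/-- Auxiliary map used to decompose `A / I` into homogeneous components. -/
def DGIdeal.preDecompose : A →ₗ[ℚ] ⨁ n, I.quotDeg n :=
  (DirectSum.lmap I.quotMkDeg) ∘ₗ (DirectSum.decomposeLinearEquiv A.deg).toLinearMap

theorem DGIdeal.preDecompose_apply (a : A) (n : ℤ) :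
    (I.preDecompose a n : A ⧸ I.toIdeal) =
      Ideal.Quotient.mk I.toIdeal (GradedAlgebra.proj A.deg n a) := by
  simp only [preDecompose, LinearMap.comp_apply, LinearEquiv.coe_coe]
  rfl

theorem DGIdeal.preDecompose_congr {a b : A}
    (h : Ideal.Quotient.mk I.toIdeal a = Ideal.Quotient.mk I.toIdeal b) :
    I.preDecompose a = I.preDecompose b := by
  refine DFinsupp.ext fun n => Subtype.ext ?_
  rw [preDecompose_apply, preDecompose_apply, Ideal.Quotient.eq, ← map_sub]
  exact I.homogeneous n (Ideal.Quotient.eq.1 h)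

theorem DGIdeal.coe_preDecompose (a : A) :
    DirectSum.coeLinearMap I.quotDeg (I.preDecompose a) = Ideal.Quotient.mk I.toIdeal a := by
  induction a using induction_deg with
  | zero => simp
  | add a b ha hb => simp only [map_add, ha, hb]
  | homog n a h =>
    have := DirectSum.decomposeLinearEquiv_apply_coe A.deg n ⟨a, h⟩
    simp only [preDecompose, LinearMap.comp_apply, LinearEquiv.coe_coe] at *
    rw [this, DirectSum.lmap_lof, DirectSum.coeLinearMap_lof]
    rfl

theorem DGIdeal.preDecompose_surjective : Function.Surjective I.preDecompose := by
  have h : Function.Surjective (DirectSum.lmap I.quotMkDeg) := by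
    rw [DirectSum.lmap_surjective]
    exact fun n => LinearMap.submoduleMap_surjective _ _
  exact h.comp (DirectSum.decomposeLinearEquiv A.deg).surjective

instance : DirectSum.Decomposition I.quotDeg where
  decompose' q := I.preDecompose (Function.surjInv Ideal.Quotient.mk_surjective q)
  left_inv q := by
    refine (I.coe_preDecompose _).trans ?_
    exact Function.surjInv_eq Ideal.Quotient.mk_surjective q
  right_inv x := by
    obtain ⟨a, rfl⟩ := I.preDecompose_surjective x
    apply I.preDecompose_congr
    refine (Function.surjInv_eq Ideal.Quotient.mk_surjective _).trans ?_
    exact I.coe_preDecompose a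

instance : SetLike.GradedMonoid I.quotDeg where
  one_mem := ⟨1, SetLike.GradedOne.one_mem, by simp⟩
  mul_mem := by
    rintro i j _ _ ⟨a, ha, rfl⟩ ⟨b, hb, rfl⟩
    exact ⟨a * b, SetLike.GradedMul.mul_mem ha hb, by simp⟩

instance : GradedAlgebra I.quotDeg where

/-- The differential of `A / I`. -/
def DGIdeal.quotD : (A ⧸ I.toIdeal) →ₗ[ℚ] (A ⧸ I.toIdeal) :=
  ((I.toIdeal.restrictScalars ℚ).mapQ (I.toIdeal.restrictScalars ℚ) A.d fun _ h => I.d_mem h)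

theorem DGIdeal.quotD_mk (a : A) :
    I.quotD (Ideal.Quotient.mk I.toIdeal a) = Ideal.Quotient.mk I.toIdeal (A.d a) := rfl

/-- The quotient CDGA `A / I`. -/
def quot (A : CDGA.{u}) (I : DGIdeal A) : CDGA.{u} where
  carrier := A ⧸ I.toIdeal
  deg := I.quotDeg
  d := I.quotD
  d_mem := by
    rintro n _ ⟨a, ha, rfl⟩
    exact ⟨A.d a, A.d_mem ha, rfl⟩
  d_d q := by
    obtain ⟨a, rfl⟩ := Ideal.Quotient.mk_surjective q
    rw [I.quotD_mk, I.quotD_mk, A.d_d, map_zero]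
  leibniz := by
    rintro n _ ⟨a, ha, rfl⟩ q
    obtain ⟨b, rfl⟩ := Ideal.Quotient.mk_surjective q
    have h := congrArg (Ideal.Quotient.mkₐ ℚ I.toIdeal) (A.leibniz ha b)
    simp only [map_add, map_mul, map_smul] at h
    exact h
  comm := by
    rintro m n _ _ ⟨a, ha, rfl⟩ ⟨b, hb, rfl⟩
    have h := congrArg (Ideal.Quotient.mkₐ ℚ I.toIdeal) (A.comm ha hb)
    simp only [map_mul, map_smul] at h
    exact h

/-- The projection `A → A / I`. -/
def quotMk (A : CDGA.{u}) (I : DGIdeal A) : Hom A (A.quot I) where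
  toAlgHom := Ideal.Quotient.mkₐ ℚ I.toIdeal
  map_deg h := ⟨_, h, rfl⟩
  map_d _ := rfl

end Quotient

/-! ### Tensor products -/

section Tensor

open GradedTensorProduct

variable (A B : CDGA.{u})

/-- The underlying algebra of `A ⊗ B`, with the Koszul sign rule
`(a ⊗ b) (a' ⊗ b') = (-1)^(|b| |a'|) aa' ⊗ bb'`. -/
abbrev TensorCarrier : Type u := A.deg ᵍ⊗[ℚ] B.deg

variable {A B}

/-- The pure tensor `a ⊗ b`. -/
abbrev tm (a : A) (b : B) : TensorCarrier A B := a ᵍ⊗ₜ[ℚ] b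

theorem add_tm (a a' : A) (b : B) : tm (a + a') b = tm a b + tm a' b := by
  simp [tm, GradedTensorProduct.tmul, TensorProduct.add_tmul]

theorem tm_add (a : A) (b b' : B) : tm a (b + b') = tm a b + tm a b' := by
  simp [tm, GradedTensorProduct.tmul, TensorProduct.tmul_add]

theorem smul_tm (r : ℚ) (a : A) (b : B) : tm (r • a) b = r • tm a b := by
  simp [tm, GradedTensorProduct.tmul, ← TensorProduct.smul_tmul']

theorem tm_smul (r : ℚ) (a : A) (b : B) : tm a (r • b) = r • tm a b := by
  simp [tm, GradedTensorProduct.tmul]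

theorem zero_tm (b : B) : tm (0 : A) b = 0 := by
  simp [tm, GradedTensorProduct.tmul]

theorem tm_zero (a : A) : tm a (0 : B) = 0 := by
  simp [tm, GradedTensorProduct.tmul]

theorem tm_mul_tm (a : A) {j k : ℤ} {b : B} (hb : b ∈ B.deg j) {a' : A} (ha' : a' ∈ A.deg k)
    (b' : B) : tm a b * tm a' b' = sgn (j * k) • tm (a * a') (b * b') := by
  rw [← units_smul_eq_sgn]
  exact tmul_coe_mul_coe_tmul A.deg B.deg a ⟨b, hb⟩ ⟨a', ha'⟩ b'

@[elab_as_elim]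
theorem tensor_induction {P : TensorCarrier A B → Prop} (zero : P 0)
    (add : ∀ x y, P x → P y → P (x + y))
    (tm : ∀ (i j : ℤ) (a : A) (b : B), a ∈ A.deg i → b ∈ B.deg j → P (tm a b))
    (x : TensorCarrier A B) : P x := by
  refine TensorProduct.induction_on (motive := P) x zero (fun a b => ?_) add
  change P (CDGA.tm a b)
  induction a using induction_deg with
  | zero => rw [zero_tm]; exact zero
  | add a a' h h' => rw [add_tm]; exact add _ _ h h'
  | homog i a ha =>
    induction b using induction_deg with
    | zero => rw [tm_zero]; exact zero
    | add b b' h h' => rw [tm_add]; exact add _ _ h h'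
    | homog j b hb => exact tm i j a b ha hb

variable (A B)

/-- The degree `n` part of `A ⊗ B`, spanned by the `a ⊗ b` with `|a| + |b| = n`. -/
def tensorDeg (n : ℤ) : Submodule ℚ (TensorCarrier A B) :=
  Submodule.span ℚ {z | ∃ i j : ℤ, i + j = n ∧ ∃ a ∈ A.deg i, ∃ b ∈ B.deg j, z = tm a b}

variable {A B}

theorem tm_mem {i j : ℤ} {a : A} {b : B} (ha : a ∈ A.deg i) (hb : b ∈ B.deg j) :
    tm a b ∈ tensorDeg A B (i + j) :=
  Submodule.subset_span ⟨i, j, rfl, a, ha, b, hb, rfl⟩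

@[elab_as_elim]
theorem tensorDeg_induction {n : ℤ} {P : (x : TensorCarrier A B) → x ∈ tensorDeg A B n → Prop}
    (zero : P 0 (zero_mem _))
    (add : ∀ x y hx hy, P x hx → P y hy → P (x + y) (add_mem hx hy))
    (smul : ∀ (r : ℚ) x hx, P x hx → P (r • x) (Submodule.smul_mem _ r hx))
    (tm : ∀ (i j : ℤ) (a : A) (b : B) (hij : i + j = n) (ha : a ∈ A.deg i) (hb : b ∈ B.deg j),
      P (tm a b) (hij ▸ tm_mem ha hb))
    {x : TensorCarrier A B} (hx : x ∈ tensorDeg A B n) : P x hx := by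
  refine Submodule.span_induction (p := fun x hx => P x hx) ?_ zero add smul hx
  rintro _ ⟨i, j, hij, a, ha, b, hb, rfl⟩
  exact tm i j a b hij ha hb

variable (A B)

/-- Auxiliary bilinear map on homogeneous components. -/
def tensorBil (i j : ℤ) : A.deg i →ₗ[ℚ] B.deg j →ₗ[ℚ] ⨁ n, tensorDeg A B n :=
  LinearMap.mk₂ ℚ
    (fun a b => DirectSum.lof ℚ ℤ (fun n => tensorDeg A B n) (i + j) ⟨tm a.1 b.1, tm_mem a.2 b.2⟩)
    (fun a a' b => by
      rw [← map_add]; congr 1; exact Subtype.ext (add_tm _ _ _))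
    (fun r a b => by
      rw [← map_smul]; exact congrArg _ (Subtype.ext (smul_tm _ _ _)))
    (fun a b b' => by
      rw [← map_add]; congr 1; exact Subtype.ext (tm_add _ _ _))
    (fun r a b => by
      rw [← map_smul]; congr 1; exact Subtype.ext (tm_smul _ _ _))

/-- Auxiliary map used to decompose `A ⊗ B` into homogeneous components. -/
def tensorDecompose : TensorCarrier A B →ₗ[ℚ] ⨁ n, tensorDeg A B n :=
  (TensorProduct.lift
    ((DirectSum.toModule ℚ ℤ (B →ₗ[ℚ] ⨁ n, tensorDeg A B n) fun i =>
      ((DirectSum.toModule ℚ ℤ (A.deg i →ₗ[ℚ] ⨁ n, tensorDeg A B n) fun j =>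
        (tensorBil A B i j).flip) ∘ₗ (DirectSum.decomposeLinearEquiv B.deg).toLinearMap).flip) ∘ₗ
      (DirectSum.decomposeLinearEquiv A.deg).toLinearMap)) ∘ₗ (of ℚ A.deg B.deg).symm.toLinearMap

variable {A B}

theorem tensorDecompose_tm {i j : ℤ} {a : A} {b : B} (ha : a ∈ A.deg i) (hb : b ∈ B.deg j) :
    tensorDecompose A B (tm a b) =
      DirectSum.lof ℚ ℤ (fun n => tensorDeg A B n) (i + j) ⟨tm a b, tm_mem ha hb⟩ := by
  have h1 := DirectSum.decomposeLinearEquiv_apply_coe A.deg i ⟨a, ha⟩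
  have h2 := DirectSum.decomposeLinearEquiv_apply_coe B.deg j ⟨b, hb⟩
  simp only [tensorDecompose, LinearMap.comp_apply, LinearEquiv.coe_coe, of_symm_of,
    TensorProduct.lift.tmul] at *
  rw [h1, DirectSum.toModule_lof, LinearMap.flip_apply, LinearMap.comp_apply, LinearEquiv.coe_coe,
    h2, DirectSum.toModule_lof]
  rfl

theorem tensorDecompose_of_mem {n : ℤ} {x : TensorCarrier A B} (hx : x ∈ tensorDeg A B n) :
    tensorDecompose A B x = DirectSum.lof ℚ ℤ (fun n => tensorDeg A B n) n ⟨x, hx⟩ := by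
  refine Submodule.span_induction (p := fun x hx => tensorDecompose A B x =
    DirectSum.lof ℚ ℤ (fun n => tensorDeg A B n) n ⟨x, hx⟩) ?_ ?_ ?_ ?_ hx
  · rintro _ ⟨i, j, rfl, a, ha, b, hb, rfl⟩
    exact tensorDecompose_tm ha hb
  · rw [map_zero]; symm; exact map_zero _
  · intro x y hx hy h h'
    rw [map_add, h, h', ← map_add]; rfl
  · intro r x hx h
    rw [map_smul, h, ← map_smul]; rfl

instance : DirectSum.Decomposition (tensorDeg A B) :=
  DirectSum.Decomposition.ofLinearMap _ (tensorDecompose A B)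
    (by
      refine LinearMap.ext fun x => ?_
      induction x using tensor_induction with
      | zero => simp
      | add x y hx hy => rw [map_add, map_add, hx, hy]
      | tm i j a b ha hb =>
        rw [LinearMap.comp_apply, tensorDecompose_tm ha hb, DirectSum.coeLinearMap_lof]; rfl)
    (by
      refine DirectSum.linearMap_ext _ fun n => LinearMap.ext fun x => ?_
      simp only [LinearMap.comp_apply, DirectSum.coeLinearMap_lof, LinearMap.id_apply]
      exact tensorDecompose_of_mem x.2)

instance : SetLike.GradedMonoid (tensorDeg A B) where
  one_mem := by
    have := tm_mem (A := A) (B := B) SetLike.GradedOne.one_mem SetLike.GradedOne.one_mem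
    exact this
  mul_mem := by
    intro m n x y hx hy
    induction hx using tensorDeg_induction with
    | zero => rw [zero_mul]; exact zero_mem _
    | add x x' _ _ h h' => rw [add_mul]; exact add_mem h h'
    | smul r x _ h => rw [smul_mul_assoc]; exact Submodule.smul_mem _ _ h
    | tm i j a b hij ha hb =>
      induction hy using tensorDeg_induction with
      | zero => rw [mul_zero]; exact zero_mem _
      | add x x' _ _ h h' => rw [mul_add]; exact add_mem h h'
      | smul r x _ h => rw [mul_smul_comm]; exact Submodule.smul_mem _ _ h
      | tm k l a' b' hkl ha' hb' =>
        rw [tm_mul_tm a hb ha' b']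
        refine Submodule.smul_mem _ _ ?_
        have := tm_mem (SetLike.GradedMul.mul_mem ha ha') (SetLike.GradedMul.mul_mem hb hb')
        rwa [show i + k + (j + l) = m + n by omega] at this

instance : GradedAlgebra (tensorDeg A B) where

variable (A B)

/-- The differential of `A ⊗ B`: `d (a ⊗ b) = da ⊗ b + (-1)^|a| a ⊗ db`. -/
def tensorD : TensorCarrier A B →ₗ[ℚ] TensorCarrier A B :=
  (of ℚ A.deg B.deg).toLinearMap ∘ₗ
    (TensorProduct.map A.d LinearMap.id + TensorProduct.map A.invol B.d) ∘ₗ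
      (of ℚ A.deg B.deg).symm.toLinearMap

variable {A B}

theorem tensorD_tm {i : ℤ} {a : A} (ha : a ∈ A.deg i) (b : B) :
    tensorD A B (tm a b) = tm (A.d a) b + sgn i • tm a (B.d b) := by
  simp [tensorD, invol_of_mem ha, ← TensorProduct.smul_tmul']

theorem sgn_cases (n : ℤ) : sgn n = 1 ∨ sgn n = -1 := mul_self_eq_one_iff.1 (sgn_sq n)

variable (A B)

/-- The tensor product of two CDGAs. -/
def tensor : CDGA.{u} where
  carrier := TensorCarrier A B
  deg := tensorDeg A B
  d := tensorD A B
  d_mem := by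
    intro n x hx
    induction hx using tensorDeg_induction with
    | zero => rw [map_zero]; exact zero_mem _
    | add x x' _ _ h h' => rw [map_add]; exact add_mem h h'
    | smul r x _ h => rw [map_smul]; exact Submodule.smul_mem _ _ h
    | tm i j a b hij ha hb =>
      rw [tensorD_tm ha]
      refine add_mem ?_ (Submodule.smul_mem _ _ ?_)
      · have := tm_mem (A.d_mem ha) hb
        rwa [show i + 1 + j = n + 1 by omega] at this
      · have := tm_mem ha (B.d_mem hb)
        rwa [show i + (j + 1) = n + 1 by omega] at this
  d_d x := by
    induction x using tensor_induction with
    | zero => simp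
    | add x y hx hy => simp only [map_add, hx, hy, add_zero]
    | tm i j a b ha hb =>
      rw [tensorD_tm ha, map_add, map_smul, tensorD_tm (A.d_mem ha), tensorD_tm ha, A.d_d, B.d_d,
        sgn_succ, zero_tm, tm_zero]
      module
  leibniz := by
    intro n x hx y
    induction hx using tensorDeg_induction with
    | zero => simp
    | add x x' _ _ h h' => simp only [add_mul, map_add, h, h', smul_add]; abel
    | smul r x _ h => 
      simp only [smul_mul_assoc, map_smul, h, smul_add, smul_smul, mul_comm]
    | tm i j a b hij ha hb =>
      induction y using tensor_induction with
      | zero => simp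
      | add x y hx hy => simp only [mul_add, map_add, hx, hy, smul_add]; abel
      | tm k l a' b' ha' hb' =>
        rw [tm_mul_tm a hb ha' b', map_smul,
          tensorD_tm (SetLike.GradedMul.mul_mem ha ha'), tensorD_tm ha, tensorD_tm ha',
          A.leibniz ha, B.leibniz hb, add_mul, mul_add, smul_mul_assoc, mul_smul_comm,
          tm_mul_tm _ hb ha', tm_mul_tm _ (B.d_mem hb) ha', tm_mul_tm _ hb (A.d_mem ha'),
          tm_mul_tm _ hb ha', ← hij, add_mul, mul_add, sgn_add, sgn_add, sgn_add, sgn_add]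
        simp only [one_mul, mul_one, add_tm, tm_add, smul_tm, tm_smul]
        rcases sgn_cases j with h | h <;> rw [h] <;> module
  comm := by
    intro m n x y hx hy
    induction hx using tensorDeg_induction with
    | zero => simp
    | add x x' _ _ h h' => simp only [add_mul, mul_add, h, h', smul_add]
    | smul r x _ h => rw [smul_mul_assoc, mul_smul_comm, h, smul_comm]
    | tm i j a b hij ha hb =>
      induction hy using tensorDeg_induction with
      | zero => simp
      | add x x' _ _ h h' => simp only [add_mul, mul_add, h, h', smul_add]
      | smul r x _ h => rw [smul_mul_assoc, mul_smul_comm, h, smul_comm]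
      | tm k l a' b' hkl ha' hb' =>
        rw [tm_mul_tm a hb ha' b', tm_mul_tm a' hb' ha b, A.comm ha ha', B.comm hb hb',
          ← hij, ← hkl, add_mul, mul_add, mul_add, sgn_add, sgn_add, sgn_add, mul_comm l i]
        simp only [smul_tm, tm_smul]
        rcases sgn_cases (i * l) with h | h <;> rw [h] <;> module

variable {A B}

/-- The pure tensor `a ⊗ b`, as an element of the CDGA `A ⊗ B`. -/
def tmul (a : A) (b : B) : A.tensor B := tm a b

theorem tensor_d_tmul (a : A) (b : B) :
    (A.tensor B).d (tmul a b) = tmul (A.d a) b + tmul (A.invol a) (B.d b) := by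
  change tensorD A B (tm a b) = tm (A.d a) b + tm (A.invol a) (B.d b)
  simp [tensorD]

variable (A B)

/-- The morphism `A → A ⊗ B`, `a ↦ a ⊗ 1`. -/
def inl : Hom A (A.tensor B) where
  toAlgHom := includeLeft A.deg B.deg
  map_deg {n a} h := by
    have := tm_mem (B := B) h SetLike.GradedOne.one_mem
    rwa [add_zero] at this
  map_d a := by
    change tm (A.d a) (1 : B) = tensorD A B (tm a 1)
    have h := tensor_d_tmul a (1 : B)
    rw [d_one] at h
    replace h : tensorD A B (tm a 1) = tm (A.d a) 1 + tm (A.invol a) (0 : B) := h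
    rw [h, tm_zero, add_zero]

/-- The morphism `B → A ⊗ B`, `b ↦ 1 ⊗ b`. -/
def inr : Hom B (A.tensor B) where
  toAlgHom := includeRight A.deg B.deg
  map_deg {n b} h := by
    have := tm_mem (A := A) SetLike.GradedOne.one_mem h
    rwa [zero_add] at this
  map_d b := by
    change tm (1 : A) (B.d b) = tensorD A B (tm 1 b)
    rw [tensorD_tm (SetLike.GradedOne.one_mem (A := A.deg)), d_one, zero_tm, zero_add, sgn_zero,
      one_smul]

variable {A B}

theorem tensorLift_aux {C : CDGA.{u}} (f : Hom A C) (g : Hom B C) ⦃i j : ℤ⦄ (a : A.deg i)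
    (b : B.deg j) : f.toAlgHom a * g.toAlgHom b =
      (-1 : ℤˣ) ^ (j * i) • (g.toAlgHom b * f.toAlgHom a) := by
  have := C.comm (f.map_deg a.2) (g.map_deg b.2)
  rw [← units_smul_eq_sgn, mul_comm i j] at this
  exact this

/-- The algebra morphism `A ⊗ B → C`, `a ⊗ b ↦ f a * g b`. -/
def tensorLiftAlgHom {C : CDGA.{u}} (f : Hom A C) (g : Hom B C) : TensorCarrier A B →ₐ[ℚ] C :=
  GradedTensorProduct.lift A.deg B.deg f.toAlgHom g.toAlgHom (tensorLift_aux f g)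

theorem tensorLiftAlgHom_tm {C : CDGA.{u}} (f : Hom A C) (g : Hom B C) (a : A) (b : B) :
    tensorLiftAlgHom f g (tm a b) = f a * g b := rfl

theorem tensorLiftAlgHom_mem {C : CDGA.{u}} (f : Hom A C) (g : Hom B C) {n : ℤ}
    {x : TensorCarrier A B} (hx : x ∈ tensorDeg A B n) : tensorLiftAlgHom f g x ∈ C.deg n := by
  induction hx using tensorDeg_induction with
  | zero => rw [map_zero]; exact zero_mem _
  | add x y _ _ h h' => rw [map_add]; exact add_mem h h'
  | smul r x _ h => rw [map_smul]; exact Submodule.smul_mem _ _ h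
  | tm i j a b hij ha hb =>
    subst hij
    exact SetLike.GradedMul.mul_mem (f.map_deg ha) (g.map_deg hb)

theorem tensorLiftAlgHom_d {C : CDGA.{u}} (f : Hom A C) (g : Hom B C) (x : TensorCarrier A B) :
    tensorLiftAlgHom f g (tensorD A B x) = C.d (tensorLiftAlgHom f g x) := by
  induction x using tensor_induction with
  | zero => simp
  | add x y h h' => rw [map_add, map_add, map_add, map_add, h, h']
  | tm i j a b ha hb =>
    rw [tensorD_tm ha, map_add, map_smul, tensorLiftAlgHom_tm, tensorLiftAlgHom_tm,
      tensorLiftAlgHom_tm, C.leibniz (f.map_deg ha), f.map_d, g.map_d]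

/-- The morphism `A ⊗ B → C`, `a ⊗ b ↦ f a * g b`. -/
def tensorLift {C : CDGA.{u}} (f : Hom A C) (g : Hom B C) : Hom (A.tensor B) C where
  toAlgHom := tensorLiftAlgHom f g
  map_deg h := tensorLiftAlgHom_mem f g h
  map_d x := tensorLiftAlgHom_d f g x

theorem tensorLift_tmul {C : CDGA.{u}} (f : Hom A C) (g : Hom B C) (a : A) (b : B) :
    tensorLift f g (tmul a b) = f a * g b := rfl

/-- Composition of morphisms. -/
def Hom.comp {A B C : CDGA.{u}} (g : Hom B C) (f : Hom A B) : Hom A C where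
  toAlgHom := g.toAlgHom.comp f.toAlgHom
  map_deg h := g.map_deg (f.map_deg h)
  map_d a := (congrArg g (f.map_d a)).trans (g.map_d _)

/-- The tensor product `f ⊗ g` of two morphisms. -/
def tensorMap {A' B' : CDGA.{u}} (f : Hom A A') (g : Hom B B') :
    Hom (A.tensor B) (A'.tensor B') :=
  tensorLift ((inl A' B').comp f) ((inr A' B').comp g)

theorem tensorMap_tmul {A' B' : CDGA.{u}} (f : Hom A A') (g : Hom B B') (a : A) (b : B) :
    tensorMap f g (tmul a b) = tmul (f a) (g b) :=
  tmul_one_mul_one_tmul A'.deg B'.deg (f a) (g b)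

/-! ### The ideal `I ⊗ J` of `A ⊗ B` -/

/-- The image of `I ⊗ J` in `A ⊗ B`: the linear span of the `x ⊗ y` with `x ∈ I`, `y ∈ J`. -/
def tensorIdealSpan (I : DGIdeal A) (J : DGIdeal B) : Submodule ℚ (TensorCarrier A B) :=
  Submodule.span ℚ {z | ∃ x ∈ I.toIdeal, ∃ y ∈ J.toIdeal, z = tm x y}

theorem tm_mem_tensorIdealSpan {I : DGIdeal A} {J : DGIdeal B} {x : A} {y : B}
    (hx : x ∈ I.toIdeal) (hy : y ∈ J.toIdeal) : tm x y ∈ tensorIdealSpan I J :=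
  Submodule.subset_span ⟨x, hx, y, hy, rfl⟩

theorem sum_tm {ι : Type*} (s : Finset ι) (x : ι → A) (y : B) :
    tm (∑ i ∈ s, x i) y = ∑ i ∈ s, tm (x i) y := by
  classical
  induction s using Finset.induction_on with
  | empty => simp [zero_tm]
  | insert i s hi h => rw [Finset.sum_insert hi, Finset.sum_insert hi, add_tm, h]

theorem tm_sum {ι : Type*} (s : Finset ι) (x : A) (y : ι → B) :
    tm x (∑ i ∈ s, y i) = ∑ i ∈ s, tm x (y i) := by
  classical
  induction s using Finset.induction_on with
  | empty => simp [tm_zero]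
  | insert i s hi h => rw [Finset.sum_insert hi, Finset.sum_insert hi, tm_add, h]

@[elab_as_elim]
theorem tensorIdeal_induction {I : DGIdeal A} {J : DGIdeal B} {P : TensorCarrier A B → Prop}
    (zero : P 0) (add : ∀ x y, P x → P y → P (x + y)) (smul : ∀ (r : ℚ) x, P x → P (r • x))
    (tm : ∀ (i j : ℤ) (x : A) (y : B), x ∈ A.deg i → y ∈ B.deg j → x ∈ I.toIdeal →
      y ∈ J.toIdeal → P (tm x y))
    {z : TensorCarrier A B} (hz : z ∈ tensorIdealSpan I J) : P z := by
  refine Submodule.span_induction (p := fun x _ => P x) ?_ zero (fun x y _ _ => add x y)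
    (fun r x _ => smul r x) hz
  rintro _ ⟨x, hx, y, hy, rfl⟩
  obtain ⟨s, hs⟩ := sum_proj A x
  obtain ⟨t, ht⟩ := sum_proj B y
  rw [hs, ht, sum_tm]
  refine Finset.sum_induction _ P add zero fun i _ => ?_
  rw [tm_sum]
  exact Finset.sum_induction _ P add zero fun j _ => tm i j _ _ (proj_mem A i x) (proj_mem B j y)
    (I.homogeneous i hx) (J.homogeneous j hy)

theorem tensorIdealSpan_mul_mem_left {I : DGIdeal A} {J : DGIdeal B} (z : TensorCarrier A B)
    {w : TensorCarrier A B} (hw : w ∈ tensorIdealSpan I J) : z * w ∈ tensorIdealSpan I J := by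
  refine tensorIdeal_induction (P := fun w => z * w ∈ tensorIdealSpan I J) ?_ ?_ ?_ ?_ hw
  · rw [mul_zero]; exact zero_mem _
  · intro x y h h'; rw [mul_add]; exact add_mem h h'
  · intro r x h; rw [mul_smul_comm]; exact Submodule.smul_mem _ _ h
  intro i j x y hi hj hx hy
  induction z using tensor_induction with
  | zero => rw [zero_mul]; exact zero_mem _
  | add z z' h h' => rw [add_mul]; exact add_mem h h'
  | tm k l a b ha hb =>
    rw [tm_mul_tm a hb hi y]
    exact Submodule.smul_mem _ _ (tm_mem_tensorIdealSpan (I.toIdeal.mul_mem_left a hx)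
      (J.toIdeal.mul_mem_left b hy))

theorem tensorIdealSpan_mul_mem_right {I : DGIdeal A} {J : DGIdeal B} (z : TensorCarrier A B)
    {w : TensorCarrier A B} (hw : w ∈ tensorIdealSpan I J) : w * z ∈ tensorIdealSpan I J := by
  refine tensorIdeal_induction (P := fun w => w * z ∈ tensorIdealSpan I J) ?_ ?_ ?_ ?_ hw
  · rw [zero_mul]; exact zero_mem _
  · intro x y h h'; rw [add_mul]; exact add_mem h h'
  · intro r x h; rw [smul_mul_assoc]; exact Submodule.smul_mem _ _ h
  intro i j x y hi hj hx hy
  induction z using tensor_induction with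
  | zero => rw [mul_zero]; exact zero_mem _
  | add z z' h h' => rw [mul_add]; exact add_mem h h'
  | tm k l a b ha hb =>
    rw [tm_mul_tm x hj ha b]
    exact Submodule.smul_mem _ _ (tm_mem_tensorIdealSpan (I.toIdeal.mul_mem_right a hx)
      (J.toIdeal.mul_mem_right b hy))

theorem tensorIdealSpan_proj_mem {I : DGIdeal A} {J : DGIdeal B} (n : ℤ)
    {w : TensorCarrier A B} (hw : w ∈ tensorIdealSpan I J) :
    GradedAlgebra.proj (tensorDeg A B) n w ∈ tensorIdealSpan I J := by
  refine tensorIdeal_induction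
    (P := fun w => GradedAlgebra.proj (tensorDeg A B) n w ∈ tensorIdealSpan I J) ?_ ?_ ?_ ?_ hw
  · rw [map_zero]; exact zero_mem _
  · intro x y h h'; rw [map_add]; exact add_mem h h'
  · intro r x h; rw [map_smul]; exact Submodule.smul_mem _ _ h
  intro i j x y hi hj hx hy
  rw [GradedAlgebra.proj_apply]
  by_cases hij : i + j = n
  · subst hij
    rw [DirectSum.decompose_of_mem_same _ (tm_mem hi hj)]
    exact tm_mem_tensorIdealSpan hx hy
  · rw [DirectSum.decompose_of_mem_ne _ (tm_mem hi hj) hij]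
    exact zero_mem _

theorem tensorIdealSpan_d_mem {I : DGIdeal A} {J : DGIdeal B}
    {w : TensorCarrier A B} (hw : w ∈ tensorIdealSpan I J) :
    tensorD A B w ∈ tensorIdealSpan I J := by
  refine tensorIdeal_induction (P := fun w => tensorD A B w ∈ tensorIdealSpan I J) ?_ ?_ ?_ ?_ hw
  · rw [map_zero]; exact zero_mem _
  · intro x y h h'; rw [map_add]; exact add_mem h h'
  · intro r x h; rw [map_smul]; exact Submodule.smul_mem _ _ h
  intro i j x y hi hj hx hy
  rw [tensorD_tm hi]
  exact add_mem (tm_mem_tensorIdealSpan (I.d_mem hx) hy)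
    (Submodule.smul_mem _ _ (tm_mem_tensorIdealSpan hx (J.d_mem hy)))

/-- The differential ideal `I ⊗ J` of `A ⊗ B`. -/
def DGIdeal.tensor (I : DGIdeal A) (J : DGIdeal B) : DGIdeal (A.tensor B) where
  toIdeal :=
    { carrier := {z : TensorCarrier A B | z ∈ tensorIdealSpan I J}
      add_mem' := fun h h' => (tensorIdealSpan I J).add_mem h h'
      zero_mem' := (tensorIdealSpan I J).zero_mem
      smul_mem' := fun z _ h => tensorIdealSpan_mul_mem_left z h }
  twoSided := ⟨fun z h => tensorIdealSpan_mul_mem_right z h⟩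
  homogeneous n _ h := tensorIdealSpan_proj_mem n h
  d_mem h := tensorIdealSpan_d_mem h

/-! ### Tensor powers -/

/-- The tensor power `A^{⊗ (m + 1)}`. -/
def tensorPow (A : CDGA.{u}) : ℕ → CDGA.{u}
  | 0 => A
  | m + 1 => (A.tensorPow m).tensor A

/-- The iterated multiplication `A^{⊗ (m + 1)} → A`. -/
def mulPow (A : CDGA.{u}) : (m : ℕ) → Hom (A.tensorPow m) A
  | 0 => Hom.id A
  | m + 1 => tensorLift (A.mulPow m) (Hom.id A)

/-- The ideal `I^{⊗ (m + 1)}` of `A^{⊗ (m + 1)}`. -/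
def DGIdeal.tensorPow {A : CDGA.{u}} (I : DGIdeal A) : (m : ℕ) → DGIdeal (A.tensorPow m)
  | 0 => I
  | m + 1 => (I.tensorPow m).tensor I

end Tensor

/-! ### Relative Sullivan models -/

section Sullivan

/-- The monomial `v^μ`, a product taken in increasing order of the indices. -/
def monomial {C : CDGA.{u}} {ι : Type u} [LinearOrder ι] (v : ι → C) (μ : ι →₀ ℕ) : C :=
  ((μ.support.sort (· ≤ ·)).map fun k => v k ^ μ k).prod

/-- `i : A → C` exhibits `C` as a relative Sullivan algebra `A ⊗ ΛV`. The graded vector space `V`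
is given by a homogeneous basis `v` adapted to an exhaustive filtration
`V(0) ⊆ V(1) ⊆ ⋯`, where `V(n)` is spanned by the `v k` with `ht k ≤ n`.
`free`: the monomials in the `v k`, with exponents at most one for generators of odd degree, form a
basis of `C` as an `A`-module, i.e. `C = A ⊗ ΛV` as algebras.
`nilpotent`: `d V(0) ⊆ A` and `d V(n + 1) ⊆ A ⊗ ΛV(n)`. -/
structure RelSullivan {A C : CDGA.{u}} (i : Hom A C) where
  ι : Type u
  [order : LinearOrder ι]
  v : ι → C
  degree : ι → ℤ
  ht : ι → ℕ
  v_mem : ∀ k, v k ∈ C.deg (degree k)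
  free : ∀ c : C, ∃! a : {μ : ι →₀ ℕ // ∀ k, Odd (degree k) → μ k ≤ 1} →₀ A,
    c = a.sum fun μ x => i x * monomial v μ.1
  nilpotent : ∀ k, C.d (v k) ∈
    Algebra.adjoin ℚ (Set.range i ∪ v '' {l | ht l < ht k})

/-- `i : A → C` is a relative Sullivan model of `f : A → B`: it is the inclusion of the base of a
relative Sullivan algebra, and `f` factors as `i` followed by a quasi-isomorphism `C → B`. -/
def IsRelSullivanModel {A B C : CDGA.{u}} (f : Hom A B) (i : Hom A C) : Prop :=
  Nonempty (RelSullivan i) ∧ ∃ q : Hom C B, q.QuasiIso ∧ ∀ a : A, q (i a) = f a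

/-- Given CDGA morphisms `f : T → M` and `g : T → N`, a morphism `M → N` of differential graded
`T`-modules (of degree zero), where `T` acts on `M` through `f` and on `N` through `g`. -/
structure ModuleHom {T M N : CDGA.{u}} (f : Hom T M) (g : Hom T N) where
  toLinearMap : M →ₗ[ℚ] N
  map_deg : ∀ {n : ℤ} {x : M}, x ∈ M.deg n → toLinearMap x ∈ N.deg n
  map_d : ∀ x : M, toLinearMap (M.d x) = N.d (toLinearMap x)
  map_act : ∀ (t : T) (x : M), toLinearMap (f t * x) = g t * toLinearMap x

/-- `f : A → B` admits a homotopy retraction of `A`-modules: there are a relative Sullivan model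
`i : A → C` of `f` and a morphism `r : C → A` of `A`-modules with `r ∘ i = id`. -/
def HasModuleHomotopyRetraction {A B : CDGA.{u}} (f : Hom A B) : Prop :=
  ∃ (C : CDGA.{u}) (i : Hom A C), IsRelSullivanModel f i ∧
    ∃ r : ModuleHom i (Hom.id A), ∀ a : A, r.toLinearMap (i a) = a

end Sullivan

/-! ### The invariants -/

section Invariants

variable {A B : CDGA.{u}} (φ : Hom A B)

/-- The projection `ρ_m : A → A / (ker φ)^(m + 1)`. -/
def rho (m : ℕ) : Hom A (A.quot (φ.ker.pow (m + 1))) := A.quotMk (φ.ker.pow (m + 1))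

/-- The smallest `m` such that `ρ_m` admits a homotopy retraction of `A`-modules (`⊤` if there is
none). -/
def amsecat : ℕ∞ := ⨅ m ∈ {m : ℕ | HasModuleHomotopyRetraction (rho φ m)}, (m : ℕ∞)

/-- The smallest `m` such that `ρ_m` is injective in homology (`⊤` if there is none). -/
def ahsecat : ℕ∞ := ⨅ m ∈ {m : ℕ | Function.Injective (rho φ m).homologyMap}, (m : ℕ∞)

/-- The projection `A^{⊗ (m + 1)} → A^{⊗ (m + 1)} / (ker φ)^{⊗ (m + 1)}`. -/
def tensorRho (m : ℕ) : Hom (A.tensorPow m) ((A.tensorPow m).quot (φ.ker.tensorPow m)) :=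
  (A.tensorPow m).quotMk (φ.ker.tensorPow m)

/-- There are a relative Sullivan model `j : A^{⊗ (m + 1)} → C` of the projection
`A^{⊗ (m + 1)} → A^{⊗ (m + 1)} / (ker φ)^{⊗ (m + 1)}` and a morphism `r : C → A` of
`A^{⊗ (m + 1)}`-modules such that `r ∘ j` is the multiplication. -/
def MsecatLE (m : ℕ) : Prop :=
  ∃ (C : CDGA.{u}) (j : Hom (A.tensorPow m) C), IsRelSullivanModel (tensorRho φ m) j ∧
    ∃ r : ModuleHom j (A.mulPow m), ∀ x : A.tensorPow m, r.toLinearMap (j x) = A.mulPow m x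

/-- The module sectional category of `φ`: the smallest `m` such that `MsecatLE φ m` (`⊤` if there
is none). -/
def msecat : ℕ∞ := ⨅ m ∈ {m : ℕ | MsecatLE φ m}, (m : ℕ∞)

/-- The nilpotency of an ideal: the greatest `m` with `I ^ m ≠ 0` (`⊤` if all powers are nonzero).
Here `I ^ 0` is the whole ring. -/
def nil {R : Type u} [Ring R] (I : Ideal R) : ℕ∞ := ⨆ m ∈ {m : ℕ | I ^ m ≠ ⊥}, (m : ℕ∞)

end Invariants

end CDGA
end RHT
end

noncomputable section

namespace RHT

/-! Let `m` be such that `φ₁ ⊗ φ₂` admits a retraction `r : C → A₁ ⊗ A₂` at level `m`, where `j : T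
→ C` is a Sullivan model of the relevant projection `T → T / J`. Write `K₁`, `K₂`, `K` for the
kernels of `φ₁`, `φ₂`, `φ₁ ⊗ φ₂`. The second factor supplies a cycle `ω` of `A₂` that is not a
boundary. If `n ≤ ahsecat φ₂`, it can be taken in `K₂ ^ n`; if the `n`-th power of `ker H(φ₂)` is
nonzero, it can be taken to be a product of `n` cycles of `K₂`.

In the first case put `κ = 1 ⊗ ω`; in the second spread the `n` cycles over the last `n` tensor
factors of `(A₁ ⊗ A₂)^{⊗ (m + 1)}`. Let `S → S / I` be the projection for `φ₁` at level `m - n`, and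
`g : S → T` the inclusion. Since `κ` is a cycle and `x ↦ g x * κ` sends `I` into `J`, this map
induces a chain map `S / I → T / J` of `S`-modules. It lifts to an `S`-linear chain map `G` from a
model of `S / I` to `C` with `G 1 = j κ`. A linear functional `ψ` on `A₂` that kills boundaries and
has `ψ ω = 1` gives an `A₁`-linear chain map `id ⊗ ψ : A₁ ⊗ A₂ → A₁`. The composite `(id ⊗ ψ) ∘ r ∘
G` sends `1` to `1`, and its degree zero part is a retraction for `φ₁` at level `m - n`.

The inequality `n ≤ m` has the same source. If `n > m`, then `κ`, or the element built from the
first `m + 1` of the cycles, lies in `J`; its image in `C` is then a boundary, and applying `(id ⊗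
ψ) ∘ r` makes `1` a boundary in `A₁`, against `H(A₁) ≠ 0`.

Two general facts carry this argument: every morphism has a relative Sullivan model
(`model_isRelSullivanModel`), and maps of modules out of this model lift through quasi-isomorphisms
(`exists_model_lift_quasiIso`). The transfer itself is `exists_retraction_of_tensor` and
`not_mem_of_retraction`. -/

theorem sgn_congr {m n : ℤ} (h : Even (m - n)) : sgn m = sgn n := by
  have h' := (Int.negOnePow_eq_iff m n).2 h
  rw [sgn, sgn, h']

namespace CDGA

/-! ### The free graded commutative algebra on a graded set -/

section FreeAlgebra

variable {ι : Type u} [LinearOrder ι]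

/-- Exponents in which the generators of odd degree occur at most once. -/
abbrev Mon (d : ι → ℤ) : Type u := {μ : ι →₀ ℕ // ∀ k, Odd (d k) → μ k ≤ 1}

/-- The degree of a monomial. -/
def monDeg (d : ι → ℤ) (μ : ι →₀ ℕ) : ℤ := μ.sum fun k m => m * d k

omit [LinearOrder ι] in
theorem monDeg_add (d : ι → ℤ) (μ ν : ι →₀ ℕ) : monDeg d (μ + ν) = monDeg d μ + monDeg d ν :=
  Finsupp.sum_add_index' (by simp) (by intros; push_cast; ring)

omit [LinearOrder ι] in
theorem monDeg_single (d : ι → ℤ) (k : ι) (m : ℕ) : monDeg d (Finsupp.single k m) = m * d k :=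
  Finsupp.sum_single_index (by simp)

omit [LinearOrder ι] in
theorem monDeg_zero (d : ι → ℤ) : monDeg d 0 = 0 := rfl

/-- The exponent of the sign in the product of two monomials. -/
def swaps (d : ι → ℤ) (μ ν : ι →₀ ℕ) : ℤ :=
  μ.sum fun k m => ν.sum fun l n => if l < k then m * n * (d k * d l) else 0

theorem swaps_add_left (d : ι → ℤ) (μ μ' ν : ι →₀ ℕ) :
    swaps d (μ + μ') ν = swaps d μ ν + swaps d μ' ν := by
  refine Finsupp.sum_add_index' (by simp) fun k m m' => ?_
  rw [← Finsupp.sum_add]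
  refine Finsupp.sum_congr fun l _ => ?_
  split_ifs
  · push_cast; ring
  · rfl

theorem swaps_add_right (d : ι → ℤ) (μ ν ν' : ι →₀ ℕ) :
    swaps d μ (ν + ν') = swaps d μ ν + swaps d μ ν' := by
  rw [swaps, swaps, swaps, ← Finsupp.sum_add]
  refine Finsupp.sum_congr fun l _ => ?_
  refine Finsupp.sum_add_index' (by simp) fun k m m' => ?_
  split_ifs
  · push_cast; ring
  · rfl

theorem swaps_zero_left (d : ι → ℤ) (ν : ι →₀ ℕ) : swaps d 0 ν = 0 := rfl

theorem swaps_zero_right (d : ι → ℤ) (μ : ι →₀ ℕ) : swaps d μ 0 = 0 := by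
  simp [swaps]

theorem swaps_single (d : ι → ℤ) (k l : ι) (m n : ℕ) :
    swaps d (Finsupp.single k m) (Finsupp.single l n) =
      if l < k then m * n * (d k * d l) else 0 := by
  rw [swaps, Finsupp.sum_single_index (by simp), Finsupp.sum_single_index (by simp)]

theorem swaps_single_of_le (d : ι → ℤ) {μ : ι →₀ ℕ} {k : ι} (n : ℕ)
    (h : ∀ l ∈ μ.support, l ≤ k) : swaps d μ (Finsupp.single k n) = 0 := by
  refine Finset.sum_eq_zero fun l hl => ?_
  dsimp only
  rw [Finsupp.sum_single_index (by simp), if_neg (h l hl).not_gt]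

/-- This is graded commutativity of monomials at the level of signs. Each pair of indices
contributes an even number: for distinct indices the transpositions on the two sides agree modulo 2,
and on the diagonal either the degree is even or the index occurs in at most one of `μ`, `ν`. -/
theorem even_swaps (d : ι → ℤ) {μ ν : ι →₀ ℕ} (h : ∀ k, Odd (d k) → (μ + ν) k ≤ 1) :
    Even (swaps d μ ν - (monDeg d μ * monDeg d ν + swaps d ν μ)) := by
  have e1 : monDeg d μ * monDeg d ν = μ.sum fun k m => ν.sum fun l n => m * n * (d k * d l) := by
    rw [monDeg, monDeg, Finsupp.sum, Finsupp.sum, Finset.sum_mul_sum]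
    exact Finset.sum_congr rfl fun k _ => Finset.sum_congr rfl fun l _ => by ring
  have e2 : swaps d ν μ =
      μ.sum fun k m => ν.sum fun l n => if k < l then m * n * (d k * d l) else 0 := by
    rw [swaps, Finsupp.sum_comm]
    exact Finsupp.sum_congr fun k _ => Finsupp.sum_congr fun l _ => by split_ifs <;> ring
  rw [e1, e2, swaps, Finsupp.sum, Finsupp.sum, Finsupp.sum, ← Finset.sum_add_distrib,
    ← Finset.sum_sub_distrib]
  refine Finset.even_sum _ fun k _ => ?_
  simp only [Finsupp.sum]
  rw [← Finset.sum_add_distrib, ← Finset.sum_sub_distrib]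
  refine Finset.even_sum _ fun l _ => ?_
  rcases lt_trichotomy k l with hkl | hkl | hkl
  · rw [if_neg hkl.not_gt, if_pos hkl]; exact ⟨-(μ k * ν l * (d k * d l)), by ring⟩
  · subst hkl
    rw [if_neg (lt_irrefl k)]
    rcases Int.even_or_odd (d k) with hk | hk
    · obtain ⟨c, hc⟩ := hk
      exact ⟨-(μ k * ν k * (d k * c)), by rw [hc]; ring⟩
    · have := h k hk
      rw [Finsupp.add_apply] at this
      have : (μ k : ℤ) * ν k = 0 := by
        rcases Nat.eq_zero_or_pos (μ k) with h0 | h0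
        · simp [h0]
        · simp [show ν k = 0 by omega]
      exact ⟨0, by rw [this]; ring⟩
  · rw [if_pos hkl, if_neg hkl.not_gt]; exact ⟨0, by ring⟩

variable (d : ι → ℤ)

/-- The underlying vector space of the free graded commutative algebra. -/
def Ext : Type u := Mon d →₀ ℚ

instance : AddCommGroup (Ext d) := inferInstanceAs (AddCommGroup (Mon d →₀ ℚ))
instance : Module ℚ (Ext d) := inferInstanceAs (Module ℚ (Mon d →₀ ℚ))

/-- The basis of admissible monomials. -/
def extBasis : Module.Basis (Mon d) ℚ (Ext d) := ⟨LinearEquiv.refl ℚ (Mon d →₀ ℚ)⟩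

open Classical in
/-- The monomial with exponent `μ`, which is zero if `μ` is not admissible. -/
def E (μ : ι →₀ ℕ) : Ext d :=
  if h : ∀ k, Odd (d k) → μ k ≤ 1 then extBasis d ⟨μ, h⟩ else 0

variable {d}

omit [LinearOrder ι] in
theorem E_coe (μ : Mon d) : E d μ.1 = extBasis d μ := dif_pos μ.2

omit [LinearOrder ι] in
theorem E_eq_zero {μ : ι →₀ ℕ} (h : ¬ ∀ k, Odd (d k) → μ k ≤ 1) : E d μ = 0 := dif_neg h

omit [LinearOrder ι] in
theorem E_add_eq_zero {μ ν : ι →₀ ℕ} (h : ¬ ∀ k, Odd (d k) → μ k ≤ 1) : E d (μ + ν) = 0 :=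
  E_eq_zero fun h' => h fun k hk => le_trans (by simp) (h' k hk)

omit [LinearOrder ι] in
@[elab_as_elim]
theorem ext_induction {P : Ext d → Prop} (zero : P 0) (add : ∀ x y, P x → P y → P (x + y))
    (smul : ∀ (r : ℚ) (μ : ι →₀ ℕ), P (r • E d μ)) (x : Ext d) : P x := by
  rw [← (extBasis d).linearCombination_repr x, Finsupp.linearCombination_apply]
  refine Finset.sum_induction _ P add zero fun μ _ => ?_
  dsimp only
  rw [← E_coe]
  exact smul _ _

variable (d) in
/-- The bilinear product. -/
def extMul : Ext d →ₗ[ℚ] Ext d →ₗ[ℚ] Ext d :=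
  (extBasis d).constr ℚ fun μ => (extBasis d).constr ℚ fun ν =>
    sgn (swaps d μ.1 ν.1) • E d (μ.1 + ν.1)

/-- Setting `E` to zero on inadmissible exponents makes the product rule hold for all exponents,
because an exponent above an inadmissible one is inadmissible. Associativity then reduces to the
biadditivity of `swaps`. -/
theorem extMul_E (μ ν : ι →₀ ℕ) :
    extMul d (E d μ) (E d ν) = sgn (swaps d μ ν) • E d (μ + ν) := by
  by_cases hμ : ∀ k, Odd (d k) → μ k ≤ 1
  · by_cases hν : ∀ k, Odd (d k) → ν k ≤ 1
    · rw [E_coe ⟨μ, hμ⟩, E_coe ⟨ν, hν⟩, extMul, Module.Basis.constr_basis,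
        Module.Basis.constr_basis]
    · rw [E_eq_zero hν, add_comm, E_add_eq_zero hν, map_zero, smul_zero]
  · rw [E_eq_zero hμ, E_add_eq_zero hμ, map_zero, smul_zero, LinearMap.zero_apply]

instance : Mul (Ext d) := ⟨fun x y => extMul d x y⟩
instance : One (Ext d) := ⟨E d 0⟩

omit [LinearOrder ι] in
theorem ext_one : (1 : Ext d) = E d 0 := rfl

theorem E_mul_E (μ ν : ι →₀ ℕ) : E d μ * E d ν = sgn (swaps d μ ν) • E d (μ + ν) := extMul_E μ ν

theorem ext_add_mul (x y z : Ext d) : (x + y) * z = x * z + y * z := by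
  change extMul d _ _ = extMul d _ _ + extMul d _ _
  rw [map_add, LinearMap.add_apply]

theorem ext_mul_add (x y z : Ext d) : x * (y + z) = x * y + x * z :=
  map_add (extMul d x) y z

theorem ext_zero_mul (x : Ext d) : 0 * x = 0 := LinearMap.map_zero₂ (extMul d) x

theorem ext_mul_zero (x : Ext d) : x * 0 = 0 := map_zero (extMul d x)

theorem ext_smul_mul (r : ℚ) (x y : Ext d) : (r • x) * y = r • (x * y) :=
  LinearMap.map_smul₂ (extMul d) r x y

theorem ext_mul_smul (r : ℚ) (x y : Ext d) : x * (r • y) = r • (x * y) :=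
  map_smul (extMul d x) r y

theorem ext_mul_assoc (x y z : Ext d) : x * y * z = x * (y * z) := by
  induction x using ext_induction with
  | zero => simp only [ext_zero_mul]
  | add x x' h h' => simp only [ext_add_mul, h, h']
  | smul r μ =>
    induction y using ext_induction with
    | zero => simp only [ext_zero_mul, ext_mul_zero]
    | add x x' h h' => simp only [ext_add_mul, ext_mul_add, h, h']
    | smul s ν =>
      induction z using ext_induction with
      | zero => simp only [ext_mul_zero]
      | add x x' h h' => simp only [ext_mul_add, h, h']
      | smul t ρ =>
        simp only [ext_smul_mul, ext_mul_smul, E_mul_E, smul_smul, swaps_add_left,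
          swaps_add_right, sgn_add, add_assoc]
        congr 1
        ring

theorem ext_one_mul (x : Ext d) : 1 * x = x := by
  induction x using ext_induction with
  | zero => rw [ext_mul_zero]
  | add x y h h' => rw [ext_mul_add, h, h']
  | smul r μ =>
    rw [ext_mul_smul, ext_one, E_mul_E, swaps_zero_left, sgn_zero, one_smul, zero_add]

theorem ext_mul_one (x : Ext d) : x * 1 = x := by
  induction x using ext_induction with
  | zero => rw [ext_zero_mul]
  | add x y h h' => rw [ext_add_mul, h, h']
  | smul r μ =>
    rw [ext_smul_mul, ext_one, E_mul_E, swaps_zero_right, sgn_zero, one_smul, add_zero]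

instance : Ring (Ext d) :=
  { (inferInstance : AddCommGroup (Ext d)), (inferInstance : Mul (Ext d)),
    (inferInstance : One (Ext d)) with
    mul_assoc := ext_mul_assoc
    one_mul := ext_one_mul
    mul_one := ext_mul_one
    left_distrib := ext_mul_add
    right_distrib := ext_add_mul
    zero_mul := ext_zero_mul
    mul_zero := ext_mul_zero }

instance : Algebra ℚ (Ext d) := Algebra.ofModule ext_smul_mul fun r x y => ext_mul_smul r x y

variable (d) in
/-- The elements of degree `n`. -/
def extDeg (n : ℤ) : Submodule ℚ (Ext d) := Submodule.span ℚ {x | ∃ μ, monDeg d μ = n ∧ x = E d μ}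

theorem E_mem (μ : ι →₀ ℕ) : E d μ ∈ extDeg d (monDeg d μ) := Submodule.subset_span ⟨μ, rfl, rfl⟩

@[elab_as_elim]
theorem extDeg_induction {n : ℤ} {P : (x : Ext d) → x ∈ extDeg d n → Prop}
    (zero : P 0 (zero_mem _))
    (add : ∀ x y hx hy, P x hx → P y hy → P (x + y) (add_mem hx hy))
    (smul : ∀ (r : ℚ) x hx, P x hx → P (r • x) (Submodule.smul_mem _ r hx))
    (E : ∀ (μ : ι →₀ ℕ) (hμ : monDeg d μ = n), P (E d μ) (hμ ▸ E_mem μ))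
    {x : Ext d} (hx : x ∈ extDeg d n) : P x hx := by
  refine Submodule.span_induction (p := fun x hx => P x hx) ?_ zero add smul hx
  rintro _ ⟨μ, hμ, rfl⟩
  exact E μ hμ

variable (d) in
/-- Auxiliary map used to decompose into homogeneous components. -/
def extDecompose : Ext d →ₗ[ℚ] ⨁ n, extDeg d n :=
  (extBasis d).constr ℚ fun μ =>
    DirectSum.lof ℚ ℤ (fun n => extDeg d n) (monDeg d μ.1) ⟨E d μ.1, E_mem μ.1⟩

theorem extDecompose_E (μ : ι →₀ ℕ) : extDecompose d (E d μ) =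
    DirectSum.lof ℚ ℤ (fun n => extDeg d n) (monDeg d μ) ⟨E d μ, E_mem μ⟩ := by
  by_cases hμ : ∀ k, Odd (d k) → μ k ≤ 1
  · have := (extBasis d).constr_basis ℚ (fun μ =>
      DirectSum.lof ℚ ℤ (fun n => extDeg d n) (monDeg d μ.1) ⟨E d μ.1, E_mem μ.1⟩) ⟨μ, hμ⟩
    rw [← E_coe] at this
    exact this
  · have h : (⟨E d μ, E_mem μ⟩ : extDeg d (monDeg d μ)) = 0 := Subtype.ext (E_eq_zero hμ)
    rw [h, E_eq_zero hμ, map_zero, map_zero]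

theorem extDecompose_of_mem {n : ℤ} {x : Ext d} (hx : x ∈ extDeg d n) :
    extDecompose d x = DirectSum.lof ℚ ℤ (fun n => extDeg d n) n ⟨x, hx⟩ := by
  refine Submodule.span_induction (p := fun x hx => extDecompose d x =
    DirectSum.lof ℚ ℤ (fun n => extDeg d n) n ⟨x, hx⟩) ?_ ?_ ?_ ?_ hx
  · rintro _ ⟨μ, rfl, rfl⟩
    exact extDecompose_E μ
  · rw [map_zero]; symm; exact map_zero _
  · intro x y hx hy h h'
    rw [map_add, h, h', ← map_add]; rfl
  · intro r x hx h
    rw [map_smul, h, ← map_smul]; rfl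

instance : DirectSum.Decomposition (extDeg d) :=
  DirectSum.Decomposition.ofLinearMap _ (extDecompose d)
    (by
      refine LinearMap.ext fun x => ?_
      induction x using ext_induction with
      | zero => simp
      | add x y hx hy => rw [map_add, map_add, hx, hy]
      | smul r μ =>
        rw [LinearMap.comp_apply, map_smul, extDecompose_E, map_smul,
          DirectSum.coeLinearMap_lof]; rfl)
    (by
      refine DirectSum.linearMap_ext _ fun n => LinearMap.ext fun x => ?_
      simp only [LinearMap.comp_apply, DirectSum.coeLinearMap_lof, LinearMap.id_apply]
      exact extDecompose_of_mem x.2)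

instance : SetLike.GradedMonoid (extDeg d) where
  one_mem := by
    have := E_mem (d := d) 0
    rwa [monDeg_zero] at this
  mul_mem := by
    intro m n x y hx hy
    induction hx using extDeg_induction with
    | zero => rw [zero_mul]; exact zero_mem _
    | add x x' _ _ h h' => rw [add_mul]; exact add_mem h h'
    | smul r x _ h => rw [smul_mul_assoc]; exact Submodule.smul_mem _ _ h
    | E μ hμ =>
      induction hy using extDeg_induction with
      | zero => rw [mul_zero]; exact zero_mem _
      | add x x' _ _ h h' => rw [mul_add]; exact add_mem h h'
      | smul r x _ h => rw [mul_smul_comm]; exact Submodule.smul_mem _ _ h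
      | E ν hν =>
        rw [E_mul_E, ← hμ, ← hν, ← monDeg_add]
        exact Submodule.smul_mem _ _ (E_mem _)

instance : GradedAlgebra (extDeg d) where

theorem E_comm (μ ν : ι →₀ ℕ) :
    E d μ * E d ν = sgn (monDeg d μ * monDeg d ν) • (E d ν * E d μ) := by
  rw [E_mul_E, E_mul_E, add_comm ν μ, smul_smul, ← sgn_add]
  by_cases h : ∀ k, Odd (d k) → (μ + ν) k ≤ 1
  · rw [sgn_congr (even_swaps d h)]
  · rw [E_eq_zero h, smul_zero, smul_zero]

variable (d) in
/-- The free graded commutative algebra on generators of degrees `d k`, with zero differential. -/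
abbrev extAlg : CDGA.{u} where
  carrier := Ext d
  deg := extDeg d
  d := 0
  d_mem _ := zero_mem _
  d_d _ := rfl
  leibniz _ _ := by simp
  comm := by
    intro m n x y hx hy
    induction hx using extDeg_induction with
    | zero => simp
    | add x x' _ _ h h' => simp only [add_mul, mul_add, h, h', smul_add]
    | smul r x _ h => rw [smul_mul_assoc, mul_smul_comm, h, smul_comm]
    | E μ hμ =>
      induction hy using extDeg_induction with
      | zero => simp
      | add x x' _ _ h h' => simp only [add_mul, mul_add, h, h', smul_add]
      | smul r x _ h => rw [smul_mul_assoc, mul_smul_comm, h, smul_comm]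
      | E ν hν => rw [E_comm, hμ, hν]

end FreeAlgebra

/-! ### Monomials and the universal property -/

section Monomial

variable {ι : Type u} [LinearOrder ι]

theorem sort_insert_max {s : Finset ι} {a : ι} (h : ∀ b ∈ s, b < a) :
    (insert a s).sort (· ≤ ·) = s.sort (· ≤ ·) ++ [a] := by
  have ha : a ∉ s := fun ha => lt_irrefl _ (h a ha)
  refine List.Perm.eq_of_pairwise' (r := (· ≤ ·)) (Finset.pairwise_sort _ _) ?_ ?_
  · rw [List.pairwise_append]
    refine ⟨Finset.pairwise_sort _ _, List.pairwise_singleton _ _, fun x hx y hy => ?_⟩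
    rw [List.mem_singleton.1 hy]
    exact (h x ((Finset.mem_sort _).1 hx)).le
  · refine (List.perm_ext_iff_of_nodup (Finset.sort_nodup _ _) ?_).2 fun x => ?_
    · refine List.nodup_append.2 ⟨Finset.sort_nodup _ _, List.nodup_singleton _, ?_⟩
      intro x hx y hy
      rw [List.mem_singleton.1 hy]
      exact (h x ((Finset.mem_sort _).1 hx)).ne
    · simp [or_comm]

variable {C : CDGA.{u}} (x : ι → C)

theorem monomial_zero : monomial x 0 = 1 := by simp [monomial]

theorem monomial_add_single {μ : ι →₀ ℕ} {a : ι} (h : ∀ l ∈ μ.support, l < a) (b : ℕ) :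
    monomial x (μ + Finsupp.single a b) = monomial x μ * x a ^ b := by
  classical
  rcases Nat.eq_zero_or_pos b with rfl | hb
  · simp
  have ha : a ∉ μ.support := fun ha => lt_irrefl _ (h a ha)
  have hsupp : (μ + Finsupp.single a b).support = insert a μ.support := by
    rw [Finsupp.support_add_eq, Finsupp.support_single _ hb.ne', Finset.union_comm,
      Finset.insert_eq]
    rw [Finsupp.support_single _ hb.ne']
    simpa using ha
  rw [monomial, hsupp, sort_insert_max h, List.map_append, List.prod_append, monomial]
  congr 2
  · refine List.map_congr_left fun k hk => ?_
    have hk' := (Finset.mem_sort _).1 hk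
    have : a ≠ k := fun hak => ha (hak ▸ hk')
    simp [this]
  · have : μ a = 0 := by simpa using ha
    simp [this]

theorem pow_deg_mem {n : ℤ} {a : C} (ha : a ∈ C.deg n) (m : ℕ) : a ^ m ∈ C.deg (m * n) := by
  have := SetLike.pow_mem_graded (A := C.deg) m ha
  rwa [nsmul_eq_mul] at this

variable {x} {d : ι → ℤ} (hx : ∀ k, x k ∈ C.deg (d k))
include hx

theorem monomial_mem (μ : ι →₀ ℕ) : monomial x μ ∈ C.deg (monDeg d μ) := by
  induction μ using Finsupp.induction_on_max with
  | zero => rw [monomial_zero, monDeg_zero]; exact SetLike.GradedOne.one_mem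
  | single_add a b f h hb ih =>
    rw [add_comm, monomial_add_single x h, monDeg_add, monDeg_single]
    exact SetLike.GradedMul.mul_mem ih (pow_deg_mem (hx a) b)

/-- Induction on the largest generator `a` of the monomial. The only case with a sign is `k < a`,
where `x k ^ b` moves past `x a ^ c`; this sign is the contribution of the pair to `swaps`. -/
theorem monomial_mul_pow (μ : ι →₀ ℕ) (k : ι) (b : ℕ) :
    monomial x μ * x k ^ b =
      sgn (swaps d μ (Finsupp.single k b)) • monomial x (μ + Finsupp.single k b) := by
  induction μ using Finsupp.induction_on_max with
  | zero =>
    rw [swaps_zero_left, sgn_zero, one_smul, monomial_add_single x (by simp)]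
  | single_add a c f h hc ih =>
    rw [add_comm _ f]
    rcases lt_trichotomy a k with hak | hak | hak
    · have h' : ∀ l ∈ (f + Finsupp.single a c).support, l < k := by
        intro l hl
        rcases Finset.mem_union.1 (Finsupp.support_add hl) with hl | hl
        · exact (h l hl).trans hak
        · rwa [Finset.mem_singleton.1 (Finsupp.support_single_subset hl)]
      rw [monomial_add_single x h', swaps_single_of_le d b fun l hl => (h' l hl).le, sgn_zero,
        one_smul]
    · subst hak
      have h' : ∀ l ∈ (f + Finsupp.single a c).support, l ≤ a := by
        intro l hl
        rcases Finset.mem_union.1 (Finsupp.support_add hl) with hl | hl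
        · exact (h l hl).le
        · rw [Finset.mem_singleton.1 (Finsupp.support_single_subset hl)]
      rw [swaps_single_of_le d b h', sgn_zero, one_smul, add_assoc, ← Finsupp.single_add,
        monomial_add_single x h, monomial_add_single x h, pow_add, mul_assoc]
    · have h' : ∀ l ∈ (f + Finsupp.single k b).support, l < a := by
        intro l hl
        rcases Finset.mem_union.1 (Finsupp.support_add hl) with hl | hl
        · exact h l hl
        · rwa [Finset.mem_singleton.1 (Finsupp.support_single_subset hl)]
      rw [monomial_add_single x h, mul_assoc,
        C.comm (pow_deg_mem (hx a) c) (pow_deg_mem (hx k) b), mul_smul_comm, ← mul_assoc (monomial x f), ih,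
        smul_mul_assoc, ← monomial_add_single x h', smul_smul, ← sgn_add, swaps_add_left,
        swaps_single, if_pos hak, add_right_comm]
      congr 2
      ring

theorem monomial_mul (μ ν : ι →₀ ℕ) :
    monomial x μ * monomial x ν = sgn (swaps d μ ν) • monomial x (μ + ν) := by
  induction ν using Finsupp.induction_on_max with
  | zero => rw [monomial_zero, swaps_zero_right, sgn_zero, one_smul, mul_one, add_zero]
  | single_add a b f h hb ih =>
    rw [add_comm _ f, monomial_add_single x h, ← mul_assoc, ih, smul_mul_assoc,
      monomial_mul_pow hx, smul_smul, ← sgn_add, swaps_add_right, add_assoc, swaps_add_left,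
      swaps_single_of_le d b fun l hl => (h l hl).le, add_zero]

omit [LinearOrder ι] in
theorem sq_eq_zero_of_odd {k : ι} (hk : Odd (d k)) : x k * x k = 0 := by
  have h := C.comm (hx k) (hx k)
  rw [show sgn (d k * d k) = -1 by
    rw [sgn, Int.negOnePow_odd _ (hk.mul hk)]; rfl] at h
  have h2 : (2 : ℚ) • (x k * x k) = 0 := by
    rw [two_smul]; nth_rewrite 1 [h]; simp
  exact (smul_eq_zero.1 h2).resolve_left two_ne_zero

/-- Up to sign a factor `x k ^ 2` can be split off on the right, and an element of odd degree
squares to zero because 2 is invertible. -/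
theorem monomial_eq_zero {μ : ι →₀ ℕ} (h : ¬ ∀ k, Odd (d k) → μ k ≤ 1) : monomial x μ = 0 := by
  push Not at h
  obtain ⟨k, hk, hμ⟩ := h
  obtain ⟨ν, rfl⟩ : ∃ ν, μ = ν + Finsupp.single k 2 :=
    ⟨μ - Finsupp.single k 2, (tsub_add_cancel_of_le (by simpa [Nat.succ_le_iff] using hμ)).symm⟩
  have h := monomial_mul_pow hx ν k 2
  rw [pow_two, sq_eq_zero_of_odd hx hk, mul_zero] at h
  refine (smul_eq_zero.1 h.symm).resolve_left fun h0 => ?_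
  have := sgn_sq (swaps d ν (Finsupp.single k 2))
  rw [h0] at this
  norm_num at this

/-- The linear map underlying `extLift`. -/
def extLiftLinear (x : ι → C) : Ext d →ₗ[ℚ] C :=
  (extBasis d).constr ℚ fun μ => monomial x μ.1

theorem extLiftLinear_E (μ : ι →₀ ℕ) : extLiftLinear x (E d μ) = monomial x μ := by
  by_cases h : ∀ k, Odd (d k) → μ k ≤ 1
  · rw [E_coe ⟨μ, h⟩, extLiftLinear, Module.Basis.constr_basis]
  · rw [E_eq_zero h, map_zero, monomial_eq_zero hx h]

/-- The algebra morphism underlying `extLift`. -/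
def extLiftAlgHom : Ext d →ₐ[ℚ] C :=
  AlgHom.ofLinearMap (extLiftLinear x)
    (by rw [ext_one, extLiftLinear_E hx, monomial_zero])
    (by
      intro a b
      induction a using ext_induction with
      | zero => simp
      | add a a' h h' => simp only [add_mul, map_add, h, h']
      | smul r μ =>
        induction b using ext_induction with
        | zero => simp
        | add b b' h h' => simp only [mul_add, map_add, h, h']
        | smul s ν =>
          simp only [smul_mul_assoc, mul_smul_comm, map_smul, E_mul_E, extLiftLinear_E hx,
            monomial_mul hx])

theorem extLiftAlgHom_mem {n : ℤ} {a : Ext d} (ha : a ∈ extDeg d n) :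
    extLiftAlgHom hx a ∈ C.deg n := by
  change extLiftLinear x a ∈ _
  induction ha using extDeg_induction with
  | zero => rw [map_zero]; exact zero_mem _
  | add a b _ _ h h' => rw [map_add]; exact add_mem h h'
  | smul r a _ h => rw [map_smul]; exact Submodule.smul_mem _ _ h
  | E μ hμ => rw [extLiftLinear_E hx, ← hμ]; exact monomial_mem hx μ

theorem extLiftAlgHom_gen (k : ι) : extLiftAlgHom hx (E d (Finsupp.single k 1)) = x k := by
  refine (extLiftLinear_E hx _).trans ?_
  have := monomial_add_single x (μ := 0) (a := k) (by simp) 1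
  rwa [zero_add, monomial_zero, one_mul, pow_one] at this

omit hx

theorem E_single_mem (k : ι) : E d (Finsupp.single k 1) ∈ (extAlg d).deg (d k) := by
  have := E_mem (d := d) (Finsupp.single k 1)
  rw [monDeg_single] at this
  simpa using this

theorem E_single_pow (a : ι) (b : ℕ) :
    (E d (Finsupp.single a 1)) ^ b = E d (Finsupp.single a b) := by
  induction b with
  | zero => rw [pow_zero, Finsupp.single_zero]; rfl
  | succ b ih =>
    rw [pow_succ, ih, E_mul_E, swaps_single, if_neg (lt_irrefl a), sgn_zero, one_smul,
      ← Finsupp.single_add]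

theorem monomial_E (μ : ι →₀ ℕ) :
    monomial (C := extAlg d) (fun k => E d (Finsupp.single k 1)) μ = E d μ := by
  induction μ using Finsupp.induction_on_max with
  | zero => rw [monomial_zero]; rfl
  | single_add a b f h hb ih =>
    rw [add_comm, monomial_add_single _ h, ih]
    have := E_single_pow (d := d) a b
    refine (congrArg (E d f * ·) this).trans ?_
    rw [E_mul_E, swaps_single_of_le d b fun l hl => (h l hl).le, sgn_zero, one_smul]

theorem map_monomial {B C : CDGA.{u}} (f : Hom B C) (x : ι → B) (μ : ι →₀ ℕ) :
    f (monomial x μ) = monomial (fun k => f (x k)) μ := by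
  rw [monomial, monomial, map_list_prod, List.map_map]
  congr 1
  refine List.map_congr_left fun k _ => ?_
  simp

end Monomial

/-! ### Algebra morphisms out of a tensor product -/

section GradedLift

variable {A B C : CDGA.{u}}

/-- The algebra morphism `a ⊗ b ↦ f a * g b` given by two degree-preserving algebra morphisms. -/
def gradedLift (f : A →ₐ[ℚ] C) (g : B →ₐ[ℚ] C) (hf : ∀ n a, a ∈ A.deg n → f a ∈ C.deg n)
    (hg : ∀ n b, b ∈ B.deg n → g b ∈ C.deg n) : A.tensor B →ₐ[ℚ] C :=
  GradedTensorProduct.lift A.deg B.deg f g fun i j a b => by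
    have := C.comm (hf _ _ a.2) (hg _ _ b.2)
    rw [← units_smul_eq_sgn, mul_comm i j] at this
    exact this

theorem gradedLift_tmul (f : A →ₐ[ℚ] C) (g : B →ₐ[ℚ] C)
    (hf : ∀ n a, a ∈ A.deg n → f a ∈ C.deg n) (hg : ∀ n b, b ∈ B.deg n → g b ∈ C.deg n)
    (a : A) (b : B) : gradedLift f g hf hg (tmul a b) = f a * g b := rfl

theorem gradedLift_mem (f : A →ₐ[ℚ] C) (g : B →ₐ[ℚ] C)
    (hf : ∀ n a, a ∈ A.deg n → f a ∈ C.deg n) (hg : ∀ n b, b ∈ B.deg n → g b ∈ C.deg n)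
    {n : ℤ} {x : A.tensor B} (hx : x ∈ (A.tensor B).deg n) :
    gradedLift f g hf hg x ∈ C.deg n := by
  refine tensorDeg_induction (P := fun x _ => gradedLift f g hf hg x ∈ C.deg n) ?_ ?_ ?_ ?_ hx
  · exact (map_zero (gradedLift f g hf hg)).symm ▸ zero_mem _
  · intro x y _ _ h h'
    exact (map_add (gradedLift f g hf hg) x y).symm ▸ add_mem h h'
  · intro r x _ h
    exact (map_smul (gradedLift f g hf hg) r x).symm ▸ Submodule.smul_mem _ r h
  · intro i j a b hij ha hb
    subst hij
    exact SetLike.GradedMul.mul_mem (hf _ _ ha) (hg _ _ hb)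

theorem tmul_eq_mul (a : A) (b : B) : tmul a b = inl A B a * inr A B b :=
  (GradedTensorProduct.tmul_one_mul_one_tmul A.deg B.deg a b).symm

theorem inl_apply (a : A) : inl A B a = tmul a 1 := rfl

theorem inr_apply (b : B) : inr A B b = tmul 1 b := rfl

theorem tmul_mul_inr (a : A) (b b' : B) : tmul a b * inr A B b' = tmul a (b * b') := by
  rw [tmul_eq_mul, mul_assoc, ← map_mul, ← tmul_eq_mul]

theorem inl_mul_tmul (a a' : A) (b : B) : inl A B a * tmul a' b = tmul (a * a') b := by
  rw [tmul_eq_mul, ← mul_assoc, ← map_mul, ← tmul_eq_mul]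

theorem tmul_mul_tmul (a : A) {j k : ℤ} {b : B} (hb : b ∈ B.deg j) {a' : A} (ha' : a' ∈ A.deg k)
    (b' : B) : tmul a b * tmul a' b' = sgn (j * k) • tmul (a * a') (b * b') :=
  tm_mul_tm a hb ha' b'

theorem tmul_add (a : A) (b b' : B) : tmul a (b + b') = tmul a b + tmul a b' := tm_add a b b'

theorem smul_tmul (r : ℚ) (a : A) (b : B) : tmul (r • a) b = r • tmul a b := smul_tm r a b

theorem tmul_smul (r : ℚ) (a : A) (b : B) : tmul a (r • b) = r • tmul a b := tm_smul r a b

theorem zero_tmul (b : B) : tmul (0 : A) b = 0 := zero_tm b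

theorem tmul_zero (a : A) : tmul a (0 : B) = 0 := tm_zero a

@[elab_as_elim]
theorem tmul_induction {P : A.tensor B → Prop} (zero : P 0) (add : ∀ x y, P x → P y → P (x + y))
    (tmul : ∀ (i j : ℤ) (a : A) (b : B), a ∈ A.deg i → b ∈ B.deg j → P (tmul a b))
    (x : A.tensor B) : P x :=
  tensor_induction (P := P) zero add tmul x

theorem tmul_deg_induction {n : ℤ} {P : A.tensor B → Prop} (zero : P 0)
    (add : ∀ x y, P x → P y → P (x + y))
    (smul : ∀ (r : ℚ) x, P x → P (r • x))
    (tmul : ∀ (i j : ℤ) (a : A) (b : B), i + j = n → a ∈ A.deg i → b ∈ B.deg j → P (tmul a b))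
    {x : A.tensor B} (hx : x ∈ (A.tensor B).deg n) : P x :=
  tensorDeg_induction (P := fun x _ => P x) zero (fun x y _ _ => add x y) (fun r x _ => smul r x)
    tmul hx

theorem tmul_mem_deg {i j : ℤ} {a : A} {b : B} (ha : a ∈ A.deg i) (hb : b ∈ B.deg j) :
    tmul a b ∈ (A.tensor B).deg (i + j) := tm_mem ha hb

/-- The linear map `a ⊗ b ↦ ψ a • b`. -/
def sliceLeft (A B : CDGA.{u}) (ψ : A →ₗ[ℚ] ℚ) : A.tensor B →ₗ[ℚ] B :=
  TensorProduct.lift ((LinearMap.lsmul ℚ B : ℚ →ₗ[ℚ] B →ₗ[ℚ] B) ∘ₗ ψ) ∘ₗ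
    (GradedTensorProduct.of ℚ A.deg B.deg).symm.toLinearMap

theorem sliceLeft_tmul (ψ : A →ₗ[ℚ] ℚ) (a : A) (b : B) :
    sliceLeft A B ψ (tmul a b) = ψ a • b := rfl

/-- The linear map `a ⊗ b ↦ ψ b • a`. -/
def sliceRight (A B : CDGA.{u}) (ψ : B →ₗ[ℚ] ℚ) : A.tensor B →ₗ[ℚ] A :=
  TensorProduct.lift ((LinearMap.lsmul ℚ A : ℚ →ₗ[ℚ] A →ₗ[ℚ] A) ∘ₗ ψ).flip ∘ₗ
    (GradedTensorProduct.of ℚ A.deg B.deg).symm.toLinearMap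

theorem sliceRight_tmul (ψ : B →ₗ[ℚ] ℚ) (a : A) (b : B) :
    sliceRight A B ψ (tmul a b) = ψ b • a := rfl

end GradedLift

/-! ### Free extensions and their derivations -/

section FreeExtension

variable {ι : Type u} [LinearOrder ι]

theorem E_add_single {d : ι → ℤ} {f : ι →₀ ℕ} {a : ι} (h : ∀ l ∈ f.support, l ≤ a) :
    E d (f + Finsupp.single a 1) = E d f * E d (Finsupp.single a 1) := by
  rw [E_mul_E, swaps_single_of_le d 1 h, sgn_zero, one_smul]

/-- Monomials are built one generator at a time in increasing order, so that appending the last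
generator costs no sign (`E_add_single`). -/
theorem exponent_induction {P : (ι →₀ ℕ) → Prop} (zero : P 0)
    (step : ∀ f a, (∀ l ∈ f.support, l ≤ a) → P f → P (f + Finsupp.single a 1)) (μ : ι →₀ ℕ) :
    P μ := by
  induction μ using Finsupp.induction_on_max with
  | zero => exact zero
  | single_add a b f h hb ih =>
    clear hb
    induction b with
    | zero => simpa using ih
    | succ b ihb =>
      rw [add_comm, Finsupp.single_add, ← add_assoc]
      rw [add_comm] at ihb
      refine step _ _ (fun l hl => ?_) ihb
      rcases Finset.mem_union.1 (Finsupp.support_add hl) with hl | hl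
      · exact (h l hl).le
      · rw [Finset.mem_singleton.1 (Finsupp.support_single_subset hl)]

variable (A : CDGA.{u}) (d : ι → ℤ)

/-- The free extension `A ⊗ ΛV`, with zero differential on `V`. -/
abbrev freeExt : CDGA.{u} := A.tensor (extAlg d)

/-- The generators of the free extension. -/
def gen (k : ι) : freeExt A d := inr A (extAlg d) (E d (Finsupp.single k 1))

variable {A d}

theorem gen_mem (k : ι) : gen A d k ∈ (freeExt A d).deg (d k) :=
  (inr A (extAlg d)).map_deg (E_single_mem k)

theorem inr_E_add_single {f : ι →₀ ℕ} {a : ι} (h : ∀ l ∈ f.support, l ≤ a) :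
    inr A (extAlg d) (E d (f + Finsupp.single a 1)) = inr A (extAlg d) (E d f) * gen A d a := by
  rw [E_add_single h]
  exact map_mul (inr A (extAlg d)).toAlgHom _ _

theorem inr_E_zero : inr A (extAlg d) (E d 0) = 1 := map_one (inr A (extAlg d)).toAlgHom

@[elab_as_elim]
theorem freeExt_span_induction {P : freeExt A d → Prop} (zero : P 0)
    (add : ∀ x y, P x → P y → P (x + y))
    (mono : ∀ a μ, P (inl A (extAlg d) a * inr A (extAlg d) (E d μ))) (x : freeExt A d) : P x := by
  induction x using tmul_induction with
  | zero => exact zero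
  | add x y h h' => exact add x y h h'
  | tmul i j a b hi hj =>
    clear hi hj
    induction b using ext_induction with
    | zero => rw [tmul_zero]; exact zero
    | add b b' h h' => rw [tmul_add]; exact add _ _ h h'
    | smul r μ => rw [tmul_smul, ← smul_tmul, tmul_eq_mul]; exact mono _ _

@[elab_as_elim]
theorem freeExt_induction {P : freeExt A d → Prop} (inl : ∀ a, P (inl A (extAlg d) a))
    (gen : ∀ k, P (gen A d k)) (add : ∀ x y, P x → P y → P (x + y))
    (mul : ∀ x y, P x → P y → P (x * y)) (x : freeExt A d) : P x := by
  induction x using freeExt_span_induction with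
  | zero => simpa using inl 0
  | add x y h h' => exact add x y h h'
  | mono a μ =>
    refine mul _ _ (inl a) ?_
    induction μ using exponent_induction with
    | zero => rw [inr_E_zero]; simpa using inl 1
    | step f a h ih => rw [inr_E_add_single h]; exact mul _ _ ih (gen a)

/-- A set of values for the generators determines an algebra morphism extending a given one. -/
def freeLift {B : CDGA.{u}} (f : Hom A B) (y : ∀ k, B.deg (d k)) : freeExt A d →ₐ[ℚ] B :=
  gradedLift f.toAlgHom (extLiftAlgHom (fun k => (y k).2)) (fun _ _ h => f.map_deg h)
    (fun _ _ h => extLiftAlgHom_mem (fun k => (y k).2) h)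

variable {B : CDGA.{u}} (f : Hom A B) (y : ∀ k, B.deg (d k))

theorem freeLift_inl (a : A) : freeLift f y (inl A (extAlg d) a) = f a := by
  rw [inl_apply, freeLift, gradedLift_tmul, map_one, mul_one]

theorem freeLift_gen (k : ι) : freeLift f y (gen A d k) = y k := by
  rw [gen, inr_apply, freeLift, gradedLift_tmul, map_one, one_mul]
  exact extLiftAlgHom_gen (fun k => (y k).2) k

theorem freeLift_mem {n : ℤ} {x : freeExt A d} (hx : x ∈ (freeExt A d).deg n) :
    freeLift f y x ∈ B.deg n := gradedLift_mem _ _ _ _ hx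

end FreeExtension

/-! ### Derivations of a free extension, obtained from algebra morphisms into dual numbers -/

section Derivation

/-- The dual numbers, on a generator of degree `-1`. -/
abbrev dualNumbers : CDGA.{u} := extAlg fun _ : PUnit.{u + 1} => -1

/-- The generator of the dual numbers. -/
def eps : dualNumbers.{u} := E _ (Finsupp.single PUnit.unit 1)

theorem eps_mem : eps ∈ dualNumbers.{u}.deg (-1) := E_single_mem (d := fun _ => -1) PUnit.unit

theorem eps_mul_eps : eps * eps = (0 : dualNumbers.{u}) :=
  sq_eq_zero_of_odd (x := fun _ : PUnit => eps) (d := fun _ => -1) (fun _ => eps_mem)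
    (k := PUnit.unit) (by decide)

/-- The coefficient of `eps`. -/
def epsCoord : dualNumbers.{u} →ₗ[ℚ] ℚ :=
  (extBasis (fun _ : PUnit.{u + 1} => (-1 : ℤ))).coord ⟨Finsupp.single PUnit.unit 1, by simp⟩

theorem epsCoord_eps : epsCoord.{u} eps = 1 := by
  have := E_coe (d := fun _ : PUnit.{u + 1} => (-1 : ℤ)) ⟨Finsupp.single PUnit.unit 1, by simp⟩
  refine (congrArg epsCoord this).trans ?_
  rw [epsCoord, Module.Basis.coord_apply, Module.Basis.repr_self, Finsupp.single_eq_same]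

theorem epsCoord_one : epsCoord.{u} 1 = 0 := by
  have := E_coe (d := fun _ : PUnit.{u + 1} => (-1 : ℤ)) ⟨0, by simp⟩
  refine (congrArg epsCoord this).trans ?_
  rw [epsCoord, Module.Basis.coord_apply, Module.Basis.repr_self,
    Finsupp.single_eq_of_ne]
  intro h
  have := congrArg (fun x => x.1 PUnit.unit) h
  simp at this

variable {T : CDGA.{u}}

/-- As `eps` has odd degree, moving `x` past it produces the degree involution. This is the sign of
the graded Leibniz rule. -/
theorem inr_mul_tmul_eps (x y : T) :
    inr dualNumbers T x * tmul eps y = tmul eps (T.invol x * y) := by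
  induction x using induction_deg with
  | zero => simp only [map_zero, zero_mul, tmul_zero]
  | add x x' h h' => simp only [map_add, add_mul, h, h', tmul_add]
  | homog n x hx =>
    rw [inr_apply, tmul_mul_tmul _ hx eps_mem, one_mul, invol_of_mem hx, smul_mul_assoc,
      tmul_smul, sgn_congr (n := n) ⟨-n, by ring⟩]

theorem tmul_eps_mul_tmul_eps (x y : T) :
    (tmul eps x * tmul eps y : dualNumbers.tensor T) = 0 := by
  rw [tmul_eq_mul, mul_assoc, inr_mul_tmul_eps, inl_mul_tmul, eps_mul_eps, zero_tmul]

variable {ι : Type u} [LinearOrder ι] {A : CDGA.{u}} {d : ι → ℤ}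
  (θ : ∀ k, (freeExt A d).deg (d k + 1))

/-- The degree `-1` of `eps` compensates the degree `+1` of the derivation, so the universal
property of the free extension applies to these values. -/
theorem dual_gen_mem (k : ι) :
    inr dualNumbers (freeExt A d) (gen A d k) + tmul eps (θ k : freeExt A d) ∈
      (dualNumbers.tensor (freeExt A d)).deg (d k) := by
  refine add_mem ((inr _ _).map_deg (gen_mem k)) ?_
  have := tmul_mem_deg eps_mem (θ k).2
  rwa [show -1 + (d k + 1) = d k by ring] at this

/-- The algebra morphism `x ↦ x + ε δ x`, where `δ` is the derivation with values `θ`. -/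
def dualLift : freeExt A d →ₐ[ℚ] dualNumbers.tensor (freeExt A d) :=
  freeLift ((inr dualNumbers (freeExt A d)).comp (inl A (extAlg d)))
    fun k => ⟨_, dual_gen_mem θ k⟩

/-- The derivation of the free extension that vanishes on `A` and has values `θ` on the
generators. -/
def freeDer : freeExt A d →ₗ[ℚ] freeExt A d :=
  sliceLeft dualNumbers (freeExt A d) epsCoord ∘ₗ (dualLift θ).toLinearMap

theorem freeDer_eq_of_dualLift {x y : freeExt A d}
    (h : dualLift θ x = inr dualNumbers (freeExt A d) x + tmul eps y) : freeDer θ x = y := by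
  change sliceLeft dualNumbers (freeExt A d) epsCoord (dualLift θ x) = y
  rw [h, map_add, inr_apply, sliceLeft_tmul, sliceLeft_tmul, epsCoord_eps, epsCoord_one, zero_smul,
    zero_add, one_smul]

theorem dual_mul (x x' y y' : T) :
    (inr dualNumbers T x + tmul eps x') * (inr dualNumbers T y + tmul eps y') =
      inr dualNumbers T (x * y) + tmul eps (x' * y + T.invol x * y') := by
  rw [add_mul, mul_add, mul_add, tmul_eps_mul_tmul_eps, tmul_mul_inr, inr_mul_tmul_eps, map_mul,
    tmul_add]
  abel

theorem dualLift_inl (a : A) : dualLift θ (inl A (extAlg d) a) =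
    inr dualNumbers (freeExt A d) (inl A (extAlg d) a) + tmul eps 0 := by
  rw [dualLift, freeLift_inl, tmul_zero, add_zero]
  rfl

theorem dualLift_gen (k : ι) : dualLift θ (gen A d k) =
    inr dualNumbers (freeExt A d) (gen A d k) + tmul eps (θ k : freeExt A d) := by
  rw [dualLift, freeLift_gen]

/-- Elements of the form `x + ε x'` are closed under sums and products by `dual_mul`, and the values
on `A` and on the generators have this form. Multiplicativity of `dualLift` then becomes the Leibniz
rule for `freeDer`. -/
theorem dualLift_apply (x : freeExt A d) :
    dualLift θ x = inr dualNumbers (freeExt A d) x + tmul eps (freeDer θ x) := by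
  suffices h : ∃ y, dualLift θ x = inr dualNumbers (freeExt A d) x + tmul eps y by
    obtain ⟨y, hy⟩ := h
    rw [hy, freeDer_eq_of_dualLift θ hy]
  induction x using freeExt_induction with
  | inl a => exact ⟨_, dualLift_inl θ a⟩
  | gen k => exact ⟨_, dualLift_gen θ k⟩
  | add x y h h' =>
    obtain ⟨x', hx⟩ := h
    obtain ⟨y', hy⟩ := h'
    refine ⟨x' + y', ?_⟩
    rw [map_add, map_add, hx, hy, tmul_add]
    abel
  | mul x y h h' =>
    obtain ⟨x', hx⟩ := h
    obtain ⟨y', hy⟩ := h'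
    exact ⟨_, by rw [map_mul, hx, hy, dual_mul]⟩

theorem freeDer_mul (x y : freeExt A d) :
    freeDer θ (x * y) = freeDer θ x * y + (freeExt A d).invol x * freeDer θ y :=
  freeDer_eq_of_dualLift θ (by rw [map_mul, dualLift_apply, dualLift_apply, dual_mul])

theorem freeDer_inl (a : A) : freeDer θ (inl A (extAlg d) a) = 0 :=
  freeDer_eq_of_dualLift θ (dualLift_inl θ a)

theorem freeDer_gen (k : ι) : freeDer θ (gen A d k) = θ k :=
  freeDer_eq_of_dualLift θ (dualLift_gen θ k)

theorem invol_mem_deg {n : ℤ} {x : T} (hx : x ∈ T.deg n) : T.invol x ∈ T.deg n := by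
  rw [invol_of_mem hx]; exact Submodule.smul_mem _ _ hx

theorem freeDer_inr_E_mem (μ : ι →₀ ℕ) :
    freeDer θ (inr A (extAlg d) (E d μ)) ∈ (freeExt A d).deg (monDeg d μ + 1) := by
  induction μ using exponent_induction with
  | zero =>
    rw [inr_E_zero]
    have := freeDer_inl θ 1
    rw [map_one] at this
    rw [this]
    exact zero_mem _
  | step f a h ih =>
    rw [inr_E_add_single h, freeDer_mul, freeDer_gen, monDeg_add, monDeg_single]
    refine add_mem ?_ ?_
    · have := SetLike.GradedMul.mul_mem ih (gen_mem (A := A) a)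
      rwa [show monDeg d f + 1 + d a = monDeg d f + ((1 : ℕ) : ℤ) * d a + 1 by push_cast; ring]
        at this
    · have := SetLike.GradedMul.mul_mem
        (invol_mem_deg ((inr A (extAlg d)).map_deg (E_mem (d := d) f))) (θ a).2
      rwa [show monDeg d f + (d a + 1) = monDeg d f + ((1 : ℕ) : ℤ) * d a + 1 by push_cast; ring]
        at this

theorem freeDer_mem {n : ℤ} {x : freeExt A d} (hx : x ∈ (freeExt A d).deg n) :
    freeDer θ x ∈ (freeExt A d).deg (n + 1) := by
  refine tmul_deg_induction
    (P := fun x => freeDer θ x ∈ (freeExt A d).deg (n + 1)) ?_ ?_ ?_ ?_ hx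
  · rw [map_zero]; exact zero_mem _
  · intro x y h h'; rw [map_add]; exact add_mem h h'
  · intro r x h; rw [map_smul]; exact Submodule.smul_mem _ _ h
  · intro i j a b hij ha hb
    rw [tmul_eq_mul, freeDer_mul, freeDer_inl, zero_mul, zero_add, ← hij, add_assoc]
    refine SetLike.GradedMul.mul_mem (invol_mem_deg ((inl A (extAlg d)).map_deg ha)) ?_
    refine extDeg_induction (P := fun b _ => freeDer θ (inr A (extAlg d) b) ∈ _) ?_ ?_ ?_ ?_ hb
    · rw [map_zero, map_zero]; exact zero_mem _
    · intro x y _ _ h h'; rw [map_add, map_add]; exact add_mem h h'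
    · intro r x _ h; rw [map_smul, map_smul]; exact Submodule.smul_mem _ _ h
    · rintro μ rfl; exact freeDer_inr_E_mem θ μ

/-- The derivation of the free extension that extends the differential of `A` and has values `θ` on
the generators. -/
def freeD : freeExt A d →ₗ[ℚ] freeExt A d := (freeExt A d).d + freeDer θ

theorem freeD_mul (x y : freeExt A d) :
    freeD θ (x * y) = freeD θ x * y + (freeExt A d).invol x * freeD θ y := by
  simp only [freeD, LinearMap.add_apply]
  rw [freeDer_mul, d_mul, add_mul, mul_add]
  abel

theorem freeD_inl (a : A) : freeD θ (inl A (extAlg d) a) = inl A (extAlg d) (A.d a) := by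
  rw [freeD, LinearMap.add_apply, freeDer_inl, add_zero, Hom.map_d]

theorem freeD_gen (k : ι) : freeD θ (gen A d k) = θ k := by
  rw [freeD, LinearMap.add_apply, freeDer_gen, gen, ← Hom.map_d]
  exact (congrArg (· + (θ k : freeExt A d)) (map_zero (inr A (extAlg d)).toAlgHom)).trans
    (zero_add _)

theorem freeD_mem {n : ℤ} {x : freeExt A d} (hx : x ∈ (freeExt A d).deg n) :
    freeD θ x ∈ (freeExt A d).deg (n + 1) :=
  add_mem ((freeExt A d).d_mem hx) (freeDer_mem θ hx)

theorem freeD_invol (x : freeExt A d) :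
    freeD θ ((freeExt A d).invol x) = - (freeExt A d).invol (freeD θ x) := by
  induction x using induction_deg with
  | zero => simp
  | homog n a h =>
    rw [invol_of_mem h, map_smul, invol_of_mem (freeD_mem θ h), sgn_succ, neg_smul, neg_neg]
  | add a b ha hb => simp only [map_add, ha, hb, neg_add]

/-- In the square of an odd derivation the two cross terms cancel, so the square is again a
derivation and it suffices to test it on `A` and on the generators. -/
theorem freeD_freeD (h : ∀ k, freeD θ (θ k : freeExt A d) = 0) (x : freeExt A d) :
    freeD θ (freeD θ x) = 0 := by
  induction x using freeExt_induction with
  | inl a => rw [freeD_inl, freeD_inl, A.d_d, map_zero]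
  | gen k => rw [freeD_gen, h]
  | add x y h h' => rw [map_add, map_add, h, h', add_zero]
  | mul x y h h' =>
    rw [freeD_mul, map_add, freeD_mul, freeD_mul, h, h', freeD_invol, invol_invol]
    simp

/-- The extension `A ⊗ ΛV` whose differential has values `θ` on the generators. -/
def twist (h : ∀ k, freeD θ (θ k : freeExt A d) = 0) : CDGA.{u} where
  carrier := freeExt A d
  deg := (freeExt A d).deg
  d := freeD θ
  d_mem := freeD_mem θ
  d_d := freeD_freeD θ h
  leibniz ha b := by rw [freeD_mul, invol_of_mem ha, smul_mul_assoc]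
  comm := (freeExt A d).comm

/-- The inclusion of the base of `A ⊗ ΛV`. -/
def twistIncl (h : ∀ k, freeD θ (θ k : freeExt A d) = 0) : Hom A (twist θ h) where
  toAlgHom := (inl A (extAlg d)).toAlgHom
  map_deg := (inl A (extAlg d)).map_deg
  map_d a := (freeD_inl θ a).symm

/-- The morphism out of `A ⊗ ΛV` determined by the images of the generators. -/
def twistLift (h : ∀ k, freeD θ (θ k : freeExt A d) = 0) {B : CDGA.{u}} (f : Hom A B)
    (y : ∀ k, B.deg (d k)) (hy : ∀ k, freeLift f y (θ k : freeExt A d) = B.d (y k)) :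
    Hom (twist θ h) B where
  toAlgHom := freeLift f y
  map_deg := freeLift_mem f y
  map_d x := by
    change freeLift f y (freeD θ x) = B.d (freeLift f y x)
    have hinv : ∀ x, freeLift f y ((freeExt A d).invol x) = B.invol (freeLift f y x) := by
      intro x
      induction x using induction_deg with
      | zero => simp only [map_zero]
      | homog n a h =>
        rw [invol_of_mem h, invol_of_mem (freeLift_mem f y h), map_smul]
      | add a b ha hb => simp only [map_add, ha, hb]
    refine freeExt_induction (P := fun x => freeLift f y (freeD θ x) = B.d (freeLift f y x))
      ?_ ?_ ?_ ?_ x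
    · intro a; rw [freeD_inl, freeLift_inl, freeLift_inl, f.map_d]
    · intro k; rw [freeD_gen, freeLift_gen, hy]
    · intro x y h h'; rw [map_add, map_add, h, h', map_add, map_add]
    · intro x y h h'
      rw [freeD_mul, map_add, map_mul, map_mul, map_mul, d_mul, h, h', hinv]

end Derivation

/-! ### Lower parts of a free extension -/

section Lower

variable {ι : Type u} [LinearOrder ι] {A : CDGA.{u}} {d : ι → ℤ}

variable (A d) in
/-- The subalgebra generated by `A` and the generators in `s`. -/
def lower (s : Set ι) : Subalgebra ℚ (freeExt A d) :=
  Algebra.adjoin ℚ (Set.range (inl A (extAlg d)) ∪ gen A d '' s)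

theorem inl_mem_lower (s : Set ι) (a : A) : inl A (extAlg d) a ∈ lower A d s :=
  Algebra.subset_adjoin (Or.inl ⟨a, rfl⟩)

theorem gen_mem_lower {s : Set ι} {k : ι} (hk : k ∈ s) : gen A d k ∈ lower A d s :=
  Algebra.subset_adjoin (Or.inr ⟨k, hk, rfl⟩)

@[elab_as_elim]
theorem lower_induction {s : Set ι} {P : freeExt A d → Prop} (inl : ∀ a, P (inl A (extAlg d) a))
    (gen : ∀ k ∈ s, P (gen A d k)) (add : ∀ x y, P x → P y → P (x + y))
    (mul : ∀ x y, P x → P y → P (x * y)) {x : freeExt A d} (hx : x ∈ lower A d s) : P x := by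
  refine Algebra.adjoin_induction (p := fun x _ => P x) ?_ ?_ (fun x y _ _ => add x y)
    (fun x y _ _ => mul x y) hx
  · rintro _ (⟨a, rfl⟩ | ⟨k, hk, rfl⟩)
    exacts [inl a, gen k hk]
  · intro r
    have := inl (algebraMap ℚ A r)
    rwa [AlgHom.commutes] at this

theorem freeD_congr {s : Set ι} {θ θ' : ∀ k, (freeExt A d).deg (d k + 1)}
    (h : ∀ k ∈ s, θ k = θ' k) {x : freeExt A d} (hx : x ∈ lower A d s) :
    freeD θ x = freeD θ' x := by
  refine lower_induction (P := fun x => freeD θ x = freeD θ' x) ?_ ?_ ?_ ?_ hx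
  · intro a; rw [freeD_inl, freeD_inl]
  · intro k hk; rw [freeD_gen, freeD_gen, h k hk]
  · intro x y h h'; rw [map_add, map_add, h, h']
  · intro x y h h'; rw [freeD_mul, freeD_mul, h, h']

theorem freeLift_congr {s : Set ι} {B : CDGA.{u}} (f : Hom A B) {y y' : ∀ k, B.deg (d k)}
    (h : ∀ k ∈ s, y k = y' k) {x : freeExt A d} (hx : x ∈ lower A d s) :
    freeLift f y x = freeLift f y' x := by
  refine lower_induction (P := fun x => freeLift f y x = freeLift f y' x) ?_ ?_ ?_ ?_ hx
  · intro a; rw [freeLift_inl, freeLift_inl]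
  · intro k hk; rw [freeLift_gen, freeLift_gen, h k hk]
  · intro x y h h'; rw [map_add, map_add, h, h']
  · intro x y h h'; rw [map_mul, map_mul, h, h']

/-- Every element of the free extension is a polynomial in the generators. -/
theorem exists_polynomial (z : freeExt A d) : ∃ L : List (A × List ι),
    z = (L.map fun p => inl A (extAlg d) p.1 * (p.2.map (gen A d)).prod).sum := by
  induction z using freeExt_span_induction with
  | zero => exact ⟨[], rfl⟩
  | add x y h h' =>
    obtain ⟨L, rfl⟩ := h
    obtain ⟨L', rfl⟩ := h'
    exact ⟨L ++ L', by rw [List.map_append, List.sum_append]⟩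
  | mono a μ =>
    suffices h : ∃ l : List ι, inr A (extAlg d) (E d μ) = (l.map (gen A d)).prod by
      obtain ⟨l, hl⟩ := h
      exact ⟨[(a, l)], by rw [hl, List.map_singleton, List.sum_singleton]⟩
    induction μ using exponent_induction with
    | zero => exact ⟨[], inr_E_zero⟩
    | step f k h ih =>
      obtain ⟨l, hl⟩ := ih
      exact ⟨l ++ [k], by rw [inr_E_add_single h, hl, List.map_append, List.prod_append,
        List.map_singleton, List.prod_singleton]⟩

end Lower

/-! ### The generators of the model -/

section Generators

/-- Formal generators, each with a degree, a target in `β` and a polynomial over `α` in earlier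
generators. -/
inductive Cell (α β : Type u) : Type u
  -- The data encode a sum of terms `c i * ∏ w i j`. No condition can be imposed at this stage,
  -- since the algebra in which the polynomial lives is itself generated by the cells.
  | mk (n : ℤ) (y : β) (s : ℕ) (c : Fin s → α) (l : Fin s → ℕ) (w : (i : Fin s) → Fin (l i) →
      Cell α β) : Cell α β

variable {α β : Type u}

/-- The degree of a formal generator. -/
def Cell.deg : Cell α β → ℤ
  | mk n _ _ _ _ _ => n

/-- The target of a formal generator. -/
def Cell.target : Cell α β → β
  | mk _ y _ _ _ _ => y

/-- The nesting depth of a formal generator. -/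
def Cell.ht : Cell α β → ℕ
  | mk _ _ _ _ _ w => (Finset.univ.sup fun i => Finset.univ.sup fun j => (w i j).ht) + 1

open Classical in
instance : LinearOrder (Cell α β) := linearOrderOfSTO WellOrderingRel

variable {A B : CDGA.{u}}

variable (A B) in
/-- The free extension of `A` by all formal generators. -/
abbrev cellExt : CDGA.{u} := freeExt A (Cell.deg (α := A) (β := B))

/-- The polynomial of a formal generator. -/
def Cell.eval : Cell A B → cellExt A B
  | mk _ _ s c l w => ∑ i : Fin s, inl A (extAlg Cell.deg) (c i) *
      (List.ofFn fun j : Fin (l i) => gen A Cell.deg (w i j)).prod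

theorem Cell.eval_mem (g : Cell A B) : g.eval ∈ lower A Cell.deg {g' | g'.ht < g.ht} := by
  obtain ⟨n, y, s, c, l, w⟩ := g
  refine sum_mem fun i _ => mul_mem (inl_mem_lower _ _) (Subalgebra.list_prod_mem _ fun x hx => ?_)
  obtain ⟨j, rfl⟩ := (List.mem_ofFn' _ _).1 hx
  refine gen_mem_lower ?_
  change (w i j).ht < Cell.ht _
  rw [Cell.ht, Nat.lt_succ_iff]
  exact (Finset.le_sup (f := fun j => (w i j).ht) (Finset.mem_univ j)).trans
    (Finset.le_sup (f := fun i => Finset.univ.sup fun j => (w i j).ht) (Finset.mem_univ i))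

/-- Polynomials in cells of every depth are themselves data for cells, so the usual stage-by-stage
attachment of generators closes up within one inductive type. -/
theorem exists_cell (n : ℤ) (y : B) (z : cellExt A B) :
    ∃ g : Cell A B, g.deg = n ∧ g.target = y ∧ g.eval = z := by
  obtain ⟨L, rfl⟩ := exists_polynomial z
  refine ⟨.mk n y L.length (fun i => (L.get i).1) (fun i => (L.get i).2.length)
    (fun i j => (L.get i).2.get j), rfl, rfl, ?_⟩
  rw [Cell.eval, ← List.sum_ofFn]
  congr 1
  refine List.ext_getElem (by simp) fun i h h' => ?_
  simp only [List.getElem_ofFn, List.getElem_map, List.get_eq_getElem]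
  congr 2
  refine List.ext_getElem (by simp) fun j h h' => ?_
  simp

variable (f : Hom A B)

/-- The condition for a formal generator to be used, relative to given values of the other ones. -/
def Cell.Valid (θ : ∀ k : Cell A B, (cellExt A B).deg (k.deg + 1))
    (y : ∀ k : Cell A B, B.deg k.deg) (g : Cell A B) : Prop :=
  g.eval ∈ (cellExt A B).deg (g.deg + 1) ∧ g.target ∈ B.deg g.deg ∧
    freeD θ g.eval = 0 ∧ freeLift f y g.eval = B.d g.target

/-- The differential and the image of a formal generator. -/
abbrev Cell.Value (g : Cell A B) : Type u :=
  (cellExt A B).deg (g.deg + 1) × B.deg g.deg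

open Classical in
/-- The value of a formal generator in terms of the values of the other ones. -/
def Cell.next (v : ∀ g : Cell A B, g.Value) (g : Cell A B) : g.Value :=
  -- A cell with inconsistent data remains a generator, with differential and image zero. It does no
  -- harm to homology: being a cycle with image zero, it is the boundary of another cell.
  if h : g.Valid f (fun k => (v k).1) (fun k => (v k).2) then (⟨g.eval, h.1⟩, ⟨g.target, h.2.1⟩)
  else 0

/-- The polynomial of a cell involves only cells of smaller height, and on these `freeD` and
`freeLift` are determined by the earlier values. This justifies the recursion on height and makes
the default value in `Cell.value` irrelevant. -/
theorem Cell.next_congr {v v' : ∀ g : Cell A B, g.Value} {g : Cell A B}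
    (h : ∀ k : Cell A B, k.ht < g.ht → v k = v' k) : g.next f v = g.next f v' := by
  have e : g.Valid f (fun k => (v k).1) (fun k => (v k).2) ↔
      g.Valid f (fun k => (v' k).1) (fun k => (v' k).2) := by
    rw [Valid, Valid, freeD_congr (fun k hk => congrArg Prod.fst (h k hk)) g.eval_mem,
      freeLift_congr f (fun k hk => congrArg Prod.snd (h k hk)) g.eval_mem]
  by_cases hv : g.Valid f (fun k => (v k).1) (fun k => (v k).2)
  · rw [next, next, dif_pos hv, dif_pos (e.1 hv)]
  · rw [next, next, dif_neg hv, dif_neg fun hv' => hv (e.2 hv')]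

open Classical in
/-- The value of a formal generator. -/
def Cell.value : ∀ g : Cell A B, g.Value :=
  (measure (Cell.ht (α := A) (β := B))).wf.fix fun g ih =>
    g.next f fun k => if h : k.ht < g.ht then ih k h else 0

theorem Cell.value_eq (g : Cell A B) : g.value f = g.next f (Cell.value f) := by
  rw [value, WellFounded.fix_eq]
  exact next_congr f fun k hk => dif_pos hk

/-- The differential of a generator. -/
def cellD (g : Cell A B) : (cellExt A B).deg (g.deg + 1) :=
  (g.value f).1

/-- The image of a generator. -/
def cellMap (g : Cell A B) : B.deg g.deg := (g.value f).2

theorem cell_of_valid {g : Cell A B} (h : g.Valid f (cellD f) (cellMap f)) :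
    (cellD f g : cellExt A B) = g.eval ∧ (cellMap f g : B) = g.target := by
  have e : g.value f = (⟨g.eval, h.1⟩, ⟨g.target, h.2.1⟩) := by
    rw [Cell.value_eq, Cell.next]
    exact dif_pos h
  rw [cellD, cellMap, e]
  exact ⟨rfl, rfl⟩

theorem cell_of_not_valid {g : Cell A B} (h : ¬ g.Valid f (cellD f) (cellMap f)) :
    (cellD f g : cellExt A B) = 0 ∧ (cellMap f g : B) = 0 := by
  have e : g.value f = 0 := by
    rw [Cell.value_eq, Cell.next]
    exact dif_neg h
  rw [cellD, cellMap, e]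
  exact ⟨rfl, rfl⟩

theorem freeD_cellD (g : Cell A B) : freeD (cellD f) (cellD f g : cellExt A B) = 0 := by
  by_cases h : g.Valid f (cellD f) (cellMap f)
  · rw [(cell_of_valid f h).1]; exact h.2.2.1
  · rw [(cell_of_not_valid f h).1, map_zero]

theorem freeLift_cellD (g : Cell A B) :
    freeLift f (cellMap f) (cellD f g : cellExt A B) = B.d (cellMap f g) := by
  by_cases h : g.Valid f (cellD f) (cellMap f)
  · rw [(cell_of_valid f h).1, (cell_of_valid f h).2]; exact h.2.2.2
  · rw [(cell_of_not_valid f h).1, (cell_of_not_valid f h).2, map_zero, map_zero]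

theorem cellD_mem (g : Cell A B) :
    (cellD f g : cellExt A B) ∈ lower A Cell.deg {g' | g'.ht < g.ht} := by
  by_cases h : g.Valid f (cellD f) (cellMap f)
  · rw [(cell_of_valid f h).1]; exact g.eval_mem
  · rw [(cell_of_not_valid f h).1]; exact zero_mem _

/-- The total space of a relative Sullivan model of `f`. -/
def model : CDGA.{u} := twist (cellD f) (freeD_cellD f)

/-- The inclusion of the base of the model. -/
def modelIncl : Hom A (model f) := twistIncl (cellD f) (freeD_cellD f)

/-- The quasi-isomorphism from the model. -/
def modelMap : Hom (model f) B :=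
  twistLift (cellD f) (freeD_cellD f) f (cellMap f) (freeLift_cellD f)

theorem modelMap_incl (a : A) : modelMap f (modelIncl f a) = f a := freeLift_inl f _ a

/-- The cell with polynomial `z` and target `y` is valid under these hypotheses, and its generator
is the required element. -/
theorem exists_of_cycle {n : ℤ} {z : model f} {y : B} (hz : z ∈ (model f).deg (n + 1))
    (hy : y ∈ B.deg n) (hdz : (model f).d z = 0) (h : modelMap f z = B.d y) :
    ∃ x : model f, (model f).d x = z ∧ modelMap f x = y := by
  obtain ⟨g, rfl, rfl, hg⟩ := exists_cell n y z
  have hv : g.Valid f (cellD f) (cellMap f) := by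
    refine ⟨?_, hy, ?_, ?_⟩ <;> rw [hg] <;> assumption
  refine ⟨gen A Cell.deg g, ?_, ?_⟩
  · exact (freeD_gen (cellD f) g).trans ((cell_of_valid f hv).1.trans hg)
  · exact (freeLift_gen f (cellMap f) g).trans (cell_of_valid f hv).2

theorem proj_of_mem {A : CDGA.{u}} {m n : ℤ} {a : A} (h : a ∈ A.deg m) :
    GradedAlgebra.proj A.deg n a = if m = n then a else 0 := by
  rw [GradedAlgebra.proj_apply]
  split_ifs with hmn
  · subst hmn; exact DirectSum.decompose_of_mem_same _ h
  · exact DirectSum.decompose_of_mem_ne _ h hmn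

theorem d_proj {A : CDGA.{u}} (n : ℤ) (a : A) :
    A.d (GradedAlgebra.proj A.deg n a) = GradedAlgebra.proj A.deg (n + 1) (A.d a) := by
  induction a using induction_deg with
  | zero => simp only [map_zero]
  | add a b h h' => simp only [map_add, h, h']
  | homog m a h =>
    rw [proj_of_mem h, proj_of_mem (A.d_mem h)]
    by_cases hmn : m = n
    · rw [if_pos hmn, if_pos (by omega)]
    · rw [if_neg hmn, if_neg (by omega), map_zero]

theorem exists_sum_proj {A : CDGA.{u}} (a : A) :
    ∃ s : Finset ℤ, ∀ t, s ⊆ t → a = ∑ n ∈ t, GradedAlgebra.proj A.deg n a := by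
  classical
  refine ⟨(DirectSum.decompose A.deg a).support, fun t ht => ?_⟩
  conv_lhs => rw [← DirectSum.sum_support_decompose A.deg a]
  refine Finset.sum_subset ht fun n _ hn => ?_
  rw [DFinsupp.notMem_support_iff.1 hn]
  rfl

theorem exists_of_cycle' {z : model f} {y : B} (hdz : (model f).d z = 0)
    (h : modelMap f z = B.d y) : ∃ x : model f, (model f).d x = z ∧ modelMap f x = y := by
  have key : ∀ n, ∃ x : model f,
      (model f).d x = GradedAlgebra.proj (model f).deg (n + 1) z ∧
        modelMap f x = GradedAlgebra.proj B.deg n y := fun n => by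
    refine exists_of_cycle f (proj_mem _ _ _) (proj_mem _ _ _) ?_ ?_
    · rw [d_proj, hdz, map_zero]
    · rw [Hom.map_proj, h, d_proj]
  choose x hx hx' using key
  obtain ⟨s, hs⟩ := exists_sum_proj z
  obtain ⟨t, ht⟩ := exists_sum_proj y
  -- The components of `z` are indexed by `n + 1` and those of `y` by `n`, hence the shift by one of
  -- the support of `z`.
  refine ⟨∑ n ∈ s.image (· - 1) ∪ t, x n, ?_, ?_⟩
  · rw [map_sum, hs (s.image (· - 1) ∪ t |>.image (· + 1)), Finset.sum_image (by simp)]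
    · exact Finset.sum_congr rfl fun n _ => hx n
    · intro n hn
      exact Finset.mem_image.2 ⟨n - 1, Finset.mem_union_left _ (Finset.mem_image_of_mem _ hn),
        by ring⟩
  · rw [map_sum, ht (s.image (· - 1) ∪ t) Finset.subset_union_right]
    exact Finset.sum_congr rfl fun n _ => hx' n

end Generators

/-! ### Quasi-isomorphisms -/

section QuasiIso

variable {A B : CDGA.{u}} {f : Hom A B}

/-- The homology class of a cycle. -/
def cls (A : CDGA.{u}) (z : A) (hz : A.d z = 0) : A.Homology :=
  Ideal.Quotient.mk A.boundaries ⟨z, hz⟩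

theorem cls_surjective (h : A.Homology) : ∃ z hz, cls A z hz = h := by
  obtain ⟨⟨z, hz⟩, rfl⟩ := Ideal.Quotient.mk_surjective h
  exact ⟨z, hz, rfl⟩

theorem cls_eq_zero {z : A} {hz : A.d z = 0} : cls A z hz = 0 ↔ ∃ x, A.d x = z :=
  Ideal.Quotient.eq_zero_iff_mem

theorem cls_eq {z z' : A} {hz : A.d z = 0} {hz' : A.d z' = 0} :
    cls A z hz = cls A z' hz' ↔ ∃ x, A.d x = z - z' := Ideal.Quotient.eq

theorem d_map_eq_zero (f : Hom A B) {z : A} (hz : A.d z = 0) : B.d (f z) = 0 := by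
  rw [← f.map_d, hz, map_zero]

theorem homologyMap_cls (f : Hom A B) {z : A} (hz : A.d z = 0) :
    f.homologyMap (cls A z hz) = cls B (f z) (d_map_eq_zero f hz) := rfl

/-- One condition contains both halves: taking for `z` a difference of cycles gives injectivity in
homology, and `z = 0` gives surjectivity. -/
theorem quasiIso_of_exists (h : ∀ z y, A.d z = 0 → f z = B.d y → ∃ x, A.d x = z ∧ f x = y) :
    f.QuasiIso := by
  constructor
  · intro a b hab
    obtain ⟨z, hz, rfl⟩ := cls_surjective a
    obtain ⟨w, hw, rfl⟩ := cls_surjective b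
    rw [homologyMap_cls, homologyMap_cls, cls_eq] at hab
    obtain ⟨y, hy⟩ := hab
    obtain ⟨x, hx, _⟩ := h (z - w) y (by rw [map_sub, hz, hw, sub_zero]) (by rw [map_sub, hy])
    exact cls_eq.2 ⟨x, hx⟩
  · intro b
    obtain ⟨y, hy, rfl⟩ := cls_surjective b
    obtain ⟨x, hx, hxy⟩ := h 0 y (map_zero _) (by rw [hy, map_zero])
    subst hxy
    exact ⟨cls A x hx, rfl⟩

/-- This is acyclicity of the mapping cocone of `f`. Injectivity gives a primitive of `z`;
surjectivity gives a cycle by which to correct it, so that the remaining difference with `y` becomes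
a boundary. -/
theorem Hom.QuasiIso.exists_lift (hf : f.QuasiIso) {z : A} {y : B} (hz : A.d z = 0)
    (h : f z = B.d y) : ∃ x y', A.d x = z ∧ B.d y' = f x - y := by
  have h0 : cls A z hz = 0 := hf.1 (by
    rw [map_zero, homologyMap_cls, cls_eq_zero]; exact ⟨y, h.symm⟩)
  obtain ⟨x, rfl⟩ := cls_eq_zero.1 h0
  have hy : B.d (f x - y) = 0 := by rw [map_sub, ← f.map_d, h, sub_self]
  obtain ⟨c, hc⟩ := hf.2 (cls B (f x - y) hy)
  obtain ⟨w, hw, rfl⟩ := cls_surjective c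
  rw [homologyMap_cls, cls_eq] at hc
  obtain ⟨y', hy'⟩ := hc
  refine ⟨x - w, -y', by rw [map_sub, hw, sub_zero], ?_⟩
  rw [map_neg, hy', map_sub]
  abel

end QuasiIso

/-! ### The model is a relative Sullivan model -/

section Model

variable {ι : Type u} [LinearOrder ι] {A : CDGA.{u}} {d : ι → ℤ}

theorem monomial_gen (μ : ι →₀ ℕ) :
    monomial (gen A d) μ = inr A (extAlg d) (E d μ) := by
  rw [← monomial_E, map_monomial]
  rfl

variable (A d) in
/-- The free extension is free as a module over its base. -/
def freeExtEquiv : freeExt A d ≃ₗ[ℚ] (Mon d →₀ A) :=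
  (GradedTensorProduct.of ℚ A.deg (extAlg d).deg).symm.trans
    (TensorProduct.equivFinsuppOfBasisRight (extBasis d))

theorem freeExtEquiv_symm (a : Mon d →₀ A) : (freeExtEquiv A d).symm a =
    a.sum fun μ x => inl A (extAlg d) x * inr A (extAlg d) (E d μ.1) := by
  induction a using Finsupp.induction_linear with
  | zero => simp
  | add a b h h' =>
    rw [map_add, h, h', Finsupp.sum_add_index' (by simp) (by intros; rw [map_add, add_mul])]
  | single μ x =>
    rw [Finsupp.sum_single_index (by simp), ← tmul_eq_mul, E_coe, LinearEquiv.symm_apply_eq]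
    symm
    refine (TensorProduct.equivFinsuppOfBasisRight_apply_tmul (extBasis d) x _).trans ?_
    rw [Module.Basis.repr_self, Finsupp.mapRange_single, one_smul]

variable {B : CDGA.{u}} (f : Hom A B)

/-- The model is a relative Sullivan algebra. -/
def modelRelSullivan : RelSullivan (modelIncl f) where
  ι := Cell A B
  v := gen A Cell.deg
  degree := Cell.deg
  ht := Cell.ht
  v_mem := gen_mem (A := A) (d := Cell.deg)
  free c := by
    have key : ∀ a : Mon (Cell.deg (α := A) (β := B)) →₀ A,
        (a.sum fun μ x => (inl A (extAlg Cell.deg) x * monomial (gen A Cell.deg) μ.1 :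
          cellExt A B)) = (freeExtEquiv A Cell.deg).symm a := by
      intro a
      rw [freeExtEquiv_symm]
      exact Finsupp.sum_congr fun μ _ => by rw [monomial_gen]
    refine ⟨freeExtEquiv A Cell.deg c, ?_, fun a ha => ?_⟩
    · exact (((key _).trans (LinearEquiv.symm_apply_apply _ _)).symm :)
    · exact ((LinearEquiv.eq_symm_apply _).1 (ha.trans (key a))).symm
  nilpotent k := by
    have := cellD_mem f k
    rw [← freeD_gen (cellD f) k] at this
    exact this

theorem model_isRelSullivanModel : IsRelSullivanModel f (modelIncl f) :=
  ⟨⟨modelRelSullivan f⟩, modelMap f,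
    quasiIso_of_exists fun _ _ hz h => exists_of_cycle' f hz h, modelMap_incl f⟩

end Model

/-! ### Lifting module morphisms out of the model -/

section WellFoundedChoice

open Classical in
-- Recursion with choice, in the situation where a value exists only if the earlier values meet
-- their own specification. The values are first picked by `Classical.epsilon` without proof, and
-- the specification is verified afterwards by induction.
theorem exists_of_wellFounded {α β : Type*} [Nonempty β] {r : α → α → Prop} (wf : WellFounded r)
    (P : α → (α → β) → β → Prop)
    (hcongr : ∀ a F F' x, (∀ b, r b a → F b = F' b) → P a F x → P a F' x)
    (hex : ∀ a F, (∀ b, r b a → P b F (F b)) → ∃ x, P a F x) : ∃ F, ∀ a, P a F (F a) := by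
  let step : ∀ a, (∀ b, r b a → β) → β := fun a ih =>
    Classical.epsilon (P a fun b => if h : r b a then ih b h else Classical.arbitrary β)
  have hF : ∀ a, wf.fix step a =
      Classical.epsilon (P a fun b => if r b a then wf.fix step b else Classical.arbitrary β) :=
    fun a => wf.fix_eq step a
  refine ⟨wf.fix step, fun a => ?_⟩
  induction a using wf.induction with
  | _ a ih =>
    obtain ⟨x, hx⟩ := hex a (wf.fix step) ih
    have h := Classical.epsilon_spec (p := P a fun b => if r b a then wf.fix step b else
      Classical.arbitrary β) ⟨x, hcongr a _ _ x (fun b hb => (if_pos hb).symm) hx⟩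
    rw [← hF] at h
    exact hcongr a _ _ _ (fun b hb => if_pos hb) h

end WellFoundedChoice

/-! ### The differential of a monomial lies in the span of smaller monomials -/

section Filtration

variable {ι : Type u} [LinearOrder ι] {A : CDGA.{u}} {d : ι → ℤ}

variable (A d) in
/-- The `A`-span of the monomials with exponents in `X`. -/
def monSpan (X : Set (ι →₀ ℕ)) : Submodule ℚ (freeExt A d) :=
  Submodule.span ℚ {z | ∃ a, ∃ μ ∈ X, z = inl A (extAlg d) a * inr A (extAlg d) (E d μ)}

theorem mem_monSpan {X : Set (ι →₀ ℕ)} (a : A) {μ : ι →₀ ℕ} (hμ : μ ∈ X) :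
    inl A (extAlg d) a * inr A (extAlg d) (E d μ) ∈ monSpan A d X :=
  Submodule.subset_span ⟨a, μ, hμ, rfl⟩

theorem inr_mem_monSpan {X : Set (ι →₀ ℕ)} {μ : ι →₀ ℕ} (hμ : μ ∈ X) :
    inr A (extAlg d) (E d μ) ∈ monSpan A d X := by
  have := mem_monSpan (A := A) (d := d) 1 hμ
  rwa [map_one, one_mul] at this

theorem inr_mul_inl (μ : ι →₀ ℕ) (a : A) : ∃ a', inr A (extAlg d) (E d μ) * inl A (extAlg d) a =
    inl A (extAlg d) a' * inr A (extAlg d) (E d μ) := by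
  induction a using induction_deg with
  | zero => exact ⟨0, by simp⟩
  | add a b h h' =>
    obtain ⟨a', ha⟩ := h
    obtain ⟨b', hb⟩ := h'
    exact ⟨a' + b', by rw [map_add, mul_add, ha, hb, map_add, add_mul]⟩
  | homog n a h =>
    refine ⟨sgn (monDeg d μ * n) • a, ?_⟩
    rw [(freeExt A d).comm ((inr A (extAlg d)).map_deg (E_mem μ))
      ((inl A (extAlg d)).map_deg h), map_smul, smul_mul_assoc]

theorem mul_mem_monSpan {X Y Z : Set (ι →₀ ℕ)} (h : ∀ μ ∈ X, ∀ ν ∈ Y, μ + ν ∈ Z)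
    {x y : freeExt A d} (hx : x ∈ monSpan A d X) (hy : y ∈ monSpan A d Y) :
    x * y ∈ monSpan A d Z := by
  refine Submodule.span_induction (p := fun x _ => x * y ∈ monSpan A d Z) ?_ ?_ ?_ ?_ hx
  · rintro _ ⟨a, μ, hμ, rfl⟩
    refine Submodule.span_induction (p := fun y _ => inl A (extAlg d) a *
      inr A (extAlg d) (E d μ) * y ∈ monSpan A d Z) ?_ ?_ ?_ ?_ hy
    · rintro _ ⟨b, ν, hν, rfl⟩
      obtain ⟨b', hb⟩ := inr_mul_inl (d := d) μ b
      rw [mul_assoc, ← mul_assoc (inr A (extAlg d) (E d μ)), hb, mul_assoc, ← mul_assoc, ← map_mul,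
        ← map_mul, E_mul_E, map_smul, mul_smul_comm]
      exact Submodule.smul_mem _ _ (mem_monSpan _ (h μ hμ ν hν))
    · rw [mul_zero]; exact zero_mem _
    · intro y y' _ _ h h'; rw [mul_add]; exact add_mem h h'
    · intro r y _ h; rw [mul_smul_comm]; exact Submodule.smul_mem _ _ h
  · rw [zero_mul]; exact zero_mem _
  · intro y y' _ _ h h'; rw [add_mul]; exact add_mem h h'
  · intro r y _ h; rw [smul_mul_assoc]; exact Submodule.smul_mem _ _ h

theorem lower_le_monSpan {s : Set ι} {x : freeExt A d} (hx : x ∈ lower A d s) :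
    x ∈ monSpan A d {μ | ∀ l ∈ μ.support, l ∈ s} := by
  refine lower_induction (P := fun x => x ∈ monSpan A d {μ | ∀ l ∈ μ.support, l ∈ s})
    ?_ ?_ ?_ ?_ hx
  · intro a
    have := mem_monSpan (A := A) (d := d) (X := {μ | ∀ l ∈ μ.support, l ∈ s}) a
      (μ := 0) (by simp)
    rwa [inr_E_zero, mul_one] at this
  · intro k hk
    refine inr_mem_monSpan fun l hl => ?_
    rwa [Finset.mem_singleton.1 (Finsupp.support_single_subset hl)]
  · exact fun x y => add_mem
  · intro x y h h'
    refine mul_mem_monSpan (fun μ hμ ν hν l hl => ?_) h h'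
    rcases Finset.mem_union.1 (Finsupp.support_add hl) with hl | hl
    exacts [hμ l hl, hν l hl]

/-- The order on exponents in which a generator is replaced by generators of smaller height. -/
def ReplaceLT (ht : ι → ℕ) (ν μ : ι →₀ ℕ) : Prop :=
  Relation.CutExpand (fun k l => ht k < ht l) (Finsupp.toMultiset ν) (Finsupp.toMultiset μ)

omit [LinearOrder ι] in
theorem replaceLT_wf (ht : ι → ℕ) : WellFounded (ReplaceLT ht) :=
  InvImage.wf Finsupp.toMultiset (WellFounded.cutExpand (measure ht).wf)

variable (θ : ∀ k, (freeExt A d).deg (d k + 1))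

theorem freeD_one : freeD θ 1 = 0 := by
  have := freeD_inl θ 1
  rwa [d_one, map_zero, map_one] at this

/-- By the Leibniz rule each term of the differential replaces one occurrence of a generator by a
polynomial in generators of smaller height. The new monomials may be longer, but the multiset order
of `ReplaceLT` is still well founded. -/
theorem freeD_inr_E_mem {ht : ι → ℕ}
    (hθ : ∀ k, (θ k : freeExt A d) ∈ lower A d {l | ht l < ht k}) (μ : ι →₀ ℕ) :
    freeD θ (inr A (extAlg d) (E d μ)) ∈ monSpan A d {ν | ReplaceLT ht ν μ} := by
  induction μ using exponent_induction with
  | zero => rw [inr_E_zero, freeD_one]; exact zero_mem _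
  | step f a h ih =>
    rw [inr_E_add_single h, freeD_mul, freeD_gen]
    refine add_mem ?_ ?_
    · refine mul_mem_monSpan (Y := {Finsupp.single a 1}) ?_ ih (inr_mem_monSpan rfl)
      rintro ν ⟨t, x, ht, hx⟩ _ rfl
      refine ⟨t, x, ht, ?_⟩
      rw [map_add, map_add, add_right_comm, hx, add_right_comm]
    · rw [invol_of_mem ((inr A (extAlg d)).map_deg (E_mem f)), smul_mul_assoc]
      refine Submodule.smul_mem _ _ ?_
      refine mul_mem_monSpan (X := {f}) ?_ (inr_mem_monSpan rfl) (lower_le_monSpan (hθ a))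
      rintro _ rfl ν hν
      refine ⟨Finsupp.toMultiset ν, a, fun l hl => hν l ?_, ?_⟩
      · rwa [Finsupp.mem_toMultiset] at hl
      · rw [map_add, map_add, Finsupp.toMultiset_single, one_smul]
        exact add_right_comm _ _ _

end Filtration

/-! ### Lifting through a surjection with acyclic kernel -/

section Lifting

variable {A B : CDGA.{u}} (f : Hom A B) {N : Type*} [AddCommGroup N] [Module ℚ N]
  (act : A →ₗ[ℚ] N →ₗ[ℚ] N)

/-- The `A`-linear map on a free extension with given values on the monomials. -/
def spread {ι : Type u} [LinearOrder ι] {d : ι → ℤ} (u : Mon d → N) : freeExt A d →ₗ[ℚ] N :=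
  TensorProduct.lift (act.compl₂ ((extBasis d).constr ℚ u)) ∘ₗ
    (GradedTensorProduct.of ℚ A.deg (extAlg d).deg).symm.toLinearMap

section

variable {ι : Type u} [LinearOrder ι] {d : ι → ℤ} (u : Mon d → N)

theorem spread_tmul (a : A) (x : extAlg d) :
    spread act u (tmul a x) = act a ((extBasis d).constr ℚ u x) := rfl

theorem spread_mono (a : A) (μ : Mon d) :
    spread act u (inl A (extAlg d) a * inr A (extAlg d) (E d μ.1)) = act a (u μ) := by
  rw [← tmul_eq_mul, spread_tmul, E_coe, Module.Basis.constr_basis]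

theorem spread_inl_mul (hact : ∀ a b x, act (a * b) x = act a (act b x)) (a : A)
    (z : freeExt A d) : spread act u (inl A (extAlg d) a * z) = act a (spread act u z) := by
  induction z using tmul_induction with
  | zero => rw [mul_zero, map_zero, map_zero]
  | add x y h h' => rw [mul_add, map_add, h, h', map_add, map_add]
  | tmul i j b x _ _ => rw [inl_mul_tmul, spread_tmul, spread_tmul, hact]

theorem eq_on_monSpan {M : Type*} [AddCommGroup M] [Module ℚ M] {F G : freeExt A d →ₗ[ℚ] M}
    {X : Set (ι →₀ ℕ)} (h : ∀ a, ∀ μ : Mon d, μ.1 ∈ X →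
      F (inl A (extAlg d) a * inr A (extAlg d) (E d μ.1)) =
        G (inl A (extAlg d) a * inr A (extAlg d) (E d μ.1)))
    {z : freeExt A d} (hz : z ∈ monSpan A d X) : F z = G z := by
  refine Submodule.span_induction (p := fun z _ => F z = G z) ?_ ?_ ?_ ?_ hz
  · rintro _ ⟨a, μ, hμ, rfl⟩
    by_cases hadm : ∀ k, Odd (d k) → μ k ≤ 1
    · exact h a ⟨μ, hadm⟩ hμ
    · rw [E_eq_zero hadm, map_zero, mul_zero, map_zero, map_zero]
  · rw [map_zero, map_zero]
  · intro x y _ _ h h'; rw [map_add, map_add, h, h']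
  · intro r x _ h; rw [map_smul, map_smul, h]

theorem mem_monSpan_univ (z : freeExt A d) : z ∈ monSpan A d Set.univ := by
  induction z using freeExt_span_induction with
  | zero => exact zero_mem _
  | add x y h h' => exact add_mem h h'
  | mono a μ => exact mem_monSpan a (Set.mem_univ _)

end

/-- A surjection of differential graded `A`-modules with acyclic kernel has the lifting property
with respect to the model, relative to the base. -/
theorem exists_model_lift (hone : ∀ x, act 1 x = x)
    (hact : ∀ a b x, act (a * b) x = act a (act b x)) (dN : N →ₗ[ℚ] N) (hdd : ∀ x, dN (dN x) = 0)
    (hdact : ∀ a x, dN (act a x) = act (A.d a) x + act (A.invol a) (dN x))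
    (p : N →ₗ[ℚ] B) (hp : Function.Surjective p) (hpact : ∀ a x, p (act a x) = f a * p x)
    (hpd : ∀ x, p (dN x) = B.d (p x))
    (hker : ∀ x, p x = 0 → dN x = 0 → ∃ z, p z = 0 ∧ dN z = x) (n₀ : N) (hn₀ : dN n₀ = 0)
    (hpn₀ : p n₀ = 1) :
    ∃ U : model f →ₗ[ℚ] N, (∀ a c, U (modelIncl f a * c) = act a (U c)) ∧
      (∀ c, dN (U c) = U ((model f).d c)) ∧ U 1 = n₀ := by
  let m : cellExt A B →ₗ[ℚ] B := (freeLift f (cellMap f)).toLinearMap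
  let D : cellExt A B →ₗ[ℚ] cellExt A B := freeD (cellD f)
  let e : (Cell A B →₀ ℕ) → cellExt A B := fun μ => inr A (extAlg Cell.deg) (E Cell.deg μ)
  have hmD : ∀ z, m (D z) = B.d (m z) := (modelMap f).map_d
  have hDe := freeD_inr_E_mem (cellD f) (ht := Cell.ht) (cellD_mem f)
  have hDmul : ∀ a z, D (inl A (extAlg Cell.deg) a * z) =
      inl A (extAlg Cell.deg) (A.d a) * z + inl A (extAlg Cell.deg) (A.invol a) * D z := by
    intro a z
    rw [Hom.map_invol]
    exact (freeD_mul (cellD f) _ _).trans (by rw [freeD_inl])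
  have hmmul : ∀ a z, m (inl A (extAlg Cell.deg) a * z) = f a * m z := fun a z =>
    (map_mul (freeLift f (cellMap f)) _ _).trans (by rw [freeLift_inl]; rfl)
  -- Compatibility with the projections and with the differentials passes from the monomials of `X`
  -- to their `A`-span, by linearity and the Leibniz rule.
  have comm_on : ∀ (u : Mon (Cell.deg (α := A) (β := B)) → N) (X : Set (Cell A B →₀ ℕ)),
      (∀ μ : Mon (Cell.deg (α := A) (β := B)), μ.1 ∈ X →
        p (u μ) = m (e μ.1) ∧ dN (u μ) = spread act u (D (e μ.1))) →
      ∀ z ∈ monSpan A Cell.deg X, p (spread act u z) = m z ∧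
        dN (spread act u z) = spread act u (D z) := by
    intro u X h z hz
    constructor
    · refine eq_on_monSpan (F := p ∘ₗ spread act u) (G := m) (fun a μ hμ => ?_) hz
      rw [LinearMap.comp_apply, spread_mono, hpact, (h μ hμ).1, hmmul]
    · refine eq_on_monSpan (F := dN ∘ₗ spread act u) (G := spread act u ∘ₗ D)
        (fun a μ hμ => ?_) hz
      rw [LinearMap.comp_apply, LinearMap.comp_apply, spread_mono, hdact, (h μ hμ).2, hDmul,
        map_add, spread_mono, spread_inl_mul act u hact]
  -- The values are chosen monomial by monomial along `ReplaceLT`. The last clause prescribes the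
  -- value on the monomial `1`.
  obtain ⟨u, hu⟩ := exists_of_wellFounded (β := N)
    (InvImage.wf (Subtype.val : Mon (Cell.deg (α := A) (β := B)) → Cell A B →₀ ℕ)
      (replaceLT_wf Cell.ht))
    (fun μ u x => (p x = m (e μ.1) ∧ dN x = spread act u (D (e μ.1))) ∧ (μ.1 = 0 → x = n₀))
    (by
      intro μ u u' x h hx
      refine ⟨⟨hx.1.1, hx.1.2.trans (eq_on_monSpan (fun a ν hν => ?_) (hDe μ.1))⟩, hx.2⟩
      rw [spread_mono, spread_mono, h ν hν])
    (by
      intro μ u ih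
      by_cases hμ : μ.1 = 0
      · refine ⟨n₀, ⟨?_, ?_⟩, fun _ => rfl⟩
        · rw [hpn₀, hμ]
          exact ((congrArg m inr_E_zero).trans (map_one (freeLift f (cellMap f)))).symm
        · have : D (e μ.1) = 0 := by
            rw [hμ]
            exact (congrArg D inr_E_zero).trans (freeD_one (cellD f))
          rw [hn₀, this, map_zero]
      · have key := comm_on u {ν | ReplaceLT Cell.ht ν μ.1} fun ν hν => (ih ν hν).1
        -- A preimage `x` of `m (e μ)` may have the wrong differential. The error is a cycle in the
        -- kernel of `p`, hence `dN z` with `z` in that kernel, and `x - z` is a correct value.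
        obtain ⟨x, hx⟩ := hp (m (e μ.1))
        obtain ⟨h1, h2⟩ := key _ (hDe μ.1)
        have hDD : D (D (e μ.1)) = 0 := freeD_freeD (cellD f) (freeD_cellD f) _
        obtain ⟨z, hz, hz'⟩ := hker (dN x - spread act u (D (e μ.1)))
          (by rw [map_sub, hpd, hx, ← hmD]; exact sub_eq_zero.2 h1.symm)
          (by
            rw [map_sub, hdd, zero_sub, neg_eq_zero]
            exact h2.trans ((congrArg _ hDD).trans (map_zero _)))
        exact ⟨x - z, ⟨by rw [map_sub, hx, hz, sub_zero], by rw [map_sub, hz']; abel⟩,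
          fun h => absurd h hμ⟩)
  refine ⟨spread act u, spread_inl_mul act u hact, fun c => ?_, ?_⟩
  · exact (comm_on u Set.univ (fun μ _ => (hu μ).1) c (mem_monSpan_univ c)).2
  · have h := spread_mono act u 1 ⟨0, by simp⟩
    rw [map_one, one_mul, inr_E_zero, hone, (hu ⟨0, by simp⟩).2 rfl] at h
    exact h

end Lifting

/-! ### Lifting through a quasi-isomorphism, by means of a mapping cocone -/

section LiftQuasiIso

variable {A B C Q : CDGA.{u}} (f : Hom A B) (h : Hom A C) {q : Hom C Q}

/-- The action of `A` on the mapping cocone of `C × B → Q`. -/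
def coconeAct (q : Hom C Q) : A →ₗ[ℚ] (C × B × Q) →ₗ[ℚ] (C × B × Q) :=
  -- The summand `Q` is shifted by one degree, so `A` acts on it through the degree involution; this
  -- is what makes `coconeD` satisfy the Leibniz rule.
  LinearMap.mk₂ ℚ (fun a x => (h a * x.1, f a * x.2.1, q (h (A.invol a)) * x.2.2))
    (fun a a' x => by simp only [map_add, add_mul, Prod.mk_add_mk])
    (fun r a x => by simp only [map_smul, smul_mul_assoc, Prod.smul_mk])
    (fun a x x' => by simp only [Prod.fst_add, Prod.snd_add, mul_add, Prod.mk_add_mk])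
    (fun r a x => by simp only [Prod.smul_fst, Prod.smul_snd, mul_smul_comm, Prod.smul_mk])

/-- The differential of the mapping cocone of `C × B → Q`. -/
def coconeD (q : Hom C Q) (s : B →ₗ[ℚ] Q) : (C × B × Q) →ₗ[ℚ] (C × B × Q) where
  toFun x := (C.d x.1, B.d x.2.1, q x.1 - s x.2.1 - Q.d x.2.2)
  map_add' x y := by
    simp only [Prod.fst_add, Prod.snd_add, map_add, Prod.mk_add_mk, Prod.mk.injEq, true_and]
    abel
  map_smul' r x := by
    simp only [Prod.smul_fst, Prod.smul_snd, map_smul, Prod.smul_mk, smul_sub, RingHom.id_apply]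

/-- A map of differential graded `A`-modules out of the model lifts through a quasi-isomorphism, up
to homotopy and relative to the base. -/
theorem exists_model_lift_quasiIso (hq : q.QuasiIso) (s : B →ₗ[ℚ] Q)
    (hs : ∀ a b, s (f a * b) = q (h a) * s b) (hsd : ∀ b, s (B.d b) = Q.d (s b)) (c₀ : C)
    (hc₀ : C.d c₀ = 0) (hqc₀ : q c₀ = s 1) :
    ∃ G : model f →ₗ[ℚ] C, (∀ a c, G (modelIncl f a * c) = h a * G c) ∧
      (∀ c, C.d (G c) = G ((model f).d c)) ∧ G 1 = c₀ := by
  -- The projection of the cocone of `(c, b) ↦ q c - s b` onto `B` is surjective, and its kernel is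
  -- the cocone of `q`, which is acyclic. The `C`-component of a lift is the desired `G`; its
  -- `Q`-component is a homotopy between `q ∘ G` and `s ∘ modelMap f`. The triple `(c₀, 1, 0)` is a
  -- cycle because `q c₀ = s 1`.
  obtain ⟨U, hU, hdU, hU1⟩ := exists_model_lift f (coconeAct f h q)
    (by intro x; simp [coconeAct, invol_of_mem (SetLike.GradedOne.one_mem (A := A.deg)), sgn_zero])
    (by intro a b x; simp [coconeAct, invol_mul, mul_assoc])
    (coconeD q s)
    (by
      intro x
      simp [coconeD, C.d_d, B.d_d, Q.d_d, Hom.map_d, hsd])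
    (by
      rintro a ⟨c, b, y⟩
      simp only [coconeAct, coconeD, LinearMap.mk₂_apply, LinearMap.coe_mk, AddHom.coe_mk,
        Prod.mk_add_mk, Prod.mk.injEq, d_mul, Hom.map_d, Hom.map_invol, hs, map_mul, true_and,
        d_invol, invol_invol]
      noncomm_ring)
    (LinearMap.fst ℚ B Q ∘ₗ LinearMap.snd ℚ C (B × Q))
    (fun b => ⟨(0, b, 0), rfl⟩) (fun _ _ => rfl) (fun _ => rfl)
    (by
      rintro ⟨c, b, y⟩ hb hd
      obtain rfl : b = 0 := hb
      simp only [coconeD, LinearMap.coe_mk, AddHom.coe_mk, map_zero, sub_zero, Prod.mk_eq_zero,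
        true_and] at hd
      obtain ⟨x, y', hx, hy'⟩ := hq.exists_lift hd.1 (sub_eq_zero.1 hd.2)
      refine ⟨(x, 0, y'), rfl, ?_⟩
      simp [coconeD, hx, hy'])
    (c₀, 1, 0) (by simp [coconeD, hc₀, hqc₀, d_one]) rfl
  refine ⟨LinearMap.fst ℚ C (B × Q) ∘ₗ U, fun a c => ?_, fun c => ?_, ?_⟩
  · simp only [LinearMap.comp_apply, hU]; rfl
  · simp only [LinearMap.comp_apply, ← hdU]; rfl
  · simp only [LinearMap.comp_apply, hU1]; rfl

end LiftQuasiIso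

/-! ### The degree zero part of a linear map -/

section DegreeZero

variable {M N : CDGA.{u}}

/-- The degree zero part of a linear map. -/
def degZeroPart (R : M →ₗ[ℚ] N) : M →ₗ[ℚ] N :=
  (DirectSum.toModule ℚ ℤ N fun n =>
    (GradedAlgebra.proj N.deg n) ∘ₗ R ∘ₗ (M.deg n).subtype) ∘ₗ
    (DirectSum.decomposeLinearEquiv M.deg).toLinearMap

theorem degZeroPart_of_mem (R : M →ₗ[ℚ] N) {n : ℤ} {x : M} (hx : x ∈ M.deg n) :
    degZeroPart R x = GradedAlgebra.proj N.deg n (R x) := by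
  have := DirectSum.decomposeLinearEquiv_apply_coe M.deg n ⟨x, hx⟩
  simp only [degZeroPart, LinearMap.comp_apply, LinearEquiv.coe_coe] at *
  rw [this, DirectSum.toModule_lof]; rfl

theorem proj_mul {A : CDGA.{u}} {m : ℤ} {a : A} (ha : a ∈ A.deg m) (n : ℤ) (x : A) :
    GradedAlgebra.proj A.deg (m + n) (a * x) = a * GradedAlgebra.proj A.deg n x := by
  induction x using induction_deg with
  | zero => simp only [map_zero, mul_zero]
  | add x y h h' => simp only [mul_add, map_add, h, h']
  | homog k x hx =>
    rw [proj_of_mem hx, proj_of_mem (SetLike.GradedMul.mul_mem ha hx)]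
    by_cases hk : k = n
    · rw [if_pos hk, if_pos (by omega)]
    · rw [if_neg hk, if_neg (by omega), mul_zero]

variable {T : CDGA.{u}} (f : Hom T M) (g : Hom T N) (R : M →ₗ[ℚ] N)

/-- The degree zero part of a `T`-linear chain map is a morphism of differential graded
`T`-modules. -/
def degZeroModuleHom (hd : ∀ x, R (M.d x) = N.d (R x)) (hact : ∀ t x, R (f t * x) = g t * R x) :
    ModuleHom f g where
  toLinearMap := degZeroPart R
  map_deg h := by rw [degZeroPart_of_mem R h]; exact proj_mem _ _ _
  map_d x := by
    induction x using induction_deg with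
    | zero => simp only [map_zero]
    | add x y h h' => simp only [map_add, h, h']
    | homog n x hx =>
      rw [degZeroPart_of_mem R (M.d_mem hx), degZeroPart_of_mem R hx, hd, d_proj]
  map_act t x := by
    induction t using induction_deg with
    | zero => simp only [map_zero, zero_mul]
    | add s t h h' => simp only [map_add, add_mul, h, h']
    | homog m t ht =>
      induction x using induction_deg with
      | zero => simp only [map_zero, mul_zero]
      | add x y h h' => simp only [map_add, mul_add, h, h']
      | homog n x hx =>
        rw [degZeroPart_of_mem R (SetLike.GradedMul.mul_mem (f.map_deg ht) hx),
          degZeroPart_of_mem R hx, hact, proj_mul (g.map_deg ht)]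

theorem degZeroModuleHom_apply (hd : ∀ x, R (M.d x) = N.d (R x))
    (hact : ∀ t x, R (f t * x) = g t * R x) (h : ∀ t, R (f t) = g t) (t : T) :
    (degZeroModuleHom f g R hd hact).toLinearMap (f t) = g t := by
  change degZeroPart R (f t) = g t
  induction t using induction_deg with
  | zero => simp only [map_zero]
  | add s t h h' => simp only [map_add, h, h']
  | homog n t ht =>
    rw [degZeroPart_of_mem R (f.map_deg ht), h, proj_of_mem (g.map_deg ht), if_pos rfl]

end DegreeZero

/-! ### Transfer of retractions -/

section Transfer

variable {S T C X : CDGA.{u}} {I : DGIdeal S} {J : DGIdeal T} (g : Hom S T) {κ : T}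

/-- The map `S / I → T / J`, `x ↦ g x * κ`. -/
def quotMulRight (hJ : ∀ x ∈ I.toIdeal, g x * κ ∈ J.toIdeal) : S.quot I →ₗ[ℚ] T.quot J :=
  (I.toIdeal.restrictScalars ℚ).mapQ (J.toIdeal.restrictScalars ℚ)
    (LinearMap.mulRight ℚ κ ∘ₗ g.toAlgHom.toLinearMap) hJ

theorem quotMulRight_quotMk (hJ : ∀ x ∈ I.toIdeal, g x * κ ∈ J.toIdeal) (x : S) :
    quotMulRight g hJ (S.quotMk I x) = T.quotMk J (g x * κ) := rfl

theorem quotMk_surjective (A : CDGA.{u}) (I : DGIdeal A) : Function.Surjective (A.quotMk I) :=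
  Ideal.Quotient.mk_surjective

/-- A retraction for `T → T / J` yields one for `S → S / I`, if `x ↦ g x * κ` maps `I` to `J`. -/
theorem exists_retraction (hκ : T.d κ = 0) (hJ : ∀ x ∈ I.toIdeal, g x * κ ∈ J.toIdeal)
    (j : Hom T C) (q : Hom C (T.quot J)) (hq : q.QuasiIso) (hqj : ∀ t, q (j t) = T.quotMk J t)
    (Φ : C →ₗ[ℚ] X) (ν : Hom S X) (hΦ : ∀ s c, Φ (j (g s) * c) = ν s * Φ c)
    (hΦd : ∀ c, Φ (C.d c) = X.d (Φ c)) (hΦκ : Φ (j κ) = 1) :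
    ∃ (M : CDGA.{u}) (i : Hom S M), IsRelSullivanModel (S.quotMk I) i ∧
      ∃ r : ModuleHom i ν, ∀ s, r.toLinearMap (i s) = ν s := by
  -- Since `κ` multiplies on the right, `S`-linearity involves no sign; since `κ` is a cycle, the
  -- map is a chain map.
  have hs : ∀ a b, quotMulRight g hJ (S.quotMk I a * b) =
      q (j.comp g a) * quotMulRight g hJ b := by
    intro a b
    obtain ⟨b, rfl⟩ := quotMk_surjective S I b
    rw [← map_mul, quotMulRight_quotMk, quotMulRight_quotMk]
    refine Eq.trans ?_ (congrArg (· * T.quotMk J (g b * κ)) (hqj (g a)).symm)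
    rw [← map_mul, map_mul g.toAlgHom, mul_assoc]
  have hsd : ∀ b, quotMulRight g hJ ((S.quot I).d b) =
      (T.quot J).d (quotMulRight g hJ b) := by
    intro b
    obtain ⟨b, rfl⟩ := quotMk_surjective S I b
    rw [← Hom.map_d, quotMulRight_quotMk, quotMulRight_quotMk, ← Hom.map_d, d_mul, hκ, mul_zero,
      add_zero, g.map_d]
  -- The normalisation `G 1 = j κ` is compatible with the map on quotients, which sends `1` to the
  -- class of `κ`. It makes `Φ ∘ G` send `1` to `1`.
  obtain ⟨G, hG, hGd, hG1⟩ := exists_model_lift_quasiIso (S.quotMk I) (j.comp g) hq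
    (quotMulRight g hJ) hs hsd (j κ) (d_map_eq_zero j hκ)
    (by
      rw [hqj, ← map_one (S.quotMk I).toAlgHom, quotMulRight_quotMk, map_one, one_mul])
  have hR : ∀ s c, (Φ ∘ₗ G) (modelIncl (S.quotMk I) s * c) = ν s * (Φ ∘ₗ G) c := fun s c => by
    rw [LinearMap.comp_apply, hG]
    exact hΦ s _
  have hRd : ∀ c, (Φ ∘ₗ G) ((model (S.quotMk I)).d c) = X.d ((Φ ∘ₗ G) c) := fun c => by
    rw [LinearMap.comp_apply, ← hGd, hΦd, LinearMap.comp_apply]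
  -- None of `G`, `κ`, `Φ` need be homogeneous. The degree zero part of `Φ ∘ G` is still an
  -- `S`-linear chain map, and it agrees with `ν` on the base because `ν` preserves degrees.
  refine ⟨_, _, model_isRelSullivanModel (S.quotMk I), degZeroModuleHom _ ν (Φ ∘ₗ G) hRd hR,
    degZeroModuleHom_apply _ ν (Φ ∘ₗ G) hRd hR fun s => ?_⟩
  have := hR s 1
  rwa [mul_one, show (Φ ∘ₗ G) 1 = 1 by rw [LinearMap.comp_apply, hG1, hΦκ], mul_one] at this

/-- If `T → T / J` has a retraction, then cycles in `J` become boundaries. -/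
theorem exists_boundary (hκ : T.d κ = 0) (hκJ : κ ∈ J.toIdeal) (j : Hom T C)
    (q : Hom C (T.quot J)) (hq : q.QuasiIso) (hqj : ∀ t, q (j t) = T.quotMk J t)
    (Φ : C →ₗ[ℚ] X) (hΦd : ∀ c, Φ (C.d c) = X.d (Φ c)) : ∃ x, X.d x = Φ (j κ) := by
  have h0 : q (j κ) = (T.quot J).d 0 := by
    rw [hqj, map_zero]
    exact Ideal.Quotient.eq_zero_iff_mem.2 hκJ
  obtain ⟨x, _, hx, _⟩ := hq.exists_lift (d_map_eq_zero j hκ) h0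
  exact ⟨Φ x, by rw [← hΦd, hx]⟩

end Transfer

/-! ### Products of morphisms -/

section Product

variable {A₁ A₂ B₁ B₂ : CDGA.{u}}

/-- Boundaries form a subspace that omits `ω`. Such a `ψ` makes `id ⊗ ψ` an `A₁`-linear chain map
`A₁ ⊗ A₂ → A₁` with `1 ⊗ ω ↦ 1`; no grading is asked of it. -/
theorem exists_functional {A : CDGA.{u}} {ω : A} (h : ¬ ∃ x, A.d x = ω) :
    ∃ ψ : A →ₗ[ℚ] ℚ, ψ ω = 1 ∧ ∀ x, ψ (A.d x) = 0 := by
  obtain ⟨ψ, hψ, hle⟩ := Submodule.exists_le_ker_of_notMem (p := LinearMap.range A.d) (v := ω) h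
  refine ⟨(ψ ω)⁻¹ • ψ, ?_, fun x => ?_⟩
  · rw [LinearMap.smul_apply, smul_eq_mul, inv_mul_cancel₀ hψ]
  · have : ψ (A.d x) = 0 := hle ⟨x, rfl⟩
    rw [LinearMap.smul_apply, this, smul_zero]

theorem not_exists_d_eq_one {A : CDGA.{u}} (hA : Nontrivial A.Homology) : ¬ ∃ x, A.d x = 1 := by
  intro h
  have : (1 : A.Homology) = 0 := cls_eq_zero (hz := d_one).2 h
  exact one_ne_zero this

theorem sliceRight_inl_mul (ψ : A₂ →ₗ[ℚ] ℚ) (a : A₁) (z : A₁.tensor A₂) :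
    sliceRight A₁ A₂ ψ (inl A₁ A₂ a * z) = a * sliceRight A₁ A₂ ψ z := by
  induction z using tmul_induction with
  | zero => rw [mul_zero, map_zero, mul_zero]
  | add x y h h' => rw [mul_add, map_add, h, h', map_add, mul_add]
  | tmul i j b x _ _ => rw [inl_mul_tmul, sliceRight_tmul, sliceRight_tmul, mul_smul_comm]

theorem sliceRight_d {ψ : A₂ →ₗ[ℚ] ℚ} (hψ : ∀ x, ψ (A₂.d x) = 0) (z : A₁.tensor A₂) :
    sliceRight A₁ A₂ ψ ((A₁.tensor A₂).d z) = A₁.d (sliceRight A₁ A₂ ψ z) := by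
  induction z using tmul_induction with
  | zero => simp only [map_zero]
  | add x y h h' => simp only [map_add, h, h']
  | tmul i j b x _ _ =>
    rw [tensor_d_tmul, map_add, sliceRight_tmul, sliceRight_tmul, sliceRight_tmul, hψ, zero_smul,
      add_zero, map_smul]

theorem sliceRight_inr (ψ : A₂ →ₗ[ℚ] ℚ) (b : A₂) :
    sliceRight A₁ A₂ ψ (inr A₁ A₂ b) = ψ b • 1 := sliceRight_tmul ψ 1 b

/-! ### Consequences of a retraction onto a tensor product -/

section Retraction

variable {S T C : CDGA.{u}} {I : DGIdeal S} {J : DGIdeal T} {g : Hom S T} {κ : T} {j : Hom T C}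
  {μ : Hom T (A₁.tensor A₂)} {ω : A₂}

/-- The transfer is applied to `Φ = (id ⊗ ψ) ∘ r`. It is `S`-linear because `μ ∘ g` factors through
`A₁`, a chain map because `ψ` kills boundaries, and it sends `j κ` to `ψ ω = 1`. -/
theorem exists_retraction_of_tensor (hκ : T.d κ = 0)
    (hJ : ∀ x ∈ I.toIdeal, g x * κ ∈ J.toIdeal) (hj : IsRelSullivanModel (T.quotMk J) j)
    (r : ModuleHom j μ) (hr : ∀ t, r.toLinearMap (j t) = μ t) (ν : Hom S A₁)
    (hν : ∀ s, μ (g s) = inl A₁ A₂ (ν s)) (hμκ : μ κ = inr A₁ A₂ ω) (hω : ¬ ∃ x, A₂.d x = ω) :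
    ∃ (M : CDGA.{u}) (i : Hom S M), IsRelSullivanModel (S.quotMk I) i ∧
      ∃ r : ModuleHom i ν, ∀ s, r.toLinearMap (i s) = ν s := by
  obtain ⟨_, q, hq, hqj⟩ := hj
  obtain ⟨ψ, hψω, hψ⟩ := exists_functional hω
  refine exists_retraction g hκ hJ j q hq hqj (sliceRight A₁ A₂ ψ ∘ₗ r.toLinearMap) ν ?_ ?_ ?_
  · intro s c
    rw [LinearMap.comp_apply, r.map_act, hν, sliceRight_inl_mul, LinearMap.comp_apply]
  · intro c
    rw [LinearMap.comp_apply, r.map_d, sliceRight_d hψ, LinearMap.comp_apply]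
  · rw [LinearMap.comp_apply, hr, hμκ, sliceRight_inr, hψω, one_smul]

/-- If `κ` were in `J`, its image in the model would be a boundary, and so would its image `ψ ω • 1
= 1` in `A₁`. -/
theorem not_mem_of_retraction (hA₁ : Nontrivial A₁.Homology) (hκ : T.d κ = 0)
    (hj : IsRelSullivanModel (T.quotMk J) j) (r : ModuleHom j μ)
    (hr : ∀ t, r.toLinearMap (j t) = μ t) (hμκ : μ κ = inr A₁ A₂ ω) (hω : ¬ ∃ x, A₂.d x = ω) :
    κ ∉ J.toIdeal := by
  intro hκJ
  obtain ⟨_, q, hq, hqj⟩ := hj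
  obtain ⟨ψ, hψω, hψ⟩ := exists_functional hω
  obtain ⟨x, hx⟩ := exists_boundary hκ hκJ j q hq hqj (sliceRight A₁ A₂ ψ ∘ₗ r.toLinearMap)
    (fun c => by rw [LinearMap.comp_apply, r.map_d, sliceRight_d hψ, LinearMap.comp_apply])
  rw [LinearMap.comp_apply, hr, hμκ, sliceRight_inr, hψω, one_smul] at hx
  exact not_exists_d_eq_one hA₁ ⟨x, hx⟩

end Retraction

/-! ### The inequality for `amsecat`: a detecting cycle in a power of the kernel -/

variable (φ₁ : Hom A₁ B₁) (φ₂ : Hom A₂ B₂)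

theorem inl_mem_ker {x : A₁} (hx : x ∈ φ₁.ker.toIdeal) :
    inl A₁ A₂ x ∈ (tensorMap φ₁ φ₂).ker.toIdeal := by
  have hx' : φ₁ x = 0 := hx
  change tensorMap φ₁ φ₂ (tmul x 1) = 0
  rw [tensorMap_tmul, hx', zero_tmul]

theorem inr_mem_ker {x : A₂} (hx : x ∈ φ₂.ker.toIdeal) :
    inr A₁ A₂ x ∈ (tensorMap φ₁ φ₂).ker.toIdeal := by
  have hx' : φ₂ x = 0 := hx
  change tensorMap φ₁ φ₂ (tmul 1 x) = 0
  rw [tensorMap_tmul, hx', tmul_zero]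

theorem map_mem_pow {S T : CDGA.{u}} (g : Hom S T) {I : DGIdeal S} {J : DGIdeal T}
    (h : ∀ x ∈ I.toIdeal, g x ∈ J.toIdeal) (n : ℕ) {x : S} (hx : x ∈ I.toIdeal ^ n) :
    g x ∈ J.toIdeal ^ n := by
  induction n generalizing x with
  | zero => rw [Submodule.pow_zero, Ideal.one_eq_top]; trivial
  | succ n ih =>
    rw [Submodule.pow_succ] at hx ⊢
    refine Submodule.smul_induction_on hx (fun x hx y hy => ?_) (fun x y hx hy => ?_)
    · rw [smul_eq_mul, map_mul]
      exact Submodule.smul_mem_smul (ih hx) (h y hy)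
    · rw [map_add]; exact add_mem hx hy

theorem mul_mem_pow_add {R : Type*} [Ring R] (I : Ideal R) [I.IsTwoSided] {m n : ℕ} {x y : R}
    (hx : x ∈ I ^ m) (hy : y ∈ I ^ n) : x * y ∈ I ^ (m + n) := by
  induction n generalizing y with
  | zero => exact Ideal.mul_mem_right y _ hx
  | succ n ih =>
    rw [Submodule.pow_succ] at hy
    rw [← add_assoc, Submodule.pow_succ]
    refine Submodule.smul_induction_on hy (fun a ha b hb => ?_) (fun a b ha hb => ?_)
    · rw [smul_eq_mul, ← mul_assoc]
      exact Submodule.smul_mem_smul (ih ha) hb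
    · rw [mul_add]; exact add_mem ha hb

/-- The element `κ = 1 ⊗ ω` lies in the `n`-th power of the kernel `K` of the product. Hence `κ` is
in `K ^ (m + 1)` if `n > m`; otherwise, with `m = p + n`, multiplication by `κ` sends `K₁ ^ (p + 1)`
into `K ^ (p + n + 1)`. -/
theorem le_and_hasModuleHomotopyRetraction (hA₁ : Nontrivial A₁.Homology) {m n : ℕ} {ω : A₂}
    (hdω : A₂.d ω = 0) (hωK : ω ∈ φ₂.ker.toIdeal ^ n) (hω : ¬ ∃ x, A₂.d x = ω)
    (hm : HasModuleHomotopyRetraction (rho (tensorMap φ₁ φ₂) m)) :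
    n ≤ m ∧ HasModuleHomotopyRetraction (rho φ₁ (m - n)) := by
  obtain ⟨C, j, hj, r, hr⟩ := hm
  have hκ : (A₁.tensor A₂).d (inr A₁ A₂ ω) = 0 := d_map_eq_zero _ hdω
  have hκK : inr A₁ A₂ ω ∈ (tensorMap φ₁ φ₂).ker.toIdeal ^ n :=
    map_mem_pow _ (fun x hx => inr_mem_ker φ₁ φ₂ hx) n hωK
  have hle : n ≤ m := by
    by_contra hlt
    refine not_mem_of_retraction hA₁ hκ hj r hr rfl hω ?_
    exact Ideal.pow_le_pow_right (show m + 1 ≤ n by omega) hκK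
  refine ⟨hle, ?_⟩
  obtain ⟨p, rfl⟩ : ∃ p, m = p + n := ⟨m - n, by omega⟩
  rw [Nat.add_sub_cancel]
  refine exists_retraction_of_tensor (g := inl A₁ A₂) hκ (fun x hx => ?_) hj r hr (Hom.id A₁)
    (fun _ => rfl) rfl hω
  have hx' := map_mem_pow _ (fun x hx => inl_mem_ker φ₁ φ₂ hx) (p + 1) hx
  change _ ∈ (tensorMap φ₁ φ₂).ker.toIdeal ^ (p + n + 1)
  rw [add_right_comm]
  exact mul_mem_pow_add _ hx' hκK

/-- For `n = 0` the unit serves, as `H(A₂) ≠ 0`. For `n = k + 1` the map `H(ρ_k)` is not injective,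
and a nonzero class that it kills gets a representative in the power `k + 1` of the kernel once the
boundary of a lifted primitive is subtracted. -/
theorem exists_cycle_of_le_ahsecat (hA₂ : Nontrivial A₂.Homology) {n : ℕ}
    (hn : (n : ℕ∞) ≤ ahsecat φ₂) :
    ∃ ω : A₂, A₂.d ω = 0 ∧ ω ∈ φ₂.ker.toIdeal ^ n ∧ ¬ ∃ x, A₂.d x = ω := by
  rcases n with _ | k
  · refine ⟨1, d_one, ?_, not_exists_d_eq_one hA₂⟩
    rw [Submodule.pow_zero, Ideal.one_eq_top]; trivial
  have hk : ¬ Function.Injective (rho φ₂ k).homologyMap := by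
    intro hk
    have h1 : ahsecat φ₂ ≤ k := iInf₂_le k hk
    have h2 := hn.trans h1
    exact absurd (Nat.cast_le.1 h2) (by omega)
  simp only [Function.Injective, not_forall] at hk
  obtain ⟨a, b, hab, hne⟩ := hk
  obtain ⟨z, hz, rfl⟩ := cls_surjective a
  obtain ⟨w, hw, rfl⟩ := cls_surjective b
  rw [homologyMap_cls, homologyMap_cls, cls_eq] at hab
  obtain ⟨y, hy⟩ := hab
  obtain ⟨x, rfl⟩ := quotMk_surjective _ _ y
  rw [← Hom.map_d] at hy
  refine ⟨z - w - A₂.d x, by rw [map_sub, map_sub, hz, hw, A₂.d_d, sub_zero, sub_zero], ?_, ?_⟩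
  · have : rho φ₂ k (z - w - A₂.d x) = 0 := by
      rw [map_sub, map_sub, ← hy]
      exact sub_self _
    exact Ideal.Quotient.eq_zero_iff_mem.1 this
  · rintro ⟨x', hx'⟩
    exact hne (cls_eq.2 ⟨x' + x, by rw [map_add, hx', sub_add_cancel]⟩)

/-- The additivity of `amsecat` and `ahsecat`. -/
theorem amsecat_add_ahsecat_le (hA₁ : Nontrivial A₁.Homology) (hA₂ : Nontrivial A₂.Homology) :
    amsecat φ₁ + ahsecat φ₂ ≤ amsecat (tensorMap φ₁ φ₂) := by
  refine le_iInf₂ fun m hm => ?_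
  have key : ∀ n : ℕ, (n : ℕ∞) ≤ ahsecat φ₂ → n ≤ m ∧ amsecat φ₁ ≤ (m - n : ℕ) := by
    intro n hn
    obtain ⟨ω, hdω, hωK, hω⟩ := exists_cycle_of_le_ahsecat φ₂ hA₂ hn
    obtain ⟨hle, hr⟩ := le_and_hasModuleHomotopyRetraction φ₁ φ₂ hA₁ hdω hωK hω hm
    exact ⟨hle, iInf₂_le (m - n) hr⟩
  generalize ahsecat φ₂ = s at key
  induction s using ENat.recTopCoe with
  -- If `ahsecat φ₂` were infinite, `n = m + 1` would contradict `n ≤ m`.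
  | top => exact absurd (key (m + 1) le_top).1 (by omega)
  | coe n =>
    obtain ⟨hle, h⟩ := key n le_rfl
    refine (add_le_add_left h _).trans ?_
    rw [← Nat.cast_add, Nat.sub_add_cancel hle]

/-! ### Products of elements of an ideal -/

/-- Additively, `I ^ n` is generated by the elements `r * x₁ ⋯ xₙ` with all `xᵢ` in `I`, so it
vanishes if all these products of `n` elements do. No commutativity is needed, which suits a
homology algebra commutative only up to sign. -/
theorem exists_list_prod_ne_zero {R : Type u} [Ring R] (I : Ideal R) {n : ℕ} (h : I ^ n ≠ ⊥) :
    ∃ l : List R, l.length = n ∧ (∀ x ∈ l, x ∈ I) ∧ l.prod ≠ 0 := by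
  have key : ∀ n, ∀ x ∈ I ^ n, x ∈ AddSubgroup.closure
      {y | ∃ r, ∃ l : List R, l.length = n ∧ (∀ x ∈ l, x ∈ I) ∧ y = r * l.prod} := by
    intro n
    induction n with
    | zero =>
      exact fun x _ => AddSubgroup.subset_closure ⟨x, [], rfl, by simp, by simp⟩
    | succ n ih =>
      intro x hx
      rw [Submodule.pow_succ] at hx
      refine Submodule.smul_induction_on hx (fun x hx y hy => ?_) (fun x y => add_mem)
      rw [smul_eq_mul]
      refine AddSubgroup.closure_induction (p := fun x _ => x * y ∈ _) ?_ ?_ ?_ ?_ (ih x hx)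
      · rintro _ ⟨r, l, hl, hlI, rfl⟩
        refine AddSubgroup.subset_closure ⟨r, l ++ [y], by simp [hl], ?_, ?_⟩
        · intro z hz
          rcases List.mem_append.1 hz with hz | hz
          · exact hlI z hz
          · rwa [List.mem_singleton.1 hz]
        · rw [List.prod_append, List.prod_singleton, mul_assoc]
      · rw [zero_mul]; exact zero_mem _
      · intro a b _ _ ha hb; rw [add_mul]; exact add_mem ha hb
      · intro a _ ha; rw [neg_mul]; exact neg_mem ha
  by_contra hcon
  refine h ((Submodule.eq_bot_iff _).2 fun x hx => ?_)
  refine AddSubgroup.closure_induction (p := fun x _ => x = 0) ?_ rfl ?_ ?_ (key n x hx)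
  · rintro _ ⟨r, l, hl, hlI, rfl⟩
    have : l.prod = 0 := by
      by_contra h0
      exact hcon ⟨l, hl, hlI, h0⟩
    rw [this, mul_zero]
  · rintro a b _ _ rfl rfl; exact add_zero _
  · rintro a _ rfl; exact neg_zero

theorem cls_mul {A : CDGA.{u}} {z w : A} (hz : A.d z = 0) (hw : A.d w = 0) :
    cls A z hz * cls A w hw = cls A (z * w) (A.cycles.mul_mem hz hw) := rfl

variable {φ₂} in
-- Surjectivity of `φ₂` enters here: a primitive of `φ₂ z` lifts to some `x` in `A₂`, and `z - d x`
-- represents the same class and lies in the kernel.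
theorem exists_cycle_in_ker (hφ₂ : Function.Surjective φ₂) {a : A₂.Homology}
    (ha : φ₂.homologyMap a = 0) : ∃ k hk, φ₂ k = 0 ∧ cls A₂ k hk = a := by
  obtain ⟨z, hz, rfl⟩ := cls_surjective a
  rw [homologyMap_cls, cls_eq_zero] at ha
  obtain ⟨y, hy⟩ := ha
  obtain ⟨x, rfl⟩ := hφ₂ y
  refine ⟨z - A₂.d x, by rw [map_sub, hz, A₂.d_d, sub_zero], ?_, ?_⟩
  · rw [map_sub, φ₂.map_d, hy, sub_self]
  · exact cls_eq.2 ⟨-x, by rw [map_neg]; abel⟩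

variable {φ₂} in
theorem exists_list_of_cycles (hφ₂ : Function.Surjective φ₂) (l : List A₂.Homology)
    (hl : ∀ a ∈ l, φ₂.homologyMap a = 0) : ∃ l' : List A₂, l'.length = l.length ∧
      (∀ k ∈ l', A₂.d k = 0 ∧ φ₂ k = 0) ∧ ∃ h, cls A₂ l'.prod h = l.prod := by
  induction l with
  | nil => exact ⟨[], rfl, by simp, d_one, rfl⟩
  | cons a l ih =>
    obtain ⟨l', hlen, hl', h, hc⟩ := ih fun b hb => hl b (List.mem_cons_of_mem _ hb)
    obtain ⟨k, hk, hk0, rfl⟩ := exists_cycle_in_ker hφ₂ (hl a List.mem_cons_self)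
    refine ⟨k :: l', by simp [hlen], ?_, ?_⟩
    · intro b hb
      rcases List.mem_cons.1 hb with rfl | hb
      exacts [⟨hk, hk0⟩, hl' b hb]
    · have := cls_mul hk h
      rw [hc] at this
      rw [List.prod_cons, List.prod_cons, this]
      exact ⟨_, rfl⟩

variable {φ₂} in
theorem exists_cycles_of_pow_ne_bot (hφ₂ : Function.Surjective φ₂) {n : ℕ}
    (hn : RingHom.ker φ₂.homologyMap ^ n ≠ ⊥) : ∃ l : List A₂, l.length = n ∧
      (∀ k ∈ l, A₂.d k = 0 ∧ φ₂ k = 0) ∧ ¬ ∃ x, A₂.d x = l.prod := by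
  obtain ⟨l, hlen, hl, hprod⟩ := exists_list_prod_ne_zero _ hn
  obtain ⟨l', hlen', hl', h, hc⟩ := exists_list_of_cycles hφ₂ l hl
  refine ⟨l', hlen'.trans hlen, hl', fun hx => hprod ?_⟩
  rw [← hc]
  exact cls_eq_zero.2 hx

/-! ### Tensor powers of a product -/

theorem mulPow_inl {A : CDGA.{u}} (m : ℕ) (x : A.tensorPow m) :
    A.mulPow (m + 1) (inl (A.tensorPow m) A x) = A.mulPow m x :=
  (tensorLift_tmul (A.mulPow m) (Hom.id A) x 1).trans (mul_one _)

theorem mulPow_tmul {A : CDGA.{u}} (m : ℕ) (x : A.tensorPow m) (y : A) :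
    A.mulPow (m + 1) (tmul x y : (A.tensorPow m).tensor A) = A.mulPow m x * y := rfl

theorem tmul_mem_tensor {A B : CDGA.{u}} {I : DGIdeal A} {J : DGIdeal B} {x : A} {y : B}
    (hx : x ∈ I.toIdeal) (hy : y ∈ J.toIdeal) : tmul x y ∈ (I.tensor J).toIdeal :=
  tm_mem_tensorIdealSpan hx hy

theorem map_mem_tensor {A B A' B' : CDGA.{u}} {I : DGIdeal A} {J : DGIdeal B} {I' : DGIdeal A'}
    {J' : DGIdeal B'} (f : Hom A A') (g : Hom B B') (hf : ∀ x ∈ I.toIdeal, f x ∈ I'.toIdeal)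
    (hg : ∀ y ∈ J.toIdeal, g y ∈ J'.toIdeal) {z : A.tensor B} (hz : z ∈ (I.tensor J).toIdeal) :
    tensorMap f g z ∈ (I'.tensor J').toIdeal := by
  refine tensorIdeal_induction (P := fun z => tensorMap f g z ∈ (I'.tensor J').toIdeal)
    ?_ ?_ ?_ ?_ hz
  · exact (map_zero (tensorMap f g).toAlgHom).symm ▸ zero_mem _
  · intro x y h h'
    exact (map_add (tensorMap f g).toAlgHom x y).symm ▸ add_mem h h'
  · intro r x h
    refine (map_smul (tensorMap f g).toAlgHom r x).symm ▸ ?_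
    exact Submodule.smul_mem (tensorIdealSpan I' J') r h
  · intro i j x y _ _ hx hy
    exact (tensorMap_tmul f g x y).symm ▸ tmul_mem_tensor (hf x hx) (hg y hy)

variable (A₁ A₂) in
/-- The inclusion `A₁^{⊗ (m + 1)} → (A₁ ⊗ A₂)^{⊗ (m + 1)}`. -/
def inlPow : (m : ℕ) → Hom (A₁.tensorPow m) ((A₁.tensor A₂).tensorPow m)
  | 0 => inl A₁ A₂
  | m + 1 => tensorMap (inlPow m) (inl A₁ A₂)

theorem inlPow_mem (m : ℕ) {x : A₁.tensorPow m} (hx : x ∈ (φ₁.ker.tensorPow m).toIdeal) :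
    inlPow A₁ A₂ m x ∈ ((tensorMap φ₁ φ₂).ker.tensorPow m).toIdeal := by
  induction m with
  | zero => exact inl_mem_ker φ₁ φ₂ hx
  | succ m ih => exact map_mem_tensor _ _ (fun x hx => ih hx) (fun x hx => inl_mem_ker φ₁ φ₂ hx) hx

theorem mulPow_inlPow (m : ℕ) (x : A₁.tensorPow m) :
    (A₁.tensor A₂).mulPow m (inlPow A₁ A₂ m x) = inl A₁ A₂ (A₁.mulPow m x) := by
  induction m with
  | zero => rfl
  | succ m ih =>
    refine tmul_induction (P := fun x => (A₁.tensor A₂).mulPow (m + 1) (inlPow A₁ A₂ (m + 1) x) =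
      inl A₁ A₂ (A₁.mulPow (m + 1) x)) ?_ ?_ ?_ x
    · exact (congrArg _ (map_zero (inlPow A₁ A₂ (m + 1)).toAlgHom)).trans
        ((map_zero ((A₁.tensor A₂).mulPow (m + 1)).toAlgHom).trans
        ((congrArg _ (map_zero (A₁.mulPow (m + 1)).toAlgHom)).trans (map_zero _)).symm)
    · intro x y h h'
      exact (congrArg _ (map_add (inlPow A₁ A₂ (m + 1)).toAlgHom x y)).trans
        ((map_add ((A₁.tensor A₂).mulPow (m + 1)).toAlgHom _ _).trans
        (((congrArg _ (map_add (A₁.mulPow (m + 1)).toAlgHom x y)).trans (map_add _ _ _)).trans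
          (congrArg₂ _ h.symm h'.symm)).symm)
    · intro i j a b _ _
      refine (congrArg _ (tensorMap_tmul (inlPow A₁ A₂ m) (inl A₁ A₂) a b)).trans ?_
      rw [mulPow_tmul, mulPow_tmul, ih, map_mul]

theorem d_tmul_eq_zero {A B : CDGA.{u}} {x : A} {y : B} (hx : A.d x = 0) (hy : B.d y = 0) :
    (A.tensor B).d (tmul x y) = 0 := by
  rw [tensor_d_tmul, hx, hy, zero_tmul, tmul_zero, add_zero]

/-- Here `g` includes `A₁^{⊗ (p + 1)}` into the first `p + 1` factors, and `κ = 1 ⊗ (1 ⊗ k₁) ⊗ ⋯ ⊗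
(1 ⊗ kₙ)` fills the remaining ones with elements of the kernel. Thus `g x * κ` has all its factors
in the kernel, and multiplication collapses `κ` to the product of the `kᵢ`. -/
theorem exists_tensorPow_map (p n : ℕ) (l : List A₂) (hlen : l.length = n)
    (hl : ∀ k ∈ l, A₂.d k = 0 ∧ φ₂ k = 0) :
    ∃ (g : Hom (A₁.tensorPow p) ((A₁.tensor A₂).tensorPow (p + n)))
      (κ : (A₁.tensor A₂).tensorPow (p + n)),
      ((A₁.tensor A₂).tensorPow (p + n)).d κ = 0 ∧
      (∀ x ∈ (φ₁.ker.tensorPow p).toIdeal,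
        g x * κ ∈ ((tensorMap φ₁ φ₂).ker.tensorPow (p + n)).toIdeal) ∧
      (∀ s, (A₁.tensor A₂).mulPow (p + n) (g s) = inl A₁ A₂ (A₁.mulPow p s)) ∧
      (A₁.tensor A₂).mulPow (p + n) κ = inr A₁ A₂ l.prod := by
  induction n generalizing l with
  | zero =>
    obtain rfl := List.length_eq_zero_iff.1 hlen
    refine ⟨inlPow A₁ A₂ p, 1, d_one, fun x hx => ?_, mulPow_inlPow p, ?_⟩
    · rw [mul_one]; exact inlPow_mem φ₁ φ₂ p hx
    · rw [List.prod_nil, map_one, map_one]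
  | succ n ih =>
    obtain rfl | ⟨l, k, rfl⟩ := List.eq_nil_or_concat l
    · simp at hlen
    rw [List.concat_eq_append] at *
    obtain ⟨g, κ, hκ, hgκ, hg, hμκ⟩ := ih l (by simpa using hlen)
      fun b hb => hl b (List.mem_append_left _ hb)
    obtain ⟨hk, hk0⟩ := hl k (by simp)
    refine ⟨(inl _ _).comp g, (tmul κ (inr A₁ A₂ k) : ((A₁.tensor A₂).tensorPow (p + n)).tensor _),
      d_tmul_eq_zero hκ (d_map_eq_zero _ hk), fun x hx => ?_, fun s => ?_, ?_⟩
    · refine (inl_mul_tmul (g x) κ (inr A₁ A₂ k)).symm ▸ ?_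
      exact tmul_mem_tensor (hgκ x hx) (inr_mem_ker φ₁ φ₂ hk0)
    · exact (mulPow_inl _ _).trans (hg s)
    · rw [List.prod_append, List.prod_singleton, map_mul, ← hμκ]
      rfl

/-- With `m + 1` cycles of the kernel every tensor factor can be occupied, so the element itself
lies in the ideal. This excludes `n > m`. -/
theorem exists_mem_tensorPow (m : ℕ) (l : List A₂) (hlen : l.length = m + 1)
    (hl : ∀ k ∈ l, A₂.d k = 0 ∧ φ₂ k = 0) :
    ∃ κ : (A₁.tensor A₂).tensorPow m, ((A₁.tensor A₂).tensorPow m).d κ = 0 ∧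
      κ ∈ ((tensorMap φ₁ φ₂).ker.tensorPow m).toIdeal ∧
      (A₁.tensor A₂).mulPow m κ = inr A₁ A₂ l.prod := by
  induction m generalizing l with
  | zero =>
    obtain ⟨k, rfl⟩ := List.length_eq_one_iff.1 hlen
    obtain ⟨hk, hk0⟩ := hl k (by simp)
    exact ⟨inr A₁ A₂ k, d_map_eq_zero _ hk, inr_mem_ker φ₁ φ₂ hk0, by
      rw [List.prod_singleton]; rfl⟩
  | succ m ih =>
    obtain rfl | ⟨l, k, rfl⟩ := List.eq_nil_or_concat l
    · simp at hlen
    rw [List.concat_eq_append] at *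
    obtain ⟨κ, hκ, hκK, hμκ⟩ := ih l (by simpa using hlen)
      fun b hb => hl b (List.mem_append_left _ hb)
    obtain ⟨hk, hk0⟩ := hl k (by simp)
    refine ⟨(tmul κ (inr A₁ A₂ k) : ((A₁.tensor A₂).tensorPow m).tensor _),
      d_tmul_eq_zero hκ (d_map_eq_zero _ hk),
      tmul_mem_tensor hκK (inr_mem_ker φ₁ φ₂ hk0), ?_⟩
    rw [List.prod_append, List.prod_singleton, map_mul, ← hμκ]
    rfl

/-! ### The inequality for `msecat` -/

variable {φ₂} in
theorem le_and_msecatLE (hφ₂ : Function.Surjective φ₂) (hA₁ : Nontrivial A₁.Homology) {m n : ℕ}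
    (hn : RingHom.ker φ₂.homologyMap ^ n ≠ ⊥) (hm : MsecatLE (tensorMap φ₁ φ₂) m) :
    n ≤ m ∧ MsecatLE φ₁ (m - n) := by
  obtain ⟨C, j, hj, r, hr⟩ := hm
  obtain ⟨l, hlen, hl, hprod⟩ := exists_cycles_of_pow_ne_bot hφ₂ hn
  have hle : n ≤ m := by
    by_contra hlt
    -- Only the first `m + 1` of the `n` cycles fit into the tensor factors. Their product is not a
    -- boundary either, since multiplying a primitive by the remaining cycles would give a primitive
    -- of the whole product.
    obtain ⟨κ, hκ, hκK, hμκ⟩ := exists_mem_tensorPow φ₁ φ₂ m (l.take (m + 1))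
      (by rw [List.length_take]; omega) fun k hk => hl k (List.mem_of_mem_take hk)
    refine not_mem_of_retraction hA₁ hκ hj r hr hμκ ?_ hκK
    rintro ⟨x, hx⟩
    have hd : A₂.d (l.drop (m + 1)).prod = 0 :=
      A₂.cycles.toSubmonoid.list_prod_mem fun k hk => (hl k (List.mem_of_mem_drop hk)).1
    refine hprod ⟨x * (l.drop (m + 1)).prod, ?_⟩
    rw [d_mul, hd, mul_zero, add_zero, hx, List.prod_take_mul_prod_drop]
  refine ⟨hle, ?_⟩
  obtain ⟨p, rfl⟩ : ∃ p, m = p + n := ⟨m - n, by omega⟩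
  rw [Nat.add_sub_cancel]
  obtain ⟨g, κ, hκ, hgκ, hg, hμκ⟩ := exists_tensorPow_map φ₁ φ₂ p n l hlen hl
  exact exists_retraction_of_tensor hκ hgκ hj r hr (A₁.mulPow p) hg hμκ hprod

variable {φ₂} in
/-- The additivity of `msecat` and the nilpotency of the kernel in homology. -/
theorem msecat_add_nil_le (hφ₂ : Function.Surjective φ₂) (hA₁ : Nontrivial A₁.Homology)
    (hA₂ : Nontrivial A₂.Homology) :
    msecat φ₁ + nil (RingHom.ker φ₂.homologyMap) ≤ msecat (tensorMap φ₁ φ₂) := by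
  refine le_iInf₂ fun m hm => ?_
  have key : ∀ n : ℕ, RingHom.ker φ₂.homologyMap ^ n ≠ ⊥ → msecat φ₁ + n ≤ m := by
    intro n hn
    obtain ⟨hle, h⟩ := le_and_msecatLE φ₁ hφ₂ hA₁ hn hm
    have h' : msecat φ₁ ≤ (m - n : ℕ) := iInf₂_le (m - n) h
    refine (add_le_add_left h' _).trans ?_
    rw [← Nat.cast_add, Nat.sub_add_cancel hle]
  -- The exponent `0` shows that `msecat φ₁` is finite, so that it can be subtracted from `m` to
  -- bound the supremum defining `nil`. The zeroth power is nonzero because `H(A₂) ≠ 0`.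
  have h0 : RingHom.ker φ₂.homologyMap ^ 0 ≠ ⊥ := by
    rw [Submodule.pow_zero, Ideal.one_eq_top]
    exact top_ne_bot
  obtain ⟨c, hc⟩ := ENat.ne_top_iff_exists.1
    (ne_top_of_le_ne_top (ENat.natCast_ne_top m) (le_self_add.trans (key 0 h0)))
  rw [← hc] at key ⊢
  have hcm : c ≤ m := by exact_mod_cast le_self_add.trans (key 0 h0)
  have hnil : nil (RingHom.ker φ₂.homologyMap) ≤ (m - c : ℕ) := iSup₂_le fun n hn => by
    have : c + n ≤ m := by exact_mod_cast key n hn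
    exact Nat.cast_le.2 (by omega)
  refine (add_le_add_right hnil _).trans ?_
  rw [← Nat.cast_add, Nat.add_sub_cancel' hcm]

end Product

end CDGA
end RHT
end

theorem mainTheorem5 {A₁ B₁ A₂ B₂ : RHT.CDGA.{u}}
    (φ₁ : RHT.CDGA.Hom A₁ B₁) (φ₂ : RHT.CDGA.Hom A₂ B₂)
    (hφ₁ : Function.Surjective φ₁) (hφ₂ : Function.Surjective φ₂)
    (hA₁ : Nontrivial A₁.Homology) (hA₂ : Nontrivial A₂.Homology) :
    RHT.CDGA.amsecat φ₁ + RHT.CDGA.ahsecat φ₂ ≤ RHT.CDGA.amsecat (RHT.CDGA.tensorMap φ₁ φ₂) ∧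
    RHT.CDGA.msecat φ₁ + RHT.CDGA.nil (RingHom.ker φ₂.homologyMap) ≤
      RHT.CDGA.msecat (RHT.CDGA.tensorMap φ₁ φ₂) :=
  ⟨RHT.CDGA.amsecat_add_ahsecat_le φ₁ φ₂ hA₁ hA₂,
    RHT.CDGA.msecat_add_nil_le φ₁ hφ₂ hA₁ hA₂⟩
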